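/- Let $\mathbb K$ be a field of characteristic zero and $d\in\mathbb Z$. Operads below have two colours, white and black; put $\varepsilon_\circ=d$, $\varepsilon_\bullet=d+1$. **The operad $\mathcal Holie_{d,d+1}$** is the dg 2-coloured operad which is free, as a graded operad, on corollas $\mathfrak C^{\circ}_{m+n}$ with white output, $m$ black and $n$ white inputs ($m+n\ge 2$ or $(m,n)=(1,0)$), and corollas $\mathfrak C^\bullet_m$ with black output and $m\geq 2$ black inputs. They have cohomological degrees $1+d-(d+1)m-dn$ and $2+d-(d+1)m$ respectively, and exchanging two inputs of colours $x,y$ multiplies a corolla by $(-1)^{\varepsilon_x\varepsilon_y}$. Its differential sends a corolla to the signed sum of all trees with two vertices which are obtained by splitting it. Precisely, for a corolla $C(I;k)$ with finite ordered set of inputs $I$ and output colour $k$, $$\delta\, C(I;k)=P_k\sum_{S\subseteq I}\ \sum_{l\in\{\circ,\bullet\}} \sigma(S)\,\eta_l\,(-1)^{(1+\varepsilon_l-\varepsilon(S))\,\varepsilon(I\setminus S)}\; C(\{*\}\sqcup (I\setminus S);k)\circ_* C(S;l),$$ where the new input $*$ has colour $l$ and comes first, $\varepsilon(S)=\sum_{i\in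 S}\varepsilon_i$ is the sum over the colours of the inputs in $S$, $\sigma(S)$ is the Koszul sign of moving $S$ in front of $I\setminus S$ (inputs of colour $x$ having parity $\varepsilon_x$), $P_\bullet=-1$, $P_\circ=1$, $\eta_\bullet=1$, $\eta_\circ=(-1)^d$, and corollas which are not among the generators are read as $0$. **The operad $\mathcal Gra_{d,d+1}$.** Its operations with white output, $m$ black and $n$ white inputs ($m+n\ge1$) are the elements of the product over $p\ge 0$ of the spaces spanned by directed graphs (connected or not) with $m$ labelled black vertices, $n$ labelled white vertices and $p$ numbered directed edges, without closed directed paths and without edges starting at white vertices, modulo the relation that renumbering the edges by a permutation $\tau$ multiplies a graph by $\mathrm{sgn}(\tau)^d$. Operations with black output are defined in the same way with $n=0$, and vanish for $n>0$. Every edge has degree $-d$, the differential is zero, and $\Gamma_1\circ_i\Gamma_2$ is the substitution of $\Gamma_2$ into the vertex $i$ of $\Gamma_1$, summed over all ways to re-attach the edge ends at $i$ to vertices of $\Gamma_2$ (the edges of $\Gamma_1$ are numbered before those of $\Gamma_2$). **The deformation complex.** Let $\mathsf{Def}=\mathsf{Def}(\mathcal Holie_{d,d+1}\xrightarrow{0}\mathcal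 Gra_{d,d+1})$ be the graded space of all families $F$ assigning to each generating corolla type an element of $\mathcal Gra_{d,d+1}$ with the same inputs and output, compatibly with relabelling of inputs (with the symmetry of the generators). $F$ has degree $g$ if $F(C(I;k))$ has degree $g+\varepsilon_k-\varepsilon(I)$. It carries the pre-Lie product, for $G$ of degree $g$, $$(F\circ G)(I;k)=\sum_{S\subseteq I}\sum_{l}\sigma(S)\,\eta_l\,(-1)^{(g+\varepsilon_l-\varepsilon(S))\varepsilon(I\setminus S)}\,F(\{*\}\sqcup (I\setminus S);k)\circ_* G(S;l).$$ A Maurer–Cartan element is an element $F$ of degree $1$ with $F\circ F=0$. Let $\widehat{\mathsf{OGC}}_{d,d+1}\subset\mathsf{Def}$ be the subspace of those $F$ all of whose values are combinations of connected graphs. A graph with unlabelled vertices is identified with the family obtained by summing, with Koszul signs, over all labellings of its vertices. **Proposition.** 1. There is a morphism of dg 2-coloured operads $f:\mathcal Holie_{d,d+1}\to\mathcal Gra_{d,d+1}$ with $$f(\mathfrak C^\bullet_2)=(\bullet_1\to\bullet_2)+(-1)^{d+1}(\bullet_2\to\bullet_1),$$ with $f(\mathfrak C^\circ_{1+n})$,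 for every $n\ge0$, equal to the star with white output consisting of one black vertex, $n$ white vertices and $n$ edges, the $j$-th edge going from the black vertex to the $j$-th white vertex, and with $f=0$ on all other generating corollas. 2. The element $\gamma=(\gamma^\circ,\gamma^\bullet)$, where $\gamma^\bullet=(\bullet\to\bullet)$ with black output and $$\gamma^\circ=\sum_{n\ge 0}\frac1{n!}\,(\text{star with a black centre, $n$ white vertices and $n$ edges from the centre to them})$$ with white output, is a Maurer–Cartan element of $\widehat{\mathsf{OGC}}_{d,d+1}$: it lies in this subspace, has degree $1$, and $\gamma\circ\gamma=0$. The values of $f$ on the generating corollas are the values of $\gamma$. 3. This corresponds to 1 as follows: a family $F$ of elements of $\mathcal Gra_{d,d+1}$, one for each finite ordered set of coloured inputs and each output colour, is a Maurer–Cartan element of $\mathsf{Def}$ if and only if there is a morphism of dg 2-coloured operads $\mathcal Holie_{d,d+1}\to\mathcal Gra_{d,d+1}$ whose values on the generating corollas are given by $F$ (and which is zero, by convention, on types of corollas that are not generators); the morphism is then unique. -/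

import Mathlib

namespace HolieGra

/-- The two colours of inputs and outputs. In pictures of corollas black legs are drawn solid and
white legs dotted. -/
inductive Colour where
  | white
  | black

/-- The integer attached to a colour: an input of colour `x` of a generating corolla contributes
`-eps d x` to its degree, and two inputs of colours `x`, `y` are interchanged with the sign
`(-1) ^ (eps d x * eps d y)`. So black inputs are (skew)symmetric according to the parity of `d + 1`
and white inputs according to the parity of `d`. -/
def eps (d : ℤ) : Colour → ℤ
  | .white => d
  | .black => d + 1

open Classical in
/-- The Koszul sign of a relabelling `e : I ≃ J` of ordered finite sets, inputs of colour `c`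
being of parity `eps d c`: the product of `(-1) ^ (eps d (c x) * eps d (c y))` over all pairs
`x < y` with `e y < e x`. -/
noncomputable def koszul (d : ℤ) {I J : Type} (c : I → Colour) (o : LinearOrder I) (e : I ≃ J)
    (o' : LinearOrder J) : ℤˣ :=
  ∏ᶠ p : I × I, if o.lt p.1 p.2 ∧ o'.lt (e p.2) (e p.1)
    then (eps d (c p.1) * eps d (c p.2)).negOnePow else 1

open Classical in
/-- The Koszul sign of moving all elements of `S` in front of the elements of its complement. -/
noncomputable def unshuffle (d : ℤ) {I : Type} (c : I → Colour) (o : LinearOrder I)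
    (S : Set I) : ℤˣ :=
  ∏ᶠ p : I × I, if p.1 ∈ S ∧ p.2 ∉ S ∧ o.lt p.2 p.1
    then (eps d (c p.1) * eps d (c p.2)).negOnePow else 1

/-- The finite set `I ∖ {i}`. -/
abbrev Without {I : Type} (i : I) : Type := {x : I // x ≠ i}

/-- The colours of the inputs of the partial composition `a ∘_i b`, whose set of inputs is
`(I ∖ {i}) ⊔ J`. -/
abbrev graftColour {I J : Type} (c : I → Colour) (i : I) (c' : J → Colour) :
    Without i ⊕ J → Colour :=
  Sum.elim (fun x => c x.1) c'

universe u v w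

/-- The data of a 2-coloured operad in graded `K`-vector spaces, in the form with inputs labelled
by finite sets. `obj I c k` is the space of operations with set of inputs `I`, with the `i`-th input of
colour `c i`, and with output of colour `k`; `deg n` is the subspace of homogeneous elements of
degree `n`; `relabel` is the action of bijections of inputs (for `J = I` and `c' = c` of the symmetric
groups); `unit k` are the identity operations; `comp i` is the partial composition `∘_i`, which is
defined when the output colour of the second operation is the colour of the input `i`. Only two
explicitly constructed instances are used below. -/
structure OperadData (K : Type u) [Field K] where
  obj : (I : Type) → [Finite I] → (I → Colour) → Colour → Type v
  [addCommGroup : ∀ (I : Type) [Finite I] (c : I → Colour) (k : Colour), AddCommGroup (obj I c k)]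
  [module : ∀ (I : Type) [Finite I] (c : I → Colour) (k : Colour), Module K (obj I c k)]
  deg : ∀ {I : Type} [Finite I] {c : I → Colour} {k : Colour}, ℤ → Submodule K (obj I c k)
  relabel : ∀ {I J : Type} [Finite I] [Finite J] {c : I → Colour} {c' : J → Colour} {k : Colour}
    (e : I ≃ J), (∀ i, c' (e i) = c i) → (obj I c k →ₗ[K] obj J c' k)
  unit : ∀ k : Colour, obj Unit (fun _ => k) k
  comp : ∀ {I J : Type} [Finite I] [Finite J] {c : I → Colour} {c' : J → Colour} {k l : Colour}
    (i : I), c i = l →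
      (obj I c k →ₗ[K] obj J c' l →ₗ[K] obj (Without i ⊕ J) (graftColour c i c') k)

attribute [instance] OperadData.addCommGroup OperadData.module

/-- The data of a 2-coloured operad together with a differential. -/
structure DGOperadData (K : Type u) [Field K] extends OperadData.{u, v} K where
  diff : ∀ {I : Type} [Finite I] {c : I → Colour} {k : Colour}, obj I c k →ₗ[K] obj I c k

/-- A type of generating corolla: a finite ordered set `I` of inputs with colours `c`, and the
colour `k` of the output. -/
structure Profile where
  I : Type
  [fin : Finite I]
  ord : LinearOrder I
  c : I → Colour
  k : Colour

attribute [instance] Profile.fin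

/-- Families of operations, one for each type of corolla. -/
abbrev OperadData.Family {K : Type u} [Field K] (P : OperadData.{u, v} K) : Type (max 1 v) :=
  ∀ p : Profile, P.obj p.I p.c p.k

/-- The order on `{⊥} ⊔ (I ∖ S)` for which `⊥` comes first. -/
abbrev outerOrder {I : Type} (o : LinearOrder I) (S : Set I) :
    LinearOrder (WithBot {x : I // x ∉ S}) :=
  inferInstance

/-- The induced order on `S`. -/
abbrev innerOrder {I : Type} (o : LinearOrder I) (S : Set I) : LinearOrder {x : I // x ∈ S} :=
  inferInstance

/-- The colours on `{⊥} ⊔ (I ∖ S)`, where the new input `⊥` has colour `l`. -/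
def outerColour {I : Type} (c : I → Colour) (S : Set I) (l : Colour) :
    WithBot {x : I // x ∉ S} → Colour :=
  WithBot.recBotCoe l (fun x => c x.1)

theorem outerColour_bot {I : Type} (c : I → Colour) (S : Set I) (l : Colour) :
    outerColour c S l ⊥ = l := rfl

open Classical in
/-- The bijection `(({⊥} ⊔ (I ∖ S)) ∖ {⊥}) ⊔ S ≃ I`. -/
noncomputable def unsplit {I : Type} (S : Set I) :
    Without (⊥ : WithBot {x : I // x ∉ S}) ⊕ {x : I // x ∈ S} ≃ I where
  toFun := Sum.elim (fun x => (x.1.unbot x.2).1) (fun x => x.1)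
  invFun x := if h : x ∈ S then .inr ⟨x, h⟩
    else .inl ⟨((⟨x, h⟩ : {x : I // x ∉ S}) : WithBot {x : I // x ∉ S}), WithBot.coe_ne_bot⟩
  left_inv := by
    rintro (⟨x, hx⟩ | ⟨x, hx⟩)
    · induction x using WithBot.recBotCoe with
      | bot => exact absurd rfl hx
      | coe x => simp [x.2]
    · simp [hx]
  right_inv x := by
    by_cases h : x ∈ S <;> simp [h]

theorem unsplit_colour {I : Type} (c : I → Colour) (S : Set I) (l : Colour)
    (x : Without (⊥ : WithBot {x : I // x ∉ S}) ⊕ {x : I // x ∈ S}) :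
    c (unsplit S x) = graftColour (outerColour c S l) ⊥ (fun x : {x : I // x ∈ S} => c x.1) x := by
  rcases x with ⟨x, hx⟩ | ⟨x, hx⟩
  · induction x using WithBot.recBotCoe with
    | bot => exact absurd rfl hx
    | coe x => simp [unsplit, outerColour]
  · simp [unsplit]

/-- The sum of `eps d` over all inputs. -/
noncomputable def totalEps (d : ℤ) {I : Type} (c : I → Colour) : ℤ :=
  ∑ᶠ i, eps d (c i)

/-- The sign `(-1) ^ d` for white and `1` for black. -/
def colourSign (d : ℤ) : Colour → ℤˣ
  | .white => d.negOnePow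
  | .black => 1

section
variable {K : Type u} [Field K]

/-- The summand of the convolution pre-Lie product below which corresponds to the tree with two
vertices, whose upper vertex has the set `S` of inputs and whose inner edge has colour `l`. The
sign consists of the Koszul sign of unshuffling `S` in front of its complement, of a sign depending
only on `l`, and of the Koszul sign for moving an operation of the degree of `G ⟨S, l⟩` past the
inputs not in `S`. Here `g` is the degree of the family `G`. -/
noncomputable def OperadData.convTerm (P : OperadData.{u, v} K) (d g : ℤ) (F G : P.Family)
    (p : Profile) (l : Colour) (S : Set p.I) : P.obj p.I p.c p.k :=
  (unshuffle d p.c p.ord S * colourSign d l *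
      ((g + eps d l - totalEps d (fun x : {x : p.I // x ∈ S} => p.c x.1)) *
        totalEps d (fun x : {x : p.I // x ∉ S} => p.c x.1)).negOnePow) •
    P.relabel (unsplit S) (unsplit_colour p.c S l)
      (P.comp (⊥ : WithBot {x : p.I // x ∉ S}) (outerColour_bot p.c S l)
        (F ⟨WithBot {x : p.I // x ∉ S}, outerOrder p.ord S, outerColour p.c S l, p.k⟩)
        (G ⟨{x : p.I // x ∈ S}, innerOrder p.ord S, fun x => p.c x.1, l⟩))

/-- The pre-Lie product of families of operations: the sum over all trees with two vertices, that is,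
over all subsets `S` of the set of inputs and all colours of the inner edge. The number `g` is the degree
of the second family. -/
noncomputable def OperadData.conv (P : OperadData.{u, v} K) (d g : ℤ) (F G : P.Family) : P.Family :=
  fun p =>
    ∑ᶠ S : Set p.I, (P.convTerm d g F G p .black S + P.convTerm d g F G p .white S)

/-- The types of the generating corollas of the 2-coloured operad of homotopy Lie algebras. With
black output: at least two inputs, all of them black. With white output: `m` black and `n` white
inputs, `m + n ≥ 1`, except for `(m, n) = (0, 1)`. -/
def Admissible {I : Type} (c : I → Colour) : Colour → Prop
  | .black => 2 ≤ Nat.card I ∧ ∀ i, c i = .black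
  | .white => 2 ≤ Nat.card I ∨ (Nat.card I = 1 ∧ ∀ i, c i = .black)

/-! ### The 2-coloured operad of homotopy Lie algebras -/

/-- Formal composites of the generating corollas: the terms built from the identities, the
generating corollas, relabellings and partial compositions. The corolla `gen o c k` has the set of
inputs `I`, ordered by `o`. -/
inductive Mono : (I : Type) → (I → Colour) → Colour → Type 1 where
  | unit (k : Colour) : Mono Unit (fun _ => k) k
  | gen {I : Type} [Finite I] (o : LinearOrder I) (c : I → Colour) (k : Colour)
      (h : Admissible c k) : Mono I c k
  | relabel {I J : Type} {c : I → Colour} {c' : J → Colour} {k : Colour} (e : I ≃ J)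
      (h : ∀ i, c' (e i) = c i) (a : Mono I c k) : Mono J c' k
  | comp {I J : Type} {c : I → Colour} {c' : J → Colour} {k l : Colour} (i : I) (h : c i = l)
      (a : Mono I c k) (b : Mono J c' l) : Mono (Without i ⊕ J) (graftColour c i c') k

/-- The cohomological degree. The corolla with `m` black and `n` white inputs has degree
`1 + (d + 1) - (d + 1) * m` if its output is black (then `n = 0`), and degree
`1 + d - (d + 1) * m - d * n` if its output is white. -/
noncomputable def Mono.deg (d : ℤ) : ∀ {I : Type} {c : I → Colour} {k : Colour}, Mono I c k → ℤ
  | _, _, _, .unit _ => 0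
  | _, _, _, @Mono.gen _ _ _ c k _ => 1 + eps d k - totalEps d c
  | _, _, _, .relabel _ _ a => a.deg d
  | _, _, _, .comp _ _ a b => a.deg d + b.deg d

/-- The bijection on the inputs of a partial composition induced by bijections. -/
def graftEquiv {I I' J J' : Type} (e : I ≃ I') (i : I) (e' : J ≃ J') :
    Without i ⊕ J ≃ Without (e i) ⊕ J' :=
  Equiv.sumCongr (e.subtypeEquiv (fun _ => by simp)) e'

/-- The identification of the inputs of `(a ∘_i b) ∘_j x` and `a ∘_i (b ∘_j x)`. -/
def assocEquiv {I J L : Type} (i : I) (j : J) :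
    Without (Sum.inr j : Without i ⊕ J) ⊕ L ≃ Without i ⊕ (Without j ⊕ L) where
  toFun
    | .inl ⟨.inl x, _⟩ => .inl x
    | .inl ⟨.inr y, h⟩ => .inr (.inl ⟨y, fun hy => h (congrArg Sum.inr hy)⟩)
    | .inr z => .inr (.inr z)
  invFun
    | .inl x => .inl ⟨.inl x, Sum.inl_ne_inr⟩
    | .inr (.inl y) => .inl ⟨.inr y.1, fun h => y.2 (Sum.inr_injective h)⟩
    | .inr (.inr z) => .inr z
  left_inv := by rintro (⟨x | y, h⟩ | z) <;> rfl
  right_inv := by rintro (x | y | z) <;> rfl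

/-- The identification of the inputs of `(a ∘_i b) ∘_j x` and `(a ∘_j x) ∘_i b`. -/
def parallelEquiv {I J L : Type} (i : I) (j : Without i) :
    Without (Sum.inl j : Without i ⊕ J) ⊕ L ≃
      Without (Sum.inl ⟨i, j.2.symm⟩ : Without j.1 ⊕ L) ⊕ J where
  toFun
    | .inl ⟨.inl x, h⟩ => .inl ⟨.inl ⟨x.1, fun hx => h (congrArg Sum.inl (Subtype.ext hx))⟩,
        fun hx => x.2 (congrArg Subtype.val (Sum.inl_injective hx))⟩
    | .inl ⟨.inr y, _⟩ => .inr y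
    | .inr z => .inl ⟨.inr z, Sum.inr_ne_inl⟩
  invFun
    | .inl ⟨.inl x, h⟩ => .inl ⟨.inl ⟨x.1, fun hx => h (congrArg Sum.inl (Subtype.ext hx))⟩,
        fun hx => x.2 (congrArg Subtype.val (Sum.inl_injective hx))⟩
    | .inl ⟨.inr z, _⟩ => .inr z
    | .inr y => .inl ⟨.inr y, Sum.inr_ne_inl⟩
  left_inv := by rintro (⟨x | y, h⟩ | z) <;> rfl
  right_inv := by rintro (⟨x | y, h⟩ | z) <;> rfl

/-- The identification of the inputs of `1 ∘ a` with those of `a`. -/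
def unitLeftEquiv (I : Type) : Without (() : Unit) ⊕ I ≃ I where
  toFun := Sum.elim (fun x => absurd rfl x.2) id
  invFun := Sum.inr
  left_inv := by
    rintro (⟨x, h⟩ | z)
    · exact absurd rfl h
    · rfl
  right_inv _ := rfl

open Classical in
/-- The identification of the inputs of `a ∘_i 1` with those of `a`. -/
noncomputable def unitRightEquiv {I : Type} (i : I) : Without i ⊕ Unit ≃ I where
  toFun := Sum.elim (fun x => x.1) (fun _ => i)
  invFun x := if h : x = i then .inr () else .inl ⟨x, h⟩
  left_inv := by
    rintro (⟨x, h⟩ | z)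
    · simp [h]
    · simp
  right_inv x := by
    by_cases h : x = i <;> simp [h]

/-- The relations between formal composites: `Rel d s a b` stands for `a = s b`, with a sign `s`.
They are generated by the axioms of a (graded, coloured) operad (`relabel_refl` to `comp_unit`),
together with the symmetry of the generating corollas (`gen`). -/
inductive Mono.Rel (d : ℤ) : ∀ {I : Type} {c : I → Colour} {k : Colour},
    ℤˣ → Mono I c k → Mono I c k → Prop where
  | refl {I : Type} {c : I → Colour} {k : Colour} (a : Mono I c k) : Rel d 1 a a
  | symm {I : Type} {c : I → Colour} {k : Colour} {s : ℤˣ} {a b : Mono I c k} :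
      Rel d s a b → Rel d s b a
  | trans {I : Type} {c : I → Colour} {k : Colour} {s t : ℤˣ} {a b x : Mono I c k} :
      Rel d s a b → Rel d t b x → Rel d (s * t) a x
  | relabel_congr {I J : Type} {c : I → Colour} {c' : J → Colour} {k : Colour} {s : ℤˣ}
      {a b : Mono I c k} (e : I ≃ J) (h : ∀ i, c' (e i) = c i) :
      Rel d s a b → Rel d s (a.relabel e h) (b.relabel e h)
  | comp_congr {I J : Type} {c : I → Colour} {c' : J → Colour} {k l : Colour} {s t : ℤˣ}
      {a a' : Mono I c k} {b b' : Mono J c' l} (i : I) (h : c i = l) :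
      Rel d s a a' → Rel d t b b' → Rel d (s * t) (a.comp i h b) (a'.comp i h b')
  | gen {I J : Type} [Finite I] [Finite J] (o : LinearOrder I) (o' : LinearOrder J)
      (c : I → Colour) (c' : J → Colour) (k : Colour) (e : I ≃ J) (h : ∀ i, c' (e i) = c i)
      (hc : Admissible c k) (hc' : Admissible c' k) :
      Rel d (koszul d c o e o') ((Mono.gen o c k hc).relabel e h) (Mono.gen o' c' k hc')
  | relabel_refl {I : Type} {c : I → Colour} {k : Colour} (a : Mono I c k)
      (h : ∀ i, c (Equiv.refl I i) = c i) : Rel d 1 (a.relabel (Equiv.refl I) h) a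
  | relabel_trans {I J L : Type} {c : I → Colour} {c' : J → Colour} {c'' : L → Colour}
      {k : Colour} (a : Mono I c k) (e : I ≃ J) (h : ∀ i, c' (e i) = c i) (e' : J ≃ L)
      (h' : ∀ j, c'' (e' j) = c' j) (h'' : ∀ i, c'' (e.trans e' i) = c i) :
      Rel d 1 ((a.relabel e h).relabel e' h') (a.relabel (e.trans e') h'')
  | comp_relabel {I I' J J' : Type} {c : I → Colour} {c₁ : I' → Colour} {c' : J → Colour}
      {c₁' : J' → Colour} {k l : Colour} (a : Mono I c k) (b : Mono J c' l) (i : I) (h : c i = l)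
      (e : I ≃ I') (he : ∀ i, c₁ (e i) = c i) (e' : J ≃ J') (he' : ∀ j, c₁' (e' j) = c' j)
      (h' : c₁ (e i) = l)
      (hg : ∀ x, graftColour c₁ (e i) c₁' (graftEquiv e i e' x) = graftColour c i c' x) :
      Rel d 1 ((a.relabel e he).comp (e i) h' (b.relabel e' he'))
        ((a.comp i h b).relabel (graftEquiv e i e') hg)
  | assoc {I J L : Type} {c : I → Colour} {c' : J → Colour} {c'' : L → Colour} {k l m : Colour}
      (a : Mono I c k) (b : Mono J c' l) (x : Mono L c'' m) (i : I) (h : c i = l) (j : J)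
      (h' : c' j = m) (h'' : graftColour c i c' (Sum.inr j) = m)
      (hg : ∀ y, graftColour c i (graftColour c' j c'') (assocEquiv i j y) =
        graftColour (graftColour c i c') (Sum.inr j) c'' y) :
      Rel d 1 (((a.comp i h b).comp (Sum.inr j) h'' x).relabel (assocEquiv i j) hg)
        (a.comp i h (b.comp j h' x))
  | parallel {I J L : Type} {c : I → Colour} {c' : J → Colour} {c'' : L → Colour}
      {k l m : Colour} (a : Mono I c k) (b : Mono J c' l) (x : Mono L c'' m) (i : I) (h : c i = l)
      (j : Without i) (h' : c j.1 = m) (h₁ : graftColour c i c' (Sum.inl j) = m)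
      (h₂ : graftColour c j.1 c'' (Sum.inl ⟨i, j.2.symm⟩) = l)
      (hg : ∀ y, graftColour (graftColour c j.1 c'') (Sum.inl ⟨i, j.2.symm⟩) c'
          (parallelEquiv i j y) = graftColour (graftColour c i c') (Sum.inl j) c'' y) :
      Rel d (b.deg d * x.deg d).negOnePow
        (((a.comp i h b).comp (Sum.inl j) h₁ x).relabel (parallelEquiv i j) hg)
        ((a.comp j.1 h' x).comp (Sum.inl ⟨i, j.2.symm⟩) h₂ b)
  | unit_comp {I : Type} {c : I → Colour} {k : Colour} (a : Mono I c k)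
      (hg : ∀ y, c (unitLeftEquiv I y) = graftColour (fun _ : Unit => k) () c y) :
      Rel d 1 (((Mono.unit k).comp () rfl a).relabel (unitLeftEquiv I) hg) a
  | comp_unit {I : Type} {c : I → Colour} {k l : Colour} (a : Mono I c k) (i : I) (h : c i = l)
      (hg : ∀ y, c (unitRightEquiv i y) = graftColour c i (fun _ : Unit => l) y) :
      Rel d 1 ((a.comp i h (Mono.unit l)).relabel (unitRightEquiv i) hg) a

variable (K)

/-- The subspace spanned by all `a - s b` with `a = s b` one of the relations. -/
noncomputable def relSpan (d : ℤ) (I : Type) (c : I → Colour) (k : Colour) : Submodule K (Mono I c k →₀ K) :=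
  Submodule.span K {x | ∃ (s : ℤˣ) (a b : Mono I c k), Mono.Rel d s a b ∧
    x = Finsupp.single a 1 - s • Finsupp.single b 1}

/-- The components of the free 2-coloured operad on the generating corollas. -/
abbrev FreeObj (d : ℤ) (I : Type) (c : I → Colour) (k : Colour) : Type (max 1 u) :=
  (Mono I c k →₀ K) ⧸ relSpan K d I c k

namespace FreeObj

variable {K} {d : ℤ} {I J : Type} {c : I → Colour} {c' : J → Colour} {k l : Colour}

/-- The class of a formal composite. -/
noncomputable def mk (a : Mono I c k) : FreeObj K d I c k :=
  (relSpan K d I c k).mkQ (Finsupp.single a 1)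

theorem mk_rel {s : ℤˣ} {a b : Mono I c k} (h : Mono.Rel d s a b) :
    (mk a : FreeObj K d I c k) = s • mk b := by
  have : (Finsupp.single a 1 - s • Finsupp.single b 1 : Mono I c k →₀ K) ∈ relSpan K d I c k :=
    Submodule.subset_span ⟨s, a, b, h, rfl⟩
  have h2 := (Submodule.Quotient.mk_eq_zero _).2 this
  rw [Submodule.Quotient.mk_sub, sub_eq_zero] at h2
  refine h2.trans ?_
  rcases Int.units_eq_one_or s with rfl | rfl
  · simp [mk]
  · simp [mk, Units.smul_def]

/-- A map on formal composites which respects the relations extends linearly. -/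
noncomputable def lift {M : Type*} [AddCommGroup M] [Module K M] (f : Mono I c k → M)
    (hf : ∀ (s : ℤˣ) (a b : Mono I c k), Mono.Rel d s a b → f a = s • f b) :
    FreeObj K d I c k →ₗ[K] M :=
  (relSpan K d I c k).liftQ (Finsupp.lift M K _ f) (by
    rw [relSpan, Submodule.span_le]
    rintro _ ⟨s, a, b, h, rfl⟩
    have := hf s a b h
    rcases Int.units_eq_one_or s with rfl | rfl
    · rw [one_smul, SetLike.mem_coe, LinearMap.mem_ker, map_sub]
      simpa [sub_eq_zero] using this
    · rw [Units.neg_smul, one_smul, sub_neg_eq_add, SetLike.mem_coe, LinearMap.mem_ker, map_add]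
      simpa [Units.smul_def, ← eq_neg_iff_add_eq_zero] using this)

@[simp] theorem lift_mk {M : Type*} [AddCommGroup M] [Module K M] (f : Mono I c k → M)
    (hf : ∀ (s : ℤˣ) (a b : Mono I c k), Mono.Rel d s a b → f a = s • f b) (a : Mono I c k) :
    lift f hf (mk a : FreeObj K d I c k) = f a := by
  simp [lift, mk]

theorem ext {M : Type*} [AddCommGroup M] [Module K M] {f g : FreeObj K d I c k →ₗ[K] M}
    (h : ∀ a, f (mk a) = g (mk a)) : f = g := by
  apply Submodule.linearMap_qext
  ext a
  simpa [mk] using h a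

/-- The action of bijections. -/
noncomputable def relabel (e : I ≃ J) (h : ∀ i, c' (e i) = c i) :
    FreeObj K d I c k →ₗ[K] FreeObj K d J c' k :=
  lift (fun a => mk (a.relabel e h)) (fun _ _ _ hr => mk_rel (hr.relabel_congr e h))

/-- The partial composition. -/
noncomputable def comp (i : I) (h : c i = l) : FreeObj K d I c k →ₗ[K] FreeObj K d J c' l →ₗ[K]
    FreeObj K d (Without i ⊕ J) (graftColour c i c') k :=
  lift (fun a => lift (fun b => mk (a.comp i h b))
      (fun s b b' hr => by
        simpa using mk_rel (K := K) (Mono.Rel.comp_congr i h (Mono.Rel.refl a) hr)))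
    (fun s a a' hr => by
      apply ext
      intro b
      have := mk_rel (K := K) (Mono.Rel.comp_congr i h hr (Mono.Rel.refl b))
      rcases Int.units_eq_one_or s with rfl | rfl
      · simpa using this
      · simpa [Units.smul_def] using this)

@[simp] theorem relabel_mk (e : I ≃ J) (h : ∀ i, c' (e i) = c i) (a : Mono I c k) :
    relabel e h (mk a : FreeObj K d I c k) = mk (a.relabel e h) := by
  simp [relabel]

@[simp] theorem comp_mk (i : I) (h : c i = l) (a : Mono I c k) (b : Mono J c' l) :
    comp i h (mk a : FreeObj K d I c k) (mk b) = mk (a.comp i h b) := by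
  simp [comp]


/-- The homogeneous elements of degree `n`. -/
noncomputable def deg (n : ℤ) : Submodule K (FreeObj K d I c k) :=
  Submodule.span K (mk '' {a | a.deg d = n})

end FreeObj

/-- The free 2-coloured operad (in graded vector spaces) generated by the corollas. -/
noncomputable def freeOperad (d : ℤ) : OperadData.{u, max 1 u} K where
  obj I _ c k := FreeObj K d I c k
  deg n := FreeObj.deg n
  relabel e h := FreeObj.relabel e h
  unit k := FreeObj.mk (Mono.unit k)
  comp i h := FreeObj.comp i h

open Classical in
/-- The generating corolla with ordered inputs, and zero if there is no such corolla. -/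
noncomputable def FreeObj.gen (d : ℤ) {I : Type} [Finite I] (o : LinearOrder I) (c : I → Colour)
    (k : Colour) : FreeObj K d I c k :=
  if h : Admissible c k then FreeObj.mk (Mono.gen o c k h) else 0

/-- The family of all generating corollas. -/
noncomputable def corolla (d : ℤ) : (freeOperad K d).Family :=
  fun p => FreeObj.gen K d p.ord p.c p.k

/-- A sign in the differential depending on the colour of the output. -/
def outSign : Colour → ℤˣ
  | .white => 1
  | .black => -1

/-- The differential, on formal composites. On a generating corolla it is, up to a sign depending
on the colour of the output, the sum over all trees with two vertices which are obtained by
splitting the corolla, where trees with a vertex that is not a generating corolla do not contribute;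
it is extended to all composites by the graded Leibniz rule. -/
noncomputable def Mono.diff (d : ℤ) : ∀ {I : Type} {c : I → Colour} {k : Colour},
    Mono I c k → FreeObj K d I c k
  | _, _, _, .unit _ => 0
  | _, _, _, @Mono.gen _ _ o c k _ =>
      outSign k • (freeOperad K d).conv d 1 (corolla K d) (corolla K d) ⟨_, o, c, k⟩
  | _, _, _, .relabel e h a => FreeObj.relabel e h (a.diff d)
  | _, _, _, .comp i h a b => FreeObj.comp i h (a.diff d) (FreeObj.mk b) +
      (a.deg d).negOnePow • FreeObj.comp i h (FreeObj.mk a) (b.diff d)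


theorem totalEps_equiv (d : ℤ) {I J : Type} {c : I → Colour} {c' : J → Colour} (e : I ≃ J)
    (h : ∀ i, c' (e i) = c i) : totalEps d c' = totalEps d c := by
  unfold totalEps
  rw [← finsum_comp_equiv e]
  simp [h]

theorem Mono.Rel.deg_eq {d : ℤ} {I : Type} {c : I → Colour} {k : Colour} {s : ℤˣ}
    {a b : Mono I c k} (h : Mono.Rel d s a b) : a.deg d = b.deg d := by
  induction h with
  | gen o o' c c' k e h hc hc' => simp [Mono.deg, totalEps_equiv d e h]
  | parallel a b x i h j h' h₁ h₂ hg => simp only [Mono.deg]; ring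
  | assoc a b x i h j h' h'' hg => simp only [Mono.deg]; ring
  | _ => simp_all [Mono.deg]

theorem totalEps_split (d : ℤ) {I : Type} [Finite I] (c : I → Colour) (S : Set I) :
    totalEps d c = totalEps d (fun x : {x : I // x ∈ S} => c x.1) +
      totalEps d (fun x : {x : I // x ∉ S} => c x.1) := by
  classical
  cases nonempty_fintype I
  simp only [totalEps, finsum_eq_sum_of_fintype]
  rw [← Fintype.sum_subtype_add_sum_subtype (fun x => x ∈ S)]

theorem totalEps_outer (d : ℤ) {I : Type} [Finite I] (c : I → Colour) (S : Set I) (l : Colour) :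
    totalEps d (outerColour c S l) = eps d l + totalEps d (fun x : {x : I // x ∉ S} => c x.1) := by
  classical
  cases nonempty_fintype I
  simp only [totalEps, finsum_eq_sum_of_fintype]
  exact Fintype.sum_option (fun x : Option {x : I // x ∉ S} => eps d (outerColour c S l x))

namespace FreeObj
variable {K} {d : ℤ} {I J : Type} {c : I → Colour} {c' : J → Colour} {k l : Colour}

theorem induction {p : FreeObj K d I c k → Prop} (x : FreeObj K d I c k)
    (hmk : ∀ a, p (mk a)) (hadd : ∀ x y, p x → p y → p (x + y))
    (hsmul : ∀ (r : K) x, p x → p (r • x)) (h0 : p 0) : p x := by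
  obtain ⟨f, rfl⟩ := Submodule.mkQ_surjective _ x
  induction f using Finsupp.induction_linear with
  | zero => simpa using h0
  | add f g hf hg => rw [map_add]; exact hadd _ _ hf hg
  | single a r =>
    have := hsmul r _ (hmk a)
    rw [mk, ← map_smul] at this
    simpa using this

theorem mk_mem_deg (a : Mono I c k) : (mk a : FreeObj K d I c k) ∈ deg (a.deg d) :=
  Submodule.subset_span ⟨a, rfl, rfl⟩

theorem relabel_mem_deg (e : I ≃ J) (h : ∀ i, c' (e i) = c i) {n : ℤ} {x : FreeObj K d I c k}
    (hx : x ∈ deg n) : relabel e h x ∈ deg n := by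
  unfold deg at hx
  induction hx using Submodule.span_induction with
  | mem x hx =>
    obtain ⟨a, ha, rfl⟩ := hx
    rw [relabel_mk]
    have := mk_mem_deg (K := K) (d := d) (a.relabel e h)
    rwa [Mono.deg, ha] at this
  | zero => simp
  | add x y _ _ hx hy => rw [map_add]; exact add_mem hx hy
  | smul r x _ hx => rw [map_smul]; exact Submodule.smul_mem _ _ hx

theorem comp_mem_deg (i : I) (h : c i = l) {n m : ℤ} {x : FreeObj K d I c k}
    {y : FreeObj K d J c' l} (hx : x ∈ deg n) (hy : y ∈ deg m) : comp i h x y ∈ deg (n + m) := by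
  unfold deg at hx hy
  induction hx using Submodule.span_induction with
  | mem x hx =>
    obtain ⟨a, ha, rfl⟩ := hx
    induction hy using Submodule.span_induction with
    | mem y hy =>
      obtain ⟨b, hb, rfl⟩ := hy
      rw [comp_mk]
      have := mk_mem_deg (K := K) (d := d) (a.comp i h b)
      rwa [Mono.deg, ha, hb] at this
    | zero => simp
    | add x y _ _ hx hy => rw [map_add]; exact add_mem hx hy
    | smul r x _ hx => rw [map_smul]; exact Submodule.smul_mem _ _ hx
  | zero => simp
  | add x y _ _ hx hy => rw [map_add]; exact add_mem hx hy
  | smul r x _ hx => rw [map_smul]; exact Submodule.smul_mem _ _ hx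

theorem units_smul_mem {M : Type*} [AddCommGroup M] [Module K M] (N : Submodule K M) (s : ℤˣ)
    {x : M} (hx : x ∈ N) : s • x ∈ N := by
  rcases Int.units_eq_one_or s with rfl | rfl
  · simpa
  · simpa [Units.smul_def]

theorem map_units_smul {M N : Type*} [AddCommGroup M] [Module K M] [AddCommGroup N] [Module K N]
    (f : M →ₗ[K] N) (s : ℤˣ) (x : M) : f (s • x) = s • f x := by
  rcases Int.units_eq_one_or s with rfl | rfl
  · simp
  · simp [Units.smul_def]

theorem units_smul_comm {M : Type*} [AddCommGroup M] (s t : ℤˣ) (x : M) :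
    s • t • x = t • s • x := by
  rw [smul_smul, smul_smul, mul_comm]

theorem units_smul_apply {M N : Type*} [AddCommGroup M] [Module K M] [AddCommGroup N]
    [Module K N] (f : M →ₗ[K] N) (s : ℤˣ) (x : M) : (s • f) x = s • f x := by
  rcases Int.units_eq_one_or s with rfl | rfl
  · simp
  · simp [Units.smul_def]

theorem comp_units_smul_left (i : I) (h : c i = l) (s : ℤˣ) (x : FreeObj K d I c k)
    (y : FreeObj K d J c' l) : comp i h (s • x) y = s • comp i h x y := by
  rw [map_units_smul]
  rcases Int.units_eq_one_or s with rfl | rfl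
  · simp
  · simp [Units.smul_def]

variable {L : Type} {c'' : L → Colour} {m : Colour}

theorem relabel_refl (x : FreeObj K d I c k) (h : ∀ i, c (Equiv.refl I i) = c i) :
    relabel (Equiv.refl I) h x = x := by
  induction x using FreeObj.induction with
  | hmk a => rw [relabel_mk, mk_rel (Mono.Rel.relabel_refl a h), one_smul]
  | hadd x y hx hy => rw [map_add, hx, hy]
  | hsmul r x hx => rw [map_smul, hx]
  | h0 => rw [map_zero]

theorem relabel_relabel (x : FreeObj K d I c k) (e : I ≃ J) (h : ∀ i, c' (e i) = c i) (e' : J ≃ L)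
    (h' : ∀ j, c'' (e' j) = c' j) (h'' : ∀ i, c'' (e.trans e' i) = c i) :
    relabel e' h' (relabel e h x) = relabel (e.trans e') h'' x := by
  induction x using FreeObj.induction with
  | hmk a => rw [relabel_mk, relabel_mk, relabel_mk,
      mk_rel (Mono.Rel.relabel_trans a e h e' h' h''), one_smul]
  | hadd x y hx hy => simp only [map_add, hx, hy]
  | hsmul r x hx => simp only [map_smul, hx]
  | h0 => simp only [map_zero]

theorem comp_relabel {I' J' : Type} {c₁ : I' → Colour} {c₁' : J' → Colour}
    (x : FreeObj K d I c k) (y : FreeObj K d J c' l) (i : I) (h : c i = l)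
    (e : I ≃ I') (he : ∀ i, c₁ (e i) = c i) (e' : J ≃ J') (he' : ∀ j, c₁' (e' j) = c' j)
    (h' : c₁ (e i) = l)
    (hg : ∀ x, graftColour c₁ (e i) c₁' (graftEquiv e i e' x) = graftColour c i c' x) :
    comp (e i) h' (relabel e he x) (relabel e' he' y) =
      relabel (graftEquiv e i e') hg (comp i h x y) := by
  induction x using FreeObj.induction with
  | hmk a =>
    induction y using FreeObj.induction with
    | hmk b => rw [relabel_mk, relabel_mk, comp_mk, comp_mk, relabel_mk,
        mk_rel (Mono.Rel.comp_relabel a b i h e he e' he' h' hg), one_smul]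
    | hadd x y hx hy => simp only [map_add, hx, hy]
    | hsmul r x hx => simp only [map_smul, hx]
    | h0 => simp only [map_zero]
  | hadd x y hx hy => simp only [map_add, LinearMap.add_apply, hx, hy]
  | hsmul r x hx => simp only [map_smul, LinearMap.smul_apply, hx]
  | h0 => simp only [map_zero, LinearMap.zero_apply]

theorem relabel_comp_relabel {I' J' : Type} {c₁ : I' → Colour} {c₁' : J' → Colour}
    (x : FreeObj K d I c k) (y : FreeObj K d J c' l) (i : I) (i' : I') (h : c i = l)
    (e : I ≃ I') (he : ∀ i, c₁ (e i) = c i) (e' : J ≃ J') (he' : ∀ j, c₁' (e' j) = c' j)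
    (hi : e i = i') (h' : c₁ i' = l) (E : Without i ⊕ J ≃ L) (E' : Without i' ⊕ J' ≃ L)
    (hE : ∀ z, c'' (E z) = graftColour c i c' z) (hE' : ∀ z, c'' (E' z) = graftColour c₁ i' c₁' z)
    (h1 : ∀ z : Without i, E' (Sum.inl ⟨e z.1, fun hz => z.2 (e.injective (hz.trans hi.symm))⟩) =
      E (Sum.inl z)) (h2 : ∀ j, E' (Sum.inr (e' j)) = E (Sum.inr j)) :
    relabel E' hE' (comp i' h' (relabel e he x) (relabel e' he' y)) =
      relabel E hE (comp i h x y) := by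
  subst hi
  have hg : ∀ x, graftColour c₁ (e i) c₁' (graftEquiv e i e' x) = graftColour c i c' x := by
    rintro (x | x)
    · exact he x.1
    · exact he' x
  have hEE : (graftEquiv e i e').trans E' = E := by
    ext z
    rcases z with z | z
    · exact h1 z
    · exact h2 z
  subst hEE
  rw [comp_relabel x y i h e he e' he' h' hg, relabel_relabel]

theorem assoc (x : FreeObj K d I c k) (y : FreeObj K d J c' l) (z : FreeObj K d L c'' m)
    (i : I) (h : c i = l) (j : J) (h' : c' j = m)
    (h'' : graftColour c i c' (Sum.inr j) = m)
    (hg : ∀ y, graftColour c i (graftColour c' j c'') (assocEquiv i j y) =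
      graftColour (graftColour c i c') (Sum.inr j) c'' y) :
    relabel (assocEquiv i j) hg (comp (Sum.inr j) h'' (comp i h x y) z) =
      comp i h x (comp j h' y z) := by
  induction x using FreeObj.induction with
  | hmk a =>
    induction y using FreeObj.induction with
    | hmk b =>
      induction z using FreeObj.induction with
      | hmk z => simp only [comp_mk, relabel_mk]; rw [mk_rel (Mono.Rel.assoc a b z i h j h' h'' hg),
          one_smul]
      | hadd x y hx hy => simp only [map_add, hx, hy]
      | hsmul r x hx => simp only [map_smul, hx]
      | h0 => simp only [map_zero]
    | hadd x y hx hy => simp only [map_add, LinearMap.add_apply, hx, hy]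
    | hsmul r x hx => simp only [map_smul, LinearMap.smul_apply, hx]
    | h0 => simp only [map_zero, LinearMap.zero_apply]
  | hadd x y hx hy => simp only [map_add, LinearMap.add_apply, hx, hy]
  | hsmul r x hx => simp only [map_smul, LinearMap.smul_apply, hx]
  | h0 => simp only [map_zero, LinearMap.zero_apply]

theorem parallel (x : FreeObj K d I c k) {n₁ n₂ : ℤ} {y : FreeObj K d J c' l}
    (hy : y ∈ deg n₁) {z : FreeObj K d L c'' m} (hz : z ∈ deg n₂)
    (i : I) (h : c i = l) (j : Without i) (h' : c j.1 = m)
    (h₁ : graftColour c i c' (Sum.inl j) = m)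
    (h₂ : graftColour c j.1 c'' (Sum.inl ⟨i, j.2.symm⟩) = l)
    (hg : ∀ y, graftColour (graftColour c j.1 c'') (Sum.inl ⟨i, j.2.symm⟩) c'
          (parallelEquiv i j y) = graftColour (graftColour c i c') (Sum.inl j) c'' y) :
    relabel (parallelEquiv i j) hg (comp (Sum.inl j) h₁ (comp i h x y) z) =
      (n₁ * n₂).negOnePow • comp (Sum.inl ⟨i, j.2.symm⟩) h₂ (comp j.1 h' x z) y := by
  unfold deg at hy hz
  induction x using FreeObj.induction with
  | hmk a =>
    induction hy using Submodule.span_induction with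
    | mem y hy =>
      obtain ⟨b, hb, rfl⟩ := hy
      induction hz using Submodule.span_induction with
      | mem z hz =>
        obtain ⟨z, hz, rfl⟩ := hz
        simp only [comp_mk, relabel_mk]
        rw [mk_rel (Mono.Rel.parallel a b z i h j h' h₁ h₂ hg), hb, hz]
      | zero => simp only [map_zero, LinearMap.zero_apply, smul_zero]
      | add x y _ _ hx hy => simp only [map_add, LinearMap.add_apply, hx, hy, smul_add]
      | smul r x _ hx =>
        simp only [map_smul, LinearMap.smul_apply, hx]; rw [smul_comm]
    | zero => simp only [map_zero, LinearMap.zero_apply, smul_zero]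
    | add x y _ _ hx hy => simp only [map_add, LinearMap.add_apply, hx, hy, smul_add]
    | smul r x _ hx =>
      simp only [map_smul, LinearMap.smul_apply, hx]; rw [smul_comm]
  | hadd x y hx hy => simp only [map_add, LinearMap.add_apply, hx, hy, smul_add]
  | hsmul r x hx => simp only [map_smul, LinearMap.smul_apply, hx]; rw [smul_comm]
  | h0 => simp only [map_zero, LinearMap.zero_apply, smul_zero]

theorem unit_comp (x : FreeObj K d I c k)
    (hg : ∀ y, c (unitLeftEquiv I y) = graftColour (fun _ : Unit => k) () c y) :
    relabel (unitLeftEquiv I) hg (comp () rfl (mk (Mono.unit k)) x) = x := by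
  induction x using FreeObj.induction with
  | hmk a => rw [comp_mk, relabel_mk, mk_rel (Mono.Rel.unit_comp a hg), one_smul]
  | hadd x y hx hy => simp only [map_add, hx, hy]
  | hsmul r x hx => simp only [map_smul, hx]
  | h0 => simp only [map_zero]

theorem comp_unit (x : FreeObj K d I c k) (i : I) (h : c i = l)
    (hg : ∀ y, c (unitRightEquiv i y) = graftColour c i (fun _ : Unit => l) y) :
    relabel (unitRightEquiv i) hg (comp i h x (mk (Mono.unit l))) = x := by
  induction x using FreeObj.induction with
  | hmk a => rw [comp_mk, relabel_mk, mk_rel (Mono.Rel.comp_unit a i h hg), one_smul]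
  | hadd x y hx hy => simp only [map_add, LinearMap.add_apply, hx, hy]
  | hsmul r x hx => simp only [map_smul, LinearMap.smul_apply, hx]
  | h0 => simp only [map_zero, LinearMap.zero_apply]

end FreeObj

theorem Admissible.congr {I J : Type} {c : I → Colour} {c' : J → Colour} {k : Colour} (e : I ≃ J)
    (h : ∀ i, c' (e i) = c i) (hc : Admissible c k) : Admissible c' k := by
  have hcard : Nat.card J = Nat.card I := (Nat.card_congr e).symm
  have hall : (∀ i, c i = .black) → ∀ j, c' j = .black := fun hb j => by
    rw [← e.apply_symm_apply j, h, hb]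
  cases k with
  | black => exact ⟨hcard ▸ hc.1, hall hc.2⟩
  | white => exact hc.imp (fun h => hcard ▸ h) (fun h => ⟨hcard ▸ h.1, hall h.2⟩)

theorem FreeObj.relabel_gen (d : ℤ) {I J : Type} [Finite I] [Finite J] {c : I → Colour}
    {c' : J → Colour} (k : Colour) (e : I ≃ J) (h : ∀ i, c' (e i) = c i) (o : LinearOrder I)
    (o' : LinearOrder J) :
    FreeObj.relabel e h (FreeObj.gen K d o c k) = koszul d c o e o' • FreeObj.gen K d o' c' k := by
  have h' : ∀ j, c (e.symm j) = c' j := fun j => by rw [← h, e.apply_symm_apply]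
  by_cases hc : Admissible c k
  · have hc' := hc.congr e h
    simp only [gen, hc, hc', dite_true]
    rw [FreeObj.relabel_mk]
    exact FreeObj.mk_rel (Mono.Rel.gen o o' c c' k e h hc hc')
  · have hc' : ¬ Admissible c' k := fun hh => hc (hh.congr e.symm h')
    simp only [gen, hc, hc', dite_false, smul_zero, map_zero]

theorem FreeObj.gen_mem_deg (d : ℤ) {I : Type} [Finite I] (o : LinearOrder I) (c : I → Colour)
    (k : Colour) : FreeObj.gen K d o c k ∈ FreeObj.deg (1 + eps d k - totalEps d c) := by
  unfold FreeObj.gen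
  split_ifs with h
  · exact FreeObj.mk_mem_deg (Mono.gen o c k h)
  · exact zero_mem _

/-- The splitting term in the free operad. -/
theorem convTerm_corolla (d : ℤ) (p : Profile) (l : Colour) (S : Set p.I) :
    (freeOperad K d).convTerm d 1 (corolla K d) (corolla K d) p l S =
      (unshuffle d p.c p.ord S * colourSign d l *
        ((1 + eps d l - totalEps d (fun x : {x : p.I // x ∈ S} => p.c x.1)) *
          totalEps d (fun x : {x : p.I // x ∉ S} => p.c x.1)).negOnePow) •
      FreeObj.relabel (unsplit S) (unsplit_colour p.c S l)
        (FreeObj.comp (⊥ : WithBot {x : p.I // x ∉ S}) (outerColour_bot p.c S l)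
          (FreeObj.gen K d (outerOrder p.ord S) (outerColour p.c S l) p.k)
          (FreeObj.gen K d (innerOrder p.ord S) (fun x => p.c x.1) l)) := rfl

theorem convTerm_mem_deg (d : ℤ) (p : Profile) (l : Colour) (S : Set p.I) :
    (freeOperad K d).convTerm d 1 (corolla K d) (corolla K d) p l S ∈
      (FreeObj.deg (1 + eps d p.k - totalEps d p.c + 1) :
        Submodule K (FreeObj K d p.I p.c p.k)) := by
  rw [convTerm_corolla]
  apply FreeObj.units_smul_mem
  apply FreeObj.relabel_mem_deg
  have h1 := FreeObj.gen_mem_deg K d (outerOrder p.ord S) (outerColour p.c S l) p.k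
  have h2 := FreeObj.gen_mem_deg K d (innerOrder p.ord S) (fun x => p.c x.1) l
  have h3 := FreeObj.comp_mem_deg (⊥ : WithBot {x : p.I // x ∉ S}) (outerColour_bot p.c S l) h1 h2
  have : 1 + eps d p.k - totalEps d p.c + 1 =
      (1 + eps d p.k - totalEps d (outerColour p.c S l)) +
        (1 + eps d l - totalEps d (fun x : {x : p.I // x ∈ S} => p.c x.1)) := by
    rw [totalEps_outer, totalEps_split d p.c S]; ring
  rw [this]
  exact h3

theorem finsum_mem_submodule {M ι : Type*} [AddCommGroup M] [Module K M] (N : Submodule K M)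
    (f : ι → M) (h : ∀ i, f i ∈ N) : ∑ᶠ i, f i ∈ N :=
  finsum_induction (· ∈ N) (zero_mem _) (fun _ _ => add_mem) h

theorem Mono.diff_mem_deg (d : ℤ) {I : Type} {c : I → Colour} {k : Colour} (a : Mono I c k) :
    Mono.diff K d a ∈ FreeObj.deg (a.deg d + 1) := by
  induction a with
  | unit k => exact zero_mem _
  | gen o c k h =>
    apply FreeObj.units_smul_mem
    apply finsum_mem_submodule
    intro S
    exact add_mem (convTerm_mem_deg K d ⟨_, o, c, k⟩ .black S)
      (convTerm_mem_deg K d ⟨_, o, c, k⟩ .white S)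
  | relabel e h a ih => exact FreeObj.relabel_mem_deg e h ih
  | comp i h a b iha ihb =>
    have h1 := FreeObj.comp_mem_deg i h iha (FreeObj.mk_mem_deg (K := K) (d := d) b)
    have h2 := FreeObj.comp_mem_deg i h (FreeObj.mk_mem_deg (K := K) (d := d) a) ihb
    simp only [Mono.deg, Mono.diff]
    refine add_mem ?_ (FreeObj.units_smul_mem _ _ ?_)
    · convert h1 using 2; ring
    · convert h2 using 2; ring

def innerEquiv {I J : Type} (e : I ≃ J) {S : Set I} {T : Set J} (hT : ∀ x, e x ∈ T ↔ x ∈ S) :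
    {x : I // x ∈ S} ≃ {x : J // x ∈ T} :=
  e.subtypeEquiv (fun x => (hT x).symm)

def outerEquiv {I J : Type} (e : I ≃ J) {S : Set I} {T : Set J} (hT : ∀ x, e x ∈ T ↔ x ∈ S) :
    WithBot {x : I // x ∉ S} ≃ WithBot {x : J // x ∉ T} :=
  Equiv.optionCongr (e.subtypeEquiv (fun x => not_congr (hT x).symm))

theorem prod_subtype_ite {I M : Type} [Finite I] [CommMonoid M] (p : I → Prop) [DecidablePred p]
    (f : I → M) : ∏ᶠ x : {x : I // p x}, f x.1 = ∏ᶠ x, if p x then f x else 1 := by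
  rw [finprod_subtype_eq_finprod_cond (f := f) p]
  congr! with x
  rw [finprod_eq_if]

theorem finprod_pair {I J M : Type} [Finite I] [Finite J] [CommMonoid M] (f : I × J → M) :
    ∏ᶠ p, f p = ∏ᶠ x, ∏ᶠ y, f (x, y) := by
  classical
  cases nonempty_fintype I
  cases nonempty_fintype J
  simp only [finprod_eq_prod_of_fintype, Fintype.prod_prod_type]

open Classical in
theorem koszul_inner (d : ℤ) {I J : Type} [Finite I] (c : I → Colour) (e : I ≃ J)
    (o : LinearOrder I) (o' : LinearOrder J) {S : Set I} {T : Set J}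
    (hT : ∀ x, e x ∈ T ↔ x ∈ S) :
    koszul d (fun x : {x : I // x ∈ S} => c x.1) (innerOrder o S) (innerEquiv e hT)
      (innerOrder o' T) = ∏ᶠ x, ∏ᶠ y, if (x ∈ S ∧ y ∈ S) ∧ o.lt x y ∧ o'.lt (e y) (e x)
        then (eps d (c x) * eps d (c y)).negOnePow else 1 := by
  unfold koszul
  rw [finprod_pair]
  have h1 : ∀ x : {x : I // x ∈ S}, (∏ᶠ y : {x : I // x ∈ S},
      if (innerOrder o S).lt x y ∧ (innerOrder o' T).lt (innerEquiv e hT y) (innerEquiv e hT x)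
        then (eps d (c x.1) * eps d (c y.1)).negOnePow else 1) =
      ∏ᶠ y, if y ∈ S then (if o.lt x.1 y ∧ o'.lt (e y) (e x.1)
        then (eps d (c x.1) * eps d (c y)).negOnePow else 1) else 1 := by
    intro x
    rw [← prod_subtype_ite (fun y => y ∈ S)]
    rfl
  refine (finprod_congr h1).trans ?_
  rw [prod_subtype_ite (fun x => x ∈ S) (fun x => ∏ᶠ y, if y ∈ S then
    (if o.lt x y ∧ o'.lt (e y) (e x) then (eps d (c x) * eps d (c y)).negOnePow else 1) else 1)]
  refine finprod_congr fun x => ?_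
  by_cases hx : x ∈ S
  · simp only [hx, if_true, true_and]
    refine finprod_congr fun y => ?_
    by_cases hy : y ∈ S <;> simp [hy]
  · simp [hx]

open Classical in
theorem koszul_outer (d : ℤ) {I J : Type} [Finite I] (c : I → Colour) (e : I ≃ J)
    (o : LinearOrder I) (o' : LinearOrder J) {S : Set I} {T : Set J}
    (hT : ∀ x, e x ∈ T ↔ x ∈ S) (l : Colour) :
    koszul d (outerColour c S l) (outerOrder o S) (outerEquiv e hT)
      (outerOrder o' T) = ∏ᶠ x, ∏ᶠ y, if (x ∉ S ∧ y ∉ S) ∧ o.lt x y ∧ o'.lt (e y) (e x)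
        then (eps d (c x) * eps d (c y)).negOnePow else 1 := by
  have key := koszul_inner d c e o o' (S := Sᶜ) (T := Tᶜ) (fun x => not_congr (hT x))
  simp only [Set.mem_compl_iff] at key
  rw [← key]
  unfold koszul
  rw [finprod_pair, finprod_pair]
  cases nonempty_fintype I
  simp only [finprod_eq_prod_of_fintype]
  have hbot : ∀ y : WithBot {x : I // x ∉ S}, ¬ (outerOrder o S).lt y ⊥ := fun y =>
    @not_lt_bot _ (outerOrder o S).toPreorder _ y
  have hbot' : ∀ y : WithBot {x : J // x ∉ T}, ¬ (outerOrder o' T).lt y ⊥ := fun y =>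
    @not_lt_bot _ (outerOrder o' T).toPreorder _ y
  refine (Fintype.prod_option (α := {x : I // x ∉ S}) _).trans ?_
  have hz : ∀ (s : ℤˣ) (q : Prop) [Decidable q], ¬ q → (if q then s else 1) = 1 :=
    fun s q _ h => if_neg h
  rw [Finset.prod_eq_one, one_mul]
  · refine Finset.prod_congr rfl fun x _ => ?_
    refine (Fintype.prod_option (α := {x : I // x ∉ S}) _).trans ?_
    rw [if_neg, one_mul]
    · refine Finset.prod_congr rfl fun y _ => ?_
      have hiff := and_congr (@WithBot.coe_lt_coe {x : I // x ∉ S} x y _)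
        (@WithBot.coe_lt_coe {x : J // x ∉ T} (innerEquiv (S := Sᶜ) (T := Tᶜ) e
          (fun x => not_congr (hT x)) y) (innerEquiv (S := Sᶜ) (T := Tᶜ) e
          (fun x => not_congr (hT x)) x) _)
      by_cases hq : (innerOrder o Sᶜ).lt x y ∧ (innerOrder o' Tᶜ).lt
          (innerEquiv (S := Sᶜ) (T := Tᶜ) e (fun x => not_congr (hT x)) y)
          (innerEquiv (S := Sᶜ) (T := Tᶜ) e (fun x => not_congr (hT x)) x)
      · exact (if_pos (hiff.2 hq)).trans (if_pos hq).symm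
      · exact (if_neg (fun hh => hq (hiff.1 hh))).trans (if_neg hq).symm
    · exact fun h => hbot _ h.1
  · intro y _
    exact if_neg fun h => hbot' _ h.2

open Classical in
theorem unshuffle_eq (d : ℤ) {I J : Type} [Finite I] [Finite J] {c : I → Colour} {c' : J → Colour}
    (e : I ≃ J) (h : ∀ i, c' (e i) = c i) (o' : LinearOrder J) {S : Set I} {T : Set J}
    (hT : ∀ x, e x ∈ T ↔ x ∈ S) :
    unshuffle d c' o' T = ∏ᶠ x, ∏ᶠ y, if x ∈ S ∧ y ∉ S ∧ o'.lt (e y) (e x)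
      then (eps d (c x) * eps d (c y)).negOnePow else 1 := by
  unfold unshuffle
  rw [finprod_pair, ← finprod_comp_equiv e]
  refine finprod_congr fun x => ?_
  rw [← finprod_comp_equiv e]
  simp only [hT, h]

theorem sign_split (d : ℤ) {I J : Type} [Finite I] [Finite J] {c : I → Colour} {c' : J → Colour}
    (e : I ≃ J) (h : ∀ i, c' (e i) = c i) (o : LinearOrder I) (o' : LinearOrder J)
    {S : Set I} {T : Set J} (hT : ∀ x, e x ∈ T ↔ x ∈ S) (l : Colour) :
    unshuffle d c o S = koszul d c o e o' * unshuffle d c' o' T *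
      (koszul d (outerColour c S l) (outerOrder o S) (outerEquiv e hT) (outerOrder o' T) *
        koszul d (fun x : {x : I // x ∈ S} => c x.1) (innerOrder o S) (innerEquiv e hT)
          (innerOrder o' T)) := by
  classical
  rw [koszul_inner, koszul_outer, unshuffle_eq d e h o' hT,
    unshuffle_eq d (Equiv.refl I) (fun _ => rfl) o (S := S) (T := S) (fun _ => Iff.rfl)]
  unfold koszul
  rw [finprod_pair]
  cases nonempty_fintype I
  simp only [finprod_eq_prod_of_fintype, Equiv.refl_apply]
  set w : I → I → ℤˣ := fun x y => (eps d (c x) * eps d (c y)).negOnePow with hw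
  have wsymm : ∀ x y, w x y = w y x := fun x y => by simp only [hw, mul_comm]
  have wsq : ∀ x y, w x y * w x y = 1 := fun x y => Int.units_mul_self _
  have swap : ∏ x, ∏ y, (if (x ∉ S ∧ y ∈ S) ∧ o.lt x y ∧ o'.lt (e y) (e x) then w x y else 1) =
      ∏ x, ∏ y, (if (y ∉ S ∧ x ∈ S) ∧ o.lt y x ∧ o'.lt (e x) (e y) then w x y else 1) := by
    rw [Finset.prod_comm]
    simp only [wsymm]
  have hK : ∏ x, ∏ y, (if o.lt x y ∧ o'.lt (e y) (e x) then w x y else 1) =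
      (∏ x, ∏ y, (if (x ∉ S ∧ y ∉ S) ∧ o.lt x y ∧ o'.lt (e y) (e x) then w x y else 1)) *
      (∏ x, ∏ y, (if (x ∈ S ∧ y ∈ S) ∧ o.lt x y ∧ o'.lt (e y) (e x) then w x y else 1)) *
      (∏ x, ∏ y, (if (x ∈ S ∧ y ∉ S) ∧ o.lt x y ∧ o'.lt (e y) (e x) then w x y else 1)) *
      (∏ x, ∏ y, (if (x ∉ S ∧ y ∈ S) ∧ o.lt x y ∧ o'.lt (e y) (e x) then w x y else 1)) := by
    simp only [← Finset.prod_mul_distrib]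
    refine Finset.prod_congr rfl fun x _ => Finset.prod_congr rfl fun y _ => ?_
    by_cases hx : x ∈ S <;> by_cases hy : y ∈ S <;> simp [hx, hy]
  have hA : ∏ x, ∏ y, (if x ∈ S ∧ y ∉ S ∧ o.lt y x then w x y else 1) =
      (∏ x, ∏ y, (if (x ∈ S ∧ y ∉ S) ∧ o.lt x y ∧ o'.lt (e y) (e x) then w x y else 1)) *
      (∏ x, ∏ y, (if (y ∉ S ∧ x ∈ S) ∧ o.lt y x ∧ o'.lt (e x) (e y) then w x y else 1)) *
      (∏ x, ∏ y, (if x ∈ S ∧ y ∉ S ∧ o'.lt (e y) (e x) then w x y else 1)) := by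
    simp only [← Finset.prod_mul_distrib]
    refine Finset.prod_congr rfl fun x _ => Finset.prod_congr rfl fun y _ => ?_
    by_cases hx : x ∈ S
    · by_cases hy : y ∈ S
      · simp [hx, hy]
      · have hne : x ≠ y := fun hxy => hy (hxy ▸ hx)
        have hne' : e x ≠ e y := fun hxy => hne (e.injective hxy)
        have h1 : o.lt x y ↔ ¬ o.lt y x :=
          ⟨fun h1 => (@lt_asymm _ o.toPreorder _ _ h1),
            fun h1 => (@lt_or_gt_of_ne _ o _ _ hne).resolve_right h1⟩
        have h2 : o'.lt (e x) (e y) ↔ ¬ o'.lt (e y) (e x) :=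
          ⟨fun h1 => (@lt_asymm _ o'.toPreorder _ _ h1),
            fun h1 => (@lt_or_gt_of_ne _ o' _ _ hne').resolve_right h1⟩
        simp only [hx, hy, h1, h2, not_false_eq_true, true_and]
        by_cases h3 : o.lt y x <;> by_cases h4 : o'.lt (e y) (e x) <;> simp [h3, h4, wsq]
    · simp [hx]
  change ∏ x, ∏ y, (if x ∈ S ∧ y ∉ S ∧ o.lt y x then w x y else 1) =
    (∏ x, ∏ y, (if o.lt x y ∧ o'.lt (e y) (e x) then w x y else 1)) *
    (∏ x, ∏ y, (if x ∈ S ∧ y ∉ S ∧ o'.lt (e y) (e x) then w x y else 1)) *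
    ((∏ x, ∏ y, (if (x ∉ S ∧ y ∉ S) ∧ o.lt x y ∧ o'.lt (e y) (e x) then w x y else 1)) *
      (∏ x, ∏ y, (if (x ∈ S ∧ y ∈ S) ∧ o.lt x y ∧ o'.lt (e y) (e x) then w x y else 1)))
  rw [hA, hK, swap]
  generalize (∏ x, ∏ y, (if (x ∉ S ∧ y ∉ S) ∧ o.lt x y ∧ o'.lt (e y) (e x) then w x y else 1)) = A
  generalize (∏ x, ∏ y, (if (x ∈ S ∧ y ∈ S) ∧ o.lt x y ∧ o'.lt (e y) (e x) then w x y else 1)) = B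
  have hA2 := Int.units_mul_self A
  have hB2 := Int.units_mul_self B
  generalize (∏ x, ∏ y, (if (x ∈ S ∧ y ∉ S) ∧ o.lt x y ∧ o'.lt (e y) (e x) then w x y else 1)) = C
  generalize (∏ x, ∏ y, (if (y ∉ S ∧ x ∈ S) ∧ o.lt y x ∧ o'.lt (e x) (e y) then w x y else 1)) = D
  generalize (∏ x, ∏ y, (if x ∈ S ∧ y ∉ S ∧ o'.lt (e y) (e x) then w x y else 1)) = U
  calc C * D * U = (A * A) * (B * B) * (C * D * U) := by rw [hA2, hB2]; simp
    _ = A * B * C * D * U * (A * B) := by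
      simp only [mul_comm, mul_left_comm]

theorem convTerm_relabel (d : ℤ) {I J : Type} [Finite I] [Finite J] {c : I → Colour}
    {c' : J → Colour} (k : Colour) (e : I ≃ J) (h : ∀ i, c' (e i) = c i) (o : LinearOrder I)
    (o' : LinearOrder J) {S : Set I} {T : Set J} (hT : ∀ x, e x ∈ T ↔ x ∈ S) (l : Colour) :
    FreeObj.relabel e h
        ((freeOperad K d).convTerm d 1 (corolla K d) (corolla K d) ⟨I, o, c, k⟩ l S) =
      koszul d c o e o' •
        (freeOperad K d).convTerm d 1 (corolla K d) (corolla K d) ⟨J, o', c', k⟩ l T := by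
  rw [convTerm_corolla, convTerm_corolla, FreeObj.map_units_smul]
  dsimp only
  have ho : ∀ x, outerColour c' T l (outerEquiv e hT x) = outerColour c S l x := by
    intro x
    induction x using WithBot.recBotCoe with
    | bot => rfl
    | coe x => exact h x.1
  have hi : ∀ x : {x : I // x ∈ S}, c' (innerEquiv e hT x).1 = c x.1 := fun x => h x.1
  have e1 := FreeObj.relabel_gen K d k (outerEquiv e hT) ho (outerOrder o S) (outerOrder o' T)
  have e2 := FreeObj.relabel_gen K d (c := fun x : {x : I // x ∈ S} => c x.1)
    (c' := fun x : {x : J // x ∈ T} => c' x.1) l (innerEquiv e hT) hi (innerOrder o S) (innerOrder o' T)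
  have e3 := FreeObj.relabel_comp_relabel (FreeObj.gen K d (outerOrder o S) (outerColour c S l) k)
    (FreeObj.gen K d (innerOrder o S) (fun x => c x.1) l) (⊥ : WithBot {x : I // x ∉ S})
    (⊥ : WithBot {x : J // x ∉ T}) (outerColour_bot c S l)
    (outerEquiv e hT) ho (innerEquiv e hT) hi rfl
    (outerColour_bot c' T l) ((unsplit S).trans e) (unsplit T)
    (fun x => by rw [Equiv.trans_apply, h, unsplit_colour c S l]) (unsplit_colour c' T l)
    (by
      rintro ⟨x, hx⟩
      induction x using WithBot.recBotCoe with
      | bot => exact absurd rfl hx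
      | coe x => rfl) (fun _ => rfl)
  rw [e1, e2, FreeObj.comp_units_smul_left, FreeObj.map_units_smul, FreeObj.map_units_smul,
    FreeObj.map_units_smul, smul_smul] at e3
  have hs := sign_split d e h o o' hT l
  have ht1 : totalEps d (fun x : {x : J // x ∈ T} => c' x.1) =
      totalEps d (fun x : {x : I // x ∈ S} => c x.1) := totalEps_equiv d (innerEquiv e hT) hi
  have ht2 : totalEps d (fun x : {x : J // x ∉ T} => c' x.1) =
      totalEps d (fun x : {x : I // x ∉ S} => c x.1) :=
    totalEps_equiv d (e.subtypeEquiv (fun x => not_congr (hT x).symm)) (fun x => h x.1)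
  rw [FreeObj.relabel_relabel (h'' := fun x => by
    rw [Equiv.trans_apply, h, unsplit_colour c S l]), ht1, ht2, ← e3, smul_smul, hs]
  refine Eq.trans ?_ (mul_smul (koszul d c o e o') _ _)
  congr 1
  generalize koszul d (outerColour c S l) (outerOrder o S) (outerEquiv e hT) (outerOrder o' T) = A
  generalize koszul d (fun x : {x : I // x ∈ S} => c x.1) (innerOrder o S) (innerEquiv e hT)
          (innerOrder o' T) = B
  calc _ = koszul d c o e o' * (unshuffle d c' o' T * colourSign d l *
          ((1 + eps d l - totalEps d (fun x : {x : I // x ∈ S} => c x.1)) *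
            totalEps d (fun x : {x : I // x ∉ S} => c x.1)).negOnePow) * ((A * B) * (A * B)) := by
        ac_rfl
    _ = _ := by rw [Int.units_mul_self, mul_one]

theorem map_finsum_lin {M N ι : Type*} [AddCommGroup M] [Module K M] [AddCommGroup N] [Module K N]
    [Finite ι] (f : M →ₗ[K] N) (g : ι → M) : f (∑ᶠ i, g i) = ∑ᶠ i, f (g i) :=
  AddMonoidHom.map_finsum f.toAddMonoidHom (Set.toFinite _)

theorem units_smul_finsum {M ι : Type*} [AddCommGroup M] [Finite ι] (s : ℤˣ) (g : ι → M) :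
    s • ∑ᶠ i, g i = ∑ᶠ i, s • g i := by
  cases nonempty_fintype ι
  simp only [finsum_eq_sum_of_fintype, Finset.smul_sum]

theorem conv_relabel (d : ℤ) {I J : Type} [Finite I] [Finite J] {c : I → Colour}
    {c' : J → Colour} (k : Colour) (e : I ≃ J) (h : ∀ i, c' (e i) = c i) (o : LinearOrder I)
    (o' : LinearOrder J) :
    FreeObj.relabel e h ((freeOperad K d).conv d 1 (corolla K d) (corolla K d) ⟨I, o, c, k⟩) =
      koszul d c o e o' •
        (freeOperad K d).conv d 1 (corolla K d) (corolla K d) ⟨J, o', c', k⟩ := by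
  unfold OperadData.conv
  refine (map_finsum_lin K (FreeObj.relabel e h) _).trans ?_
  rw [units_smul_finsum, ← finsum_comp_equiv (Equiv.Set.congr e)]
  refine finsum_congr fun S => ?_
  have hT : ∀ x, e x ∈ Equiv.Set.congr e S ↔ x ∈ S := fun x => by simp
  rw [smul_add, ← convTerm_relabel K d k e h o o' hT, ← convTerm_relabel K d k e h o o' hT]
  exact map_add _ _ _

theorem Mono.diff_rel (d : ℤ) {I : Type} {c : I → Colour} {k : Colour} {s : ℤˣ} {a b : Mono I c k}
    (hr : Mono.Rel d s a b) : Mono.diff K d a = s • Mono.diff K d b := by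
  induction hr with
  | refl a => rw [one_smul]
  | @symm _ _ _ s a b _ ih => rw [ih, smul_smul, Int.units_mul_self, one_smul]
  | trans _ _ ih1 ih2 => rw [ih1, ih2, smul_smul]
  | relabel_congr e h _ ih => simp only [Mono.diff, ih, FreeObj.map_units_smul]
  | comp_congr i h hr1 hr2 ih1 ih2 =>
    simp only [Mono.diff, ih1, ih2, FreeObj.map_units_smul, FreeObj.mk_rel hr1,
      FreeObj.mk_rel hr2, FreeObj.units_smul_apply, hr1.deg_eq, smul_add, smul_smul]
    congr 2 <;> simp only [mul_comm]
  | gen o o' c c' k e h hc hc' =>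
    simp only [Mono.diff]
    exact (FreeObj.map_units_smul _ _ _).trans
      ((congrArg (outSign k • ·) (conv_relabel K d k e h o o')).trans
        (FreeObj.units_smul_comm _ _ _))
  | relabel_refl a h => simp only [Mono.diff]; rw [FreeObj.relabel_refl, one_smul]
  | relabel_trans a e h e' h' h'' =>
    simp only [Mono.diff]; rw [FreeObj.relabel_relabel (h'' := h''), one_smul]
  | comp_relabel a b i h e he e' he' h' hg =>
    simp only [Mono.diff, one_smul, map_add, FreeObj.map_units_smul, Mono.deg]
    rw [← FreeObj.relabel_mk, ← FreeObj.relabel_mk, FreeObj.comp_relabel (h := h) (hg := hg),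
      FreeObj.comp_relabel (h := h) (hg := hg)]
  | assoc a b x i h j h' h'' hg =>
    simp only [Mono.diff, one_smul, map_add, FreeObj.map_units_smul, Mono.deg,
      LinearMap.add_apply, FreeObj.units_smul_apply]
    simp only [← FreeObj.comp_mk]
    rw [FreeObj.assoc (h := h) (h' := h'), FreeObj.assoc (h := h) (h' := h'),
      FreeObj.assoc (h := h) (h' := h'), Int.negOnePow_add, smul_add, smul_smul, add_assoc]
  | parallel a b x i h j h' h₁ h₂ hg =>
    simp only [Mono.diff, map_add, FreeObj.map_units_smul, Mono.deg,
      LinearMap.add_apply, FreeObj.units_smul_apply]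
    simp only [← FreeObj.comp_mk]
    have hb := FreeObj.mk_mem_deg (K := K) (d := d) b
    have hx := FreeObj.mk_mem_deg (K := K) (d := d) x
    have hb' := Mono.diff_mem_deg K d b
    have hx' := Mono.diff_mem_deg K d x
    rw [FreeObj.parallel _ hb hx i h j h' h₁ h₂ hg, FreeObj.parallel _ hb' hx i h j h' h₁ h₂ hg,
      FreeObj.parallel _ hb hx' i h j h' h₁ h₂ hg]
    simp only [smul_add, smul_smul, ← Int.negOnePow_add]
    have t1 : (a.deg d + (b.deg d + 1) * x.deg d).negOnePow =
      (b.deg d * x.deg d + (a.deg d + x.deg d)).negOnePow := by congr 1; ring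
    have t2 : (a.deg d + b.deg d + b.deg d * (x.deg d + 1)).negOnePow =
        (b.deg d * x.deg d + a.deg d).negOnePow := by
      rw [show a.deg d + b.deg d + b.deg d * (x.deg d + 1) =
        b.deg d * x.deg d + a.deg d + 2 * b.deg d by ring, Int.negOnePow_add,
        Int.negOnePow_two_mul, mul_one]
    rw [t1, t2]
    abel
  | unit_comp a hg =>
    simp only [Mono.diff, map_zero, LinearMap.zero_apply, zero_add, Mono.deg, one_smul,
      Int.negOnePow_zero]
    rw [FreeObj.unit_comp]
  | comp_unit a i h hg =>
    simp only [Mono.diff, map_zero, smul_zero, add_zero, one_smul]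
    rw [FreeObj.comp_unit]

namespace FreeObj

/-- The differential on the free operad. -/
noncomputable def diff (d : ℤ) (I : Type) (c : I → Colour) (k : Colour) :
    FreeObj K d I c k →ₗ[K] FreeObj K d I c k :=
  lift (fun a => Mono.diff K d a) (fun _ _ _ hr => Mono.diff_rel K d hr)

end FreeObj

/-- The dg 2-coloured operad `Holie_{d,d+1}`: the free operad on the corollas, with the differential
splitting corollas. -/
noncomputable def holie (d : ℤ) : DGOperadData.{u, max 1 u} K where
  toOperadData := freeOperad K d
  diff := FreeObj.diff K d _ _ _

/-! ### The 2-coloured operad of oriented graphs -/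

/-- The condition on a directed graph with set of vertices `I` of colours `c` and with `p` numbered
directed edges (the edge `e` goes from `(E e).1` to `(E e).2`) to be a generator of the operad of
oriented graphs with output of colour `k`: there is at least one vertex and there are no closed directed
paths; if the output is white no edge starts at a white vertex; if the output is black all vertices are
black. -/
def IsGraph {I : Type} (c : I → Colour) (k : Colour) {p : ℕ} (E : Fin p → I × I) : Prop :=
  Nonempty I ∧ (∀ v, ¬ Relation.TransGen (fun x y => ∃ e, E e = (x, y)) v v) ∧
    match k with
    | .white => ∀ e, c (E e).1 = .black
    | .black => ∀ v, c v = .black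

theorem IsGraph.perm {I : Type} {c : I → Colour} {k : Colour} {p : ℕ} {E : Fin p → I × I}
    (h : IsGraph c k E) (σ : Equiv.Perm (Fin p)) : IsGraph c k (E ∘ σ) := by
  refine ⟨h.1, fun v hv => h.2.1 v (?_), ?_⟩
  · refine Relation.TransGen.lift (p := fun x y => ∃ e, E e = (x, y)) id ?_ _ _ hv
    rintro x y ⟨e, he⟩
    exact ⟨σ e, he⟩
  · cases k with
    | white => exact fun e => h.2.2 (σ e)
    | black => exact h.2.2

theorem isGraph_perm_iff {I : Type} {c : I → Colour} {k : Colour} {p : ℕ} {E : Fin p → I × I}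
    (σ : Equiv.Perm (Fin p)) : IsGraph c k (E ∘ σ) ↔ IsGraph c k E := by
  refine ⟨fun h => ?_, fun h => h.perm σ⟩
  have := h.perm σ⁻¹
  rwa [Function.comp_assoc, ← Equiv.Perm.coe_mul, mul_inv_cancel, Equiv.Perm.coe_one,
    Function.comp_id] at this

/-- The relation that a renumbering `σ` of the edges acts by `sign σ ^ d`. -/
noncomputable def edgeSpan (d : ℤ) {I : Type} (c : I → Colour) (k : Colour) (p : ℕ) :
    Submodule K ({E : Fin p → I × I // IsGraph c k E} →₀ K) :=
  Submodule.span K {x | ∃ (E : {E : Fin p → I × I // IsGraph c k E}) (σ : Equiv.Perm (Fin p)),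
    x = Finsupp.single ⟨E.1 ∘ σ, E.2.perm σ⟩ 1 - (Equiv.Perm.sign σ ^ d) • Finsupp.single E 1}

/-- The space of linear combinations of oriented graphs with `p` edges, modulo renumbering of the
edges up to the sign `sign σ ^ d`. -/
abbrev GraPiece (d : ℤ) {I : Type} (c : I → Colour) (k : Colour) (p : ℕ) : Type u :=
  ({E : Fin p → I × I // IsGraph c k E} →₀ K) ⧸ edgeSpan K d c k p

namespace GraPiece

variable {d : ℤ} {I J : Type} {c : I → Colour} {c' : J → Colour} {k l : Colour} {p q r : ℕ}

open Classical in
/-- The class of a graph, and zero if the conditions on the graph are violated. -/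
noncomputable def graph (d : ℤ) (c : I → Colour) (k : Colour) (E : Fin p → I × I) :
    GraPiece K d c k p :=
  if h : IsGraph c k E then (edgeSpan K d c k p).mkQ (Finsupp.single ⟨E, h⟩ 1) else 0

theorem graph_perm (E : Fin p → I × I) (σ : Equiv.Perm (Fin p)) :
    graph K d c k (E ∘ σ) = (Equiv.Perm.sign σ ^ d) • graph K d c k E := by
  by_cases h : IsGraph c k E
  · have h' := h.perm σ
    simp only [graph, h, h', dite_true]
    have : (Finsupp.single ⟨E ∘ σ, h'⟩ 1 - (Equiv.Perm.sign σ ^ d) • Finsupp.single ⟨E, h⟩ 1 :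
        {E : Fin p → I × I // IsGraph c k E} →₀ K) ∈ edgeSpan K d c k p :=
      Submodule.subset_span ⟨⟨E, h⟩, σ, rfl⟩
    have h2 := (Submodule.Quotient.mk_eq_zero _).2 this
    rw [Submodule.Quotient.mk_sub, sub_eq_zero] at h2
    refine h2.trans ?_
    rcases Int.units_eq_one_or (Equiv.Perm.sign σ ^ d) with hs | hs
    · simp [hs]
    · simp [hs, Units.smul_def]
  · have h' : ¬ IsGraph c k (E ∘ σ) := fun hh => h ((isGraph_perm_iff σ).1 hh)
    simp only [graph, h, h', dite_false, smul_zero]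

variable {K}

/-- Linear extension of a map defined on graphs. -/
noncomputable def lift {M : Type*} [AddCommGroup M] [Module K M] (f : (Fin p → I × I) → M)
    (hf : ∀ (E : Fin p → I × I) (σ : Equiv.Perm (Fin p)),
      f (E ∘ σ) = (Equiv.Perm.sign σ ^ d) • f E) :
    GraPiece K d c k p →ₗ[K] M :=
  (edgeSpan K d c k p).liftQ (Finsupp.lift M K _ (fun E => f E.1)) (by
    rw [edgeSpan, Submodule.span_le]
    rintro _ ⟨E, σ, rfl⟩
    have := hf E.1 σ
    rcases Int.units_eq_one_or (Equiv.Perm.sign σ ^ d) with hs | hs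
    · rw [hs] at this ⊢
      rw [one_smul, SetLike.mem_coe, LinearMap.mem_ker, map_sub]
      simpa [sub_eq_zero] using this
    · rw [hs] at this ⊢
      rw [Units.neg_smul, one_smul, sub_neg_eq_add, SetLike.mem_coe, LinearMap.mem_ker, map_add]
      simpa [Units.smul_def, ← eq_neg_iff_add_eq_zero] using this)

theorem lift_graph {M : Type*} [AddCommGroup M] [Module K M] (f : (Fin p → I × I) → M)
    (hf : ∀ (E : Fin p → I × I) (σ : Equiv.Perm (Fin p)),
      f (E ∘ σ) = (Equiv.Perm.sign σ ^ d) • f E) {E : Fin p → I × I} (h : IsGraph c k E) :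
    lift f hf (graph K d c k E) = f E := by
  simp [lift, graph, h]

theorem ext {M : Type*} [AddCommGroup M] [Module K M] {f g : GraPiece K d c k p →ₗ[K] M}
    (h : ∀ E, IsGraph c k E → f (graph K d c k E) = g (graph K d c k E)) : f = g := by
  apply Submodule.linearMap_qext
  ext E
  simpa [graph, E.2] using h E.1 E.2

theorem units_smul_apply {M N : Type*} [AddCommGroup M] [Module K M] [AddCommGroup N]
    [Module K N] (f : M →ₗ[K] N) (s : ℤˣ) (x : M) : (s • f) x = s • f x := by
  rcases Int.units_eq_one_or s with rfl | rfl
  · simp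
  · simp [Units.smul_def]

/-- The action of bijections of the vertices. -/
noncomputable def relabel (e : I ≃ J) : GraPiece K d c k p →ₗ[K] GraPiece K d c' k p :=
  lift (fun E => graph K d c' k (Prod.map e e ∘ E)) (fun E σ => graph_perm K (Prod.map e e ∘ E) σ)

/-- The map from the vertices of `Γ₁ ∘_i Γ₂` to those of `Γ₁` which sends all vertices of `Γ₂` to
`i`. -/
def collapse (i : I) : Without i ⊕ J → I :=
  Sum.elim (fun x => x.1) (fun _ => i)

/-- All ways to attach the edges of `Γ₁` to the vertices of `Γ₁ ∘_i Γ₂`: every end of an edge which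
is not `i` stays as it is, and every end at `i` is attached to an arbitrary vertex of `Γ₂`. -/
noncomputable def reattachments [Finite I] [Finite J] (i : I) (E : Fin q → I × I) :
    Finset (Fin q → (Without i ⊕ J) × (Without i ⊕ J)) :=
  (Set.toFinite {E' | ∀ e, Prod.map (collapse i) (collapse i) (E' e) = E e}).toFinset

/-- Numbering the edges of the first graph before those of the second. -/
def edgeEquiv (h : q + r = p) : Fin q ⊕ Fin r ≃ Fin p :=
  finSumFinEquiv.trans (finCongr h)

/-- The graph with reattached edges `E'` of `Γ₁`, followed by the edges of `Γ₂`. -/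
def union (i : I) (h : q + r = p) (E' : Fin q → (Without i ⊕ J) × (Without i ⊕ J))
    (E₂ : Fin r → J × J) : Fin p → (Without i ⊕ J) × (Without i ⊕ J) :=
  Sum.elim E' (fun e => ((Sum.inr (E₂ e).1, Sum.inr (E₂ e).2))) ∘ (edgeEquiv h).symm

theorem isGraph_union [Finite I] [Finite J] {i : I} (hi : c i = l) (h : q + r = p)
    {E₁ : Fin q → I × I} {E₂ : Fin r → J × J} (h₁ : IsGraph c k E₁) (h₂ : IsGraph c' l E₂)
    {E' : Fin q → (Without i ⊕ J) × (Without i ⊕ J)} (hE' : E' ∈ reattachments i E₁) :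
    IsGraph (graftColour c i c') k (union i h E' E₂) := by
  have hE : ∀ e, Prod.map (collapse i) (collapse i) (E' e) = E₁ e := by
    simpa [reattachments] using hE'
  have step : ∀ x y : Without i ⊕ J, (∃ e, union i h E' E₂ e = (x, y)) →
      (∃ e, E₁ e = (collapse i x, collapse i y)) ∨
        ∃ a b, x = .inr a ∧ y = .inr b ∧ ∃ e, E₂ e = (a, b) := by
    rintro x y ⟨e, he⟩
    obtain ⟨e, rfl⟩ := (edgeEquiv h).surjective e
    rcases e with e | e
    · left
      refine ⟨e, ?_⟩
      simp only [union, Function.comp_apply, Equiv.symm_apply_apply, Sum.elim_inl] at he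
      rw [← hE, he]
      rfl
    · right
      simp only [union, Function.comp_apply, Equiv.symm_apply_apply, Sum.elim_inr,
        Prod.mk.injEq] at he
      exact ⟨_, _, he.1.symm, he.2.symm, e, rfl⟩
  have key : ∀ x y : Without i ⊕ J,
      Relation.TransGen (fun x y => ∃ e, union i h E' E₂ e = (x, y)) x y →
      Relation.TransGen (fun x y => ∃ e, E₁ e = (x, y)) (collapse i x) (collapse i y) ∨
        ∃ a b, x = .inr a ∧ y = .inr b ∧ Relation.TransGen (fun x y => ∃ e, E₂ e = (x, y)) a b := by
    intro x y hxy
    induction hxy with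
    | single hs =>
      rcases step _ _ hs with h1 | ⟨a, b, ha, hb, h1⟩
      · exact .inl (.single h1)
      · exact .inr ⟨a, b, ha, hb, .single h1⟩
    | @tail y z _ hs ih =>
      rcases step _ _ hs with h1 | ⟨a, b, rfl, rfl, h1⟩
      · rcases ih with h2 | ⟨a, b, rfl, rfl, h2⟩
        · exact .inl (h2.tail h1)
        · exact .inl (.single h1)
      · rcases ih with h2 | ⟨a', b', rfl, hb, h2⟩
        · exact .inl h2
        · obtain rfl := Sum.inr_injective hb
          exact .inr ⟨_, _, rfl, rfl, h2.tail h1⟩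
  refine ⟨h₂.1.map Sum.inr, fun v hv => ?_, ?_⟩
  · rcases key v v hv with h3 | ⟨a, b, rfl, hb, h3⟩
    · exact h₁.2.1 _ h3
    · obtain rfl := Sum.inr_injective hb
      exact h₂.2.1 _ h3
  · cases k with
    | white =>
      intro e
      obtain ⟨e, rfl⟩ := (edgeEquiv h).surjective e
      rcases e with e | e
      · simp only [union, Function.comp_apply, Equiv.symm_apply_apply, Sum.elim_inl]
        have h3 := h₁.2.2 e
        rw [← hE] at h3
        rcases hx : (E' e).1 with x | x
        · simpa [hx, collapse] using h3
        · have h4 : c i = .black := by simpa [hx, collapse] using h3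
          subst hi
          have h5 := h₂.2.2
          rw [h4] at h5
          exact h5 x
      · simp only [union, Function.comp_apply, Equiv.symm_apply_apply, Sum.elim_inr]
        have h5 := h₂.2.2
        cases l with
        | white => exact h5 e
        | black => exact h5 _
    | black =>
      have h3 : ∀ v, c v = .black := h₁.2.2
      subst hi
      have h5 := h₂.2.2
      rw [h3 i] at h5
      rintro (x | x)
      · exact h3 x.1
      · exact h5 x

theorem union_perm (i : I) (h : q + r = p) (E' : Fin q → (Without i ⊕ J) × (Without i ⊕ J))
    (E₂ : Fin r → J × J) (σ : Equiv.Perm (Fin q)) (τ : Equiv.Perm (Fin r)) :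
    union i h (E' ∘ σ) (E₂ ∘ τ) =
      union i h E' E₂ ∘ ((edgeEquiv h).permCongr (Equiv.sumCongr σ τ)) := by
  funext e
  obtain ⟨e, rfl⟩ := (edgeEquiv h).surjective e
  rcases e with e | e <;> simp [union, Equiv.permCongr_apply]

/-- The substitution of the second graph into the vertex `i` of the first one: the sum over all
reattachments. -/
noncomputable def insert [Finite I] [Finite J] (d : ℤ) (c : I → Colour) (c' : J → Colour)
    (k : Colour) (i : I) (h : q + r = p) (E₁ : Fin q → I × I) (E₂ : Fin r → J × J) :
    GraPiece K d (graftColour c i c') k p :=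
  ∑ E' ∈ reattachments i E₁, graph K d (graftColour c i c') k (union i h E' E₂)

theorem insert_perm [Finite I] [Finite J] (i : I) (h : q + r = p) (E₁ : Fin q → I × I)
    (E₂ : Fin r → J × J) (σ : Equiv.Perm (Fin q)) (τ : Equiv.Perm (Fin r)) :
    (insert d c c' k i h (E₁ ∘ σ) (E₂ ∘ τ) : GraPiece K d (graftColour c i c') k p) =
      ((Equiv.Perm.sign σ ^ d) * (Equiv.Perm.sign τ ^ d)) • insert d c c' k i h E₁ E₂ := by
  unfold insert
  rw [Finset.smul_sum]
  symm
  refine Finset.sum_bij (fun E' _ => E' ∘ σ) ?_ ?_ ?_ ?_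
  · intro E' hE'
    simp only [reattachments, Set.Finite.mem_toFinset, Set.mem_ofPred_eq] at hE' ⊢
    exact fun e => hE' (σ e)
  · intro E' _ E'' _ hEE
    funext e
    simpa using congrFun hEE (σ.symm e)
  · intro E' hE'
    simp only [reattachments, Set.Finite.mem_toFinset, Set.mem_ofPred_eq] at hE'
    refine ⟨E' ∘ σ.symm, ?_, ?_⟩
    · simp only [reattachments, Set.Finite.mem_toFinset, Set.mem_ofPred_eq]
      intro e
      have := hE' (σ.symm e)
      simpa using this
    · funext e
      simp
  · intro E' _
    rw [union_perm, graph_perm, Equiv.Perm.sign_permCongr]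
    congr 1
    rw [← mul_zpow]
    congr 1
    exact (Equiv.Perm.sign_sumCongr σ τ).symm

/-- The substitution as a bilinear map, in fixed numbers of edges. -/
noncomputable def comp [Finite I] [Finite J] (i : I) (h : q + r = p) :
    GraPiece K d c k q →ₗ[K] GraPiece K d c' l r →ₗ[K] GraPiece K d (graftColour c i c') k p :=
  lift (fun E₁ => lift (fun E₂ => insert d c c' k i h E₁ E₂)
      (fun E₂ τ => by simpa using insert_perm (K := K) (d := d) i h E₁ E₂ 1 τ))
    (fun E₁ σ => by
      apply ext
      intro E₂ h₂
      rw [units_smul_apply, lift_graph _ _ h₂, lift_graph _ _ h₂]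
      simpa using insert_perm (K := K) (d := d) i h E₁ E₂ σ 1)

end GraPiece

/-- The product over all numbers `p` of edges of the spaces of oriented graphs. -/
abbrev GraObj (d : ℤ) {I : Type} (c : I → Colour) (k : Colour) : Type u :=
  (p : ℕ) → GraPiece K d c k p

namespace GraObj

variable {d : ℤ} {I J : Type} {c : I → Colour} {c' : J → Colour} {k l : Colour}

variable {K} in
/-- A graph as an element of the product. -/
noncomputable def graph (d : ℤ) (c : I → Colour) (k : Colour) {p : ℕ} (E : Fin p → I × I) :
    GraObj K d c k :=
  Pi.single p (GraPiece.graph K d c k E)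

variable {K} in
/-- The elements of degree `n`; every edge has degree `-d`. -/
noncomputable def deg (n : ℤ) : Submodule K (GraObj K d c k) where
  carrier := {x | ∀ p : ℕ, -d * p ≠ n → x p = 0}
  add_mem' := fun hx hy p hp => by rw [Pi.add_apply, hx p hp, hy p hp, add_zero]
  zero_mem' := fun _ _ => rfl
  smul_mem' := fun r x hx p hp => by rw [Pi.smul_apply, hx p hp, smul_zero]

variable {K} in
/-- The action of bijections of the vertices. -/
noncomputable def relabel (e : I ≃ J) : GraObj K d c k →ₗ[K] GraObj K d c' k :=
  LinearMap.pi fun p => GraPiece.relabel e ∘ₗ LinearMap.proj p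

variable {K} in
/-- The operadic composition: substitution into the vertex `i`. -/
noncomputable def comp [Finite I] [Finite J] (i : I) :
    GraObj K d c k →ₗ[K] GraObj K d c' l →ₗ[K] GraObj K d (graftColour c i c') k :=
  LinearMap.mk₂ K
    (fun x y p => ∑ q : Finset.HasAntidiagonal.antidiagonal p,
      GraPiece.comp i (Finset.HasAntidiagonal.mem_antidiagonal.1 q.2) (x q.1.1) (y q.1.2))
    (fun x x' y => by
      funext p
      simp only [Pi.add_apply, map_add, LinearMap.add_apply, Finset.sum_add_distrib])
    (fun r x y => by
      funext p
      simp only [Pi.smul_apply, map_smul, LinearMap.smul_apply, Finset.smul_sum])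
    (fun x y y' => by
      funext p
      simp only [Pi.add_apply, map_add, Finset.sum_add_distrib])
    (fun r x y => by
      funext p
      simp only [Pi.smul_apply, map_smul, Finset.smul_sum])

end GraObj

/-- The dg 2-coloured operad `Gra_{d,d+1}` of oriented graphs, with zero differential. -/
noncomputable def gra (d : ℤ) : DGOperadData.{u, u} K where
  obj I _ c k := GraObj K d c k
  addCommGroup I _ c k := inferInstanceAs (AddCommGroup (GraObj K d c k))
  module I _ c k := inferInstanceAs (Module K (GraObj K d c k))
  deg n := GraObj.deg n
  relabel e _ := GraObj.relabel e
  unit k := GraObj.graph d (fun _ => k) k Fin.elim0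
  comp i _ := GraObj.comp i
  diff := 0

/-- Morphisms of dg 2-coloured operads. -/
structure DGOperadHom {K : Type u} [Field K] (P : DGOperadData.{u, v} K)
    (Q : DGOperadData.{u, w} K) where
  map : ∀ {I : Type} [Finite I] {c : I → Colour} {k : Colour}, P.obj I c k →ₗ[K] Q.obj I c k
  map_deg : ∀ {I : Type} [Finite I] {c : I → Colour} {k : Colour} (n : ℤ) (x : P.obj I c k),
    x ∈ P.deg n → map x ∈ Q.deg n
  map_relabel : ∀ {I J : Type} [Finite I] [Finite J] {c : I → Colour} {c' : J → Colour}
    {k : Colour} (e : I ≃ J) (h : ∀ i, c' (e i) = c i) (x : P.obj I c k),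
    map (P.relabel e h x) = Q.relabel e h (map x)
  map_unit : ∀ k : Colour, map (P.unit k) = Q.unit k
  map_comp : ∀ {I J : Type} [Finite I] [Finite J] {c : I → Colour} {c' : J → Colour}
    {k l : Colour} (i : I) (h : c i = l) (x : P.obj I c k) (y : P.obj J c' l),
    map (P.comp i h x y) = Q.comp i h (map x) (map y)
  map_diff : ∀ {I : Type} [Finite I] {c : I → Colour} {k : Colour} (x : P.obj I c k),
    map (P.diff x) = Q.diff (map x)

/-- The generating corolla of a given type (zero if there is no such corolla). -/
noncomputable def holieGen (d : ℤ) (p : Profile) : (holie K d).obj p.I p.c p.k :=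
  corolla K d p

variable {K} in
/-- The values of a morphism on the generating corollas. -/
noncomputable def DGOperadHom.onGenerators {d : ℤ} {Q : DGOperadData.{u, w} K}
    (f : DGOperadHom (holie K d) Q) : Q.toOperadData.Family :=
  fun p => f.map (holieGen K d p)

/-- The deformation complex of the zero morphism from `Holie_{d,d+1}` to `P`, as a vector space: the
space of all maps from the generating corollas to `P` which are compatible with relabelling of the
inputs, so that it is a product of spaces of (skew)invariants of symmetric groups. -/
noncomputable def OperadData.defComplex (P : OperadData.{u, v} K) (d : ℤ) :
    Submodule K P.Family where
  carrier := {F |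
    (∀ (I J : Type) [Finite I] [Finite J] (o : LinearOrder I) (o' : LinearOrder J)
      (c : I → Colour) (c' : J → Colour) (k : Colour) (e : I ≃ J) (h : ∀ i, c' (e i) = c i),
      P.relabel e h (F ⟨I, o, c, k⟩) = koszul d c o e o' • F ⟨J, o', c', k⟩) ∧
    ∀ p : Profile, ¬ Admissible p.c p.k → F p = 0}
  add_mem' := fun {F G} hF hG => by
    refine ⟨fun I J _ _ o o' c c' k e h => ?_, fun p hp => ?_⟩
    · rw [Pi.add_apply, Pi.add_apply, smul_add, ← hF.1 I J o o' c c' k e h,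
        ← hG.1 I J o o' c c' k e h]
      exact map_add _ _ _
    · rw [Pi.add_apply, hF.2 p hp, hG.2 p hp, add_zero]
  zero_mem' := ⟨fun I J _ _ o o' c c' k e h => by
    rw [Pi.zero_apply, Pi.zero_apply, smul_zero]
    exact map_zero _, fun _ _ => rfl⟩
  smul_mem' := fun r F hF => by
    refine ⟨fun I J _ _ o o' c c' k e h => ?_, fun p hp => ?_⟩
    · rw [Pi.smul_apply, Pi.smul_apply, smul_comm, ← hF.1 I J o o' c c' k e h]
      exact map_smul _ _ _
    · rw [Pi.smul_apply, hF.2 p hp, smul_zero]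

variable {K} in
/-- Homogeneity of degree `g` in the deformation complex. The degree is normalized such that the
morphisms of operads correspond to elements of degree `1`; for `P = Gra_{d,d+1}`, a graph with `n` white
and `m` black vertices, `p` edges and white (black) output has degree `d n + (d + 1) m - d p - d`
(`(d + 1) m - d p - (d + 1)`). -/
def OperadData.HasDegree (P : OperadData.{u, v} K) (d g : ℤ) (F : P.Family) : Prop :=
  ∀ p : Profile, F p ∈ P.deg (g + eps d p.k - totalEps d p.c)

/-- Connectedness of the graph that underlies a directed graph. -/
def IsConnectedGraph {I : Type} {p : ℕ} (E : Fin p → I × I) : Prop :=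
  ∀ u v, Relation.EqvGen (fun x y => ∃ e, E e = (x, y)) u v

/-- The span of the connected graphs. -/
noncomputable def connectedSpan (d : ℤ) {I : Type} (c : I → Colour) (k : Colour) (p : ℕ) :
    Submodule K (GraPiece K d c k p) :=
  Submodule.span K {x | ∃ E : Fin p → I × I, IsConnectedGraph E ∧ x = GraPiece.graph K d c k E}

/-- Families of elements of `Gra_{d,d+1}`. -/
abbrev GraFamily (d : ℤ) : Type (max 1 u) := (gra K d).toOperadData.Family

/-- The deformation complex of the zero morphism from `Holie_{d,d+1}` to `Gra_{d,d+1}`, with all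
graphs, connected or not. Its pre-Lie product is `OperadData.conv`. -/
noncomputable def fOGC (d : ℤ) : Submodule K (GraFamily K d) :=
  (gra K d).toOperadData.defComplex K d

/-- The subspace of the deformation complex which consists of connected graphs. -/
noncomputable def OGChat (d : ℤ) : Submodule K (GraFamily K d) :=
  fOGC K d ⊓
    { carrier := {F | ∀ (p : Profile) (n : ℕ),
        (show GraObj K d p.c p.k from F p) n ∈ connectedSpan K d p.c p.k n}
      add_mem' := fun hF hG p n => Submodule.add_mem _ (hF p n) (hG p n)
      zero_mem' := fun p n => Submodule.zero_mem _
      smul_mem' := fun r F hF p n => Submodule.smul_mem _ r (hF p n) }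

/-- Maurer-Cartan elements of the deformation complex of the zero morphism: the elements of degree
`1` such that `F ∘ F = 0` for the pre-Lie product. -/
structure IsMaurerCartan (d : ℤ) (F : GraFamily K d) : Prop where
  mem : F ∈ fOGC K d
  degree : (gra K d).toOperadData.HasDegree d 1 F
  equation : (gra K d).toOperadData.conv d 1 F F = 0

/-- The graph with two vertices and one edge from the first to the second vertex. -/
def arrow : Fin 1 → Fin 2 × Fin 2 := fun _ => (0, 1)

/-- The graph with two vertices and one edge from the second to the first vertex. -/
def arrowRev : Fin 1 → Fin 2 × Fin 2 := fun _ => (1, 0)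

/-- The graph with `n` edges, which go from the vertex `0` to the vertices `1, …, n`, in this order. -/
def star (n : ℕ) : Fin n → Fin (n + 1) × Fin (n + 1) := fun j => (0, j.succ)

/-- The colours on the vertices of the star: `0` is black and the others are white. -/
def starColour (n : ℕ) : Fin (n + 1) → Colour := Fin.cons .black (fun _ => .white)

/-- The binary corolla with black inputs and black output. -/
abbrev blackProfile : Profile := ⟨Fin 2, inferInstance, fun _ => .black, .black⟩

/-- The corolla with one black and `n` white inputs and white output. -/
abbrev starProfile (n : ℕ) : Profile := ⟨Fin (n + 1), inferInstance, starColour n, .white⟩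

/-- The element of the deformation complex represented by a graph with unlabelled vertices: the sum
with Koszul signs over all labellings of the vertices that are compatible with the colours. -/
noncomputable def symmetrize (d : ℤ) {N n : ℕ} (c₀ : Fin N → Colour) (E : Fin n → Fin N × Fin N)
    {I : Type} (o : LinearOrder I) (c : I → Colour) (k : Colour) : GraObj K d c k :=
  ∑ᶠ e : {e : Fin N ≃ I // ∀ i, c (e i) = c₀ i},
    koszul d c₀ inferInstance e.1 o • GraObj.graph d c k (Prod.map e.1 e.1 ∘ E)

/-- The components of the element `γ`: with black output the graph with two black vertices and one
edge, with white output the sum over all `n ≥ 0` of `1 / n!` times the star with a black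
centre and `n` white vertices. -/
noncomputable def gammaAt (d : ℤ) {I : Type} (o : LinearOrder I) (c : I → Colour) :
    ∀ k : Colour, GraObj K d c k
  | .black => symmetrize K d (fun _ => .black) arrow o c .black
  | .white => ∑ n ∈ Finset.range (Nat.card I),
      ((n.factorial : K)⁻¹) • symmetrize K d (starColour n) (star n) o c .white

/-- The element `γ` of the deformation complex. -/
noncomputable def gamma (d : ℤ) : GraFamily K d := fun p => gammaAt K d p.ord p.c p.k

end

end HolieGra

namespace HolieGra

universe u

/-! ### Koszul signs -/

open Classical in
theorem koszul_eq_prod (d : ℤ) {I J : Type} [Fintype I] (c : I → Colour) (o : LinearOrder I)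
    (e : I ≃ J) (o' : LinearOrder J) :
    koszul d c o e o' = ∏ x, ∏ y, if o.lt x y ∧ o'.lt (e y) (e x)
      then (eps d (c x) * eps d (c y)).negOnePow else 1 := by
  unfold koszul
  rw [finprod_pair]
  simp only [finprod_eq_prod_of_fintype]

theorem koszul_eq_one (d : ℤ) {I J : Type} (c : I → Colour) (o : LinearOrder I)
    (e : I ≃ J) (o' : LinearOrder J) (h : ∀ x y, o.lt x y → o'.lt (e x) (e y)) :
    koszul d c o e o' = 1 := by
  unfold koszul
  refine finprod_eq_one_of_forall_eq_one fun p => if_neg fun hp => ?_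
  exact @lt_asymm _ o'.toPreorder _ _ hp.2 (h _ _ hp.1)

theorem koszul_trans (d : ℤ) {I J L : Type} [Finite I] {c : I → Colour} {c' : J → Colour}
    (e : I ≃ J) (h : ∀ i, c' (e i) = c i) (e' : J ≃ L) (o : LinearOrder I) (o' : LinearOrder J)
    (o'' : LinearOrder L) :
    koszul d c o (e.trans e') o'' = koszul d c o e o' * koszul d c' o' e' o'' := by
  classical
  cases nonempty_fintype I
  have : Fintype J := Fintype.ofEquiv I e
  rw [koszul_eq_prod, koszul_eq_prod, koszul_eq_prod, ← e.prod_comp]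
  simp only [← e.prod_comp (fun y => ite (o'.lt _ y ∧ _) _ _), h, Equiv.trans_apply]
  set w : I → I → ℤˣ := fun x y => (eps d (c x) * eps d (c y)).negOnePow with hw
  have wsymm : ∀ x y, w x y = w y x := fun x y => by simp only [hw, mul_comm]
  have key : ∏ x, ∏ y, (if o'.lt (e x) (e y) ∧ o''.lt (e' (e y)) (e' (e x)) then w x y else 1) =
      (∏ x, ∏ y, (if o.lt x y ∧ o'.lt (e x) (e y) ∧ o''.lt (e' (e y)) (e' (e x))
        then w x y else 1)) *
      ∏ x, ∏ y, (if o.lt x y ∧ o'.lt (e y) (e x) ∧ o''.lt (e' (e x)) (e' (e y))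
        then w x y else 1) := by
    have swap : ∏ x, ∏ y, (if o.lt x y ∧ o'.lt (e y) (e x) ∧ o''.lt (e' (e x)) (e' (e y))
        then w x y else 1) =
        ∏ x, ∏ y, (if o.lt y x ∧ o'.lt (e x) (e y) ∧ o''.lt (e' (e y)) (e' (e x))
          then w x y else 1) := by
      rw [Finset.prod_comm]
      simp only [wsymm]
    rw [swap]
    simp only [← Finset.prod_mul_distrib]
    refine Finset.prod_congr rfl fun x _ => Finset.prod_congr rfl fun y _ => ?_
    rcases @lt_trichotomy _ o x y with hxy | rfl | hxy
    · have h1 : ¬ o.lt y x := fun h1 => @lt_asymm _ o.toPreorder _ _ h1 hxy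
      simp only [h1, false_and, if_false, mul_one]
      simp [show o.lt x y from hxy]
    · simp
    · have h1 : ¬ o.lt x y := fun h1 => @lt_asymm _ o.toPreorder _ _ h1 hxy
      simp only [h1, false_and, if_false, one_mul]
      simp [show o.lt y x from hxy]
  refine Eq.trans ?_ (congrArg _ key.symm)
  simp only [← Finset.prod_mul_distrib]
  refine Finset.prod_congr rfl fun x _ => Finset.prod_congr rfl fun y _ => ?_
  by_cases hxy : o.lt x y
  · have hne : x ≠ y := fun hh => @lt_irrefl _ o.toPreorder x (hh ▸ hxy)
    have h1 : o'.lt (e x) (e y) ↔ ¬ o'.lt (e y) (e x) :=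
      ⟨fun h1 => (@lt_asymm _ o'.toPreorder _ _ h1),
        fun h1 => (@lt_or_gt_of_ne _ o' _ _ (e.injective.ne hne)).resolve_right h1⟩
    have h2 : o''.lt (e' (e x)) (e' (e y)) ↔ ¬ o''.lt (e' (e y)) (e' (e x)) :=
      ⟨fun h1 => (@lt_asymm _ o''.toPreorder _ _ h1),
        fun h1 => (@lt_or_gt_of_ne _ o'' _ _ (e'.injective.ne (e.injective.ne hne))).resolve_right
          h1⟩
    simp only [hxy, h1, h2, true_and]
    by_cases h3 : o'.lt (e y) (e x) <;> by_cases h4 : o''.lt (e' (e y)) (e' (e x)) <;>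
      simp [h3, h4, hw]
  · simp [hxy]

theorem negOnePow_mul_self (d : ℤ) : (d * d).negOnePow = d.negOnePow := by
  rcases Int.even_or_odd d with h | h
  · rw [Int.negOnePow_even _ h, Int.negOnePow_even _ (h.mul_left _)]
  · rw [Int.negOnePow_odd _ h, Int.negOnePow_odd _ (h.mul h)]

theorem negOnePow_mul_succ (d : ℤ) : (d * (d + 1)).negOnePow = 1 :=
  Int.negOnePow_even _ (Int.even_mul_succ_self d)

theorem neg_one_zpow_eq (d : ℤ) : ((-1 : ℤˣ) ^ d) = d.negOnePow := rfl

/-- The Koszul sign of a bijection of ordered sets, all of whose elements have parity `d`. -/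
noncomputable abbrev edgeSign (d : ℤ) {I J : Type} (o : LinearOrder I) (e : I ≃ J)
    (o' : LinearOrder J) : ℤˣ :=
  koszul d (fun _ => .white) o e o'

open Classical in
theorem edgeSign_eq_prod (d : ℤ) {I J : Type} [Fintype I] (o : LinearOrder I)
    (e : I ≃ J) (o' : LinearOrder J) :
    edgeSign d o e o' = ∏ x, ∏ y, if o.lt x y ∧ o'.lt (e y) (e x) then d.negOnePow else 1 := by
  unfold edgeSign
  rw [koszul_eq_prod]
  simp only [eps, negOnePow_mul_self]

theorem edgeSign_trans (d : ℤ) {I J L : Type} [Finite I] (e : I ≃ J) (e' : J ≃ L)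
    (o : LinearOrder I) (o' : LinearOrder J) (o'' : LinearOrder L) :
    edgeSign d o (e.trans e') o'' = edgeSign d o e o' * edgeSign d o' e' o'' :=
  koszul_trans d (c' := fun _ => .white) e (fun _ => rfl) e' o o' o''

theorem edgeSign_perm (d : ℤ) {n : ℕ} (σ : Equiv.Perm (Fin n)) :
    edgeSign d inferInstance σ inferInstance = Equiv.Perm.sign σ ^ d := by
  classical
  rw [edgeSign_eq_prod, Equiv.Perm.sign_eq_prod_prod_Ioi, ← Finset.prod_zpow]
  refine Finset.prod_congr rfl fun x _ => ?_
  rw [← Finset.prod_zpow, ← Finset.prod_subset (Finset.subset_univ (Finset.Ioi x))]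
  · refine Finset.prod_congr rfl fun y hy => ?_
    have hxy : x < y := Finset.mem_Ioi.1 hy
    rcases lt_or_gt_of_ne (σ.injective.ne hxy.ne) with h | h
    · have h' : ¬ σ y < σ x := h.asymm
      rw [if_neg (fun hh => h' hh.2), if_pos h, one_zpow]
    · have h' : ¬ σ x < σ y := h.asymm
      rw [if_pos ⟨hxy, h⟩, if_neg h']
      rfl
  · intro y _ hy
    exact if_neg fun hh => hy (Finset.mem_Ioi.2 hh.1)

/-- A sign as a scalar. -/
def signScalar (K : Type u) [Field K] : ℤˣ →* K :=
  (Int.castRingHom K).toMonoidHom.comp (Units.coeHom ℤ)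

theorem signScalar_apply (K : Type u) [Field K] (s : ℤˣ) : signScalar K s = ((s : ℤ) : K) := rfl

@[simp] theorem signScalar_neg (K : Type u) [Field K] (s : ℤˣ) :
    signScalar K (-s) = -signScalar K s := by
  simp [signScalar_apply]

theorem signScalar_mul_self (K : Type u) [Field K] (s : ℤˣ) :
    signScalar K s * signScalar K s = 1 := by
  rw [← map_mul, Int.units_mul_self, map_one]

theorem units_smul_eq (K : Type u) [Field K] {M : Type*} [AddCommGroup M] [Module K M] (s : ℤˣ)
    (x : M) : s • x = signScalar K s • x := by
  rcases Int.units_eq_one_or s with rfl | rfl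
  · simp
  · simp [Units.smul_def]

/-! ### Graphs with edges indexed by an ordered set -/

/-- The increasing enumeration of a finite ordered set. -/
noncomputable def enum {ι : Type} [Finite ι] (o : LinearOrder ι) : Fin (Nat.card ι) ≃ ι :=
  letI := o
  letI := Fintype.ofFinite ι
  (Fintype.orderIsoFinOfCardEq ι Nat.card_eq_fintype_card.symm).toEquiv

theorem enum_lt {ι : Type} [Finite ι] (o : LinearOrder ι) (x y : Fin (Nat.card ι)) (h : x < y) :
    o.lt (enum o x) (enum o y) := by
  let _ := o
  let _ := Fintype.ofFinite ι
  exact (Fintype.orderIsoFinOfCardEq ι Nat.card_eq_fintype_card.symm).lt_iff_lt.2 h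

variable {K : Type u} [Field K] {d : ℤ} {I J L : Type} {c : I → Colour} {c' : J → Colour}
  {c'' : L → Colour} {k l m : Colour}

variable (K) in
/-- The operations of the operad of oriented graphs. -/
abbrev GraSpace (d : ℤ) [Finite I] (c : I → Colour) (k : Colour) : Type u :=
  (gra K d).obj I c k

variable (K) in
/-- The graph with edges indexed by a finite ordered set. -/
noncomputable def orderedGraph (d : ℤ) [Finite I] (c : I → Colour) (k : Colour) {ι : Type}
    [Finite ι] (o : LinearOrder ι) (E : ι → I × I) : GraSpace K d c k :=
  GraObj.graph d c k (E ∘ enum o)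

theorem single_smul_gra [Finite I] {p : ℕ} (r : K) (x : GraPiece K d c k p) :
    (show GraSpace K d c k from (Pi.single p (r • x) : GraObj K d c k)) =
      r • (show GraSpace K d c k from (Pi.single p x : GraObj K d c k)) :=
  (LinearMap.single K (GraPiece K d c k) p).map_smul r x

theorem graph_comp_equiv [Finite I] {ι : Type} [Finite ι] {p : ℕ} (f : Fin p ≃ ι)
    (o : LinearOrder ι)
    (E : ι → I × I) : (show GraSpace K d c k from GraObj.graph d c k (E ∘ f)) =
      signScalar K (edgeSign d inferInstance f o) • orderedGraph K d c k o E := by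
  obtain rfl : p = Nat.card ι := by simpa using Nat.card_congr f
  have h1 : E ∘ f = (E ∘ enum o) ∘ (f.trans (enum o).symm) := by
    funext x; simp
  have h2 : edgeSign d inferInstance f o =
      Equiv.Perm.sign (f.trans (enum o).symm) ^ d := by
    have h3 : f = (f.trans (enum o).symm).trans (enum o) := by ext x; simp
    rw [← edgeSign_perm]
    conv_lhs => rw [h3, edgeSign_trans d _ _ _ (inferInstance : LinearOrder (Fin (Nat.card ι)))]
    rw [edgeSign, edgeSign, koszul_eq_one d _ _ (enum o) o (enum_lt o), mul_one]
  rw [h1, GraObj.graph, GraPiece.graph_perm, h2, units_smul_eq K]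
  exact single_smul_gra _ _

theorem orderedGraph_comp_equiv [Finite I] {ι κ : Type} [Finite ι] [Finite κ] (f : ι ≃ κ)
    (o : LinearOrder ι)
    (o' : LinearOrder κ) (E : κ → I × I) :
    orderedGraph K d c k o (E ∘ f) = signScalar K (edgeSign d o f o') • orderedGraph K d c k o' E
      := by
  have h := graph_comp_equiv (K := K) (d := d) (c := c) (k := k) ((enum o).trans f) o' E
  rw [edgeSign_trans d _ _ _ o, edgeSign, koszul_eq_one d _ _ (enum o) o (enum_lt o), one_mul] at h
  exact h

theorem orderedGraph_congr [Finite I] {ι κ : Type} [Finite ι] [Finite κ] (f : ι ≃ κ)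
    (o : LinearOrder ι)
    (o' : LinearOrder κ) (h : ∀ x y, o.lt x y → o'.lt (f x) (f y)) (E : κ → I × I) :
    orderedGraph K d c k o (E ∘ f) = orderedGraph K d c k o' E := by
  rw [orderedGraph_comp_equiv f o o', edgeSign, koszul_eq_one d _ _ f o' h, map_one, one_smul]

theorem graph_eq_orderedGraph [Finite I] {p : ℕ} (E : Fin p → I × I) :
    (show GraSpace K d c k from GraObj.graph d c k E) = orderedGraph K d c k inferInstance E := by
  have h := graph_comp_equiv (K := K) (d := d) (c := c) (k := k) (Equiv.refl (Fin p))
    inferInstance E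
  rw [edgeSign, koszul_eq_one d _ _ _ _ (fun x y h => h), map_one, one_smul] at h
  exact h

/-- A permutation of the edges acts by a power of its sign. -/
theorem orderedGraph_perm [Finite I] {ι : Type} [Fintype ι] [DecidableEq ι] (σ : Equiv.Perm ι)
    (o : LinearOrder ι) (E : ι → I × I) :
    orderedGraph K d c k o (E ∘ σ) = signScalar K (Equiv.Perm.sign σ ^ d) • orderedGraph K d c k o
      E := by
  have h1 : (E ∘ σ) ∘ enum o = (E ∘ enum o) ∘ ((enum o).trans (σ.trans (enum o).symm)) := by
    funext x; simp
  unfold orderedGraph GraObj.graph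
  rw [h1, GraPiece.graph_perm, units_smul_eq K]
  refine (single_smul_gra _ _).trans ?_
  have : Equiv.Perm.sign ((enum o).trans (σ.trans (enum o).symm)) = Equiv.Perm.sign σ := by
    have := Equiv.Perm.sign_permCongr (enum o).symm σ
    rw [← this]
    rfl
  rw [this]

/-- The order on a disjoint union for which the first summand comes first. -/
@[reducible] def sumOrder {α β : Type} (o : LinearOrder α) (o' : LinearOrder β) : LinearOrder
    (α ⊕ β) :=
  inferInstanceAs (LinearOrder (α ⊕ₗ β))

section sumOrder

variable {α β : Type} (o : LinearOrder α) (o' : LinearOrder β)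

@[simp] theorem sumOrder_inl_inl (x y : α) : (sumOrder o o').lt (.inl x) (.inl y) ↔ o.lt x y :=
  Sum.Lex.inl_lt_inl_iff

@[simp] theorem sumOrder_inr_inr (x y : β) : (sumOrder o o').lt (.inr x) (.inr y) ↔ o'.lt x y :=
  Sum.Lex.inr_lt_inr_iff

@[simp] theorem sumOrder_inl_inr (x : α) (y : β) : (sumOrder o o').lt (.inl x) (.inr y) :=
  Sum.Lex.inl_lt_inr x y

@[simp] theorem not_sumOrder_inr_inl (x : β) (y : α) : ¬ (sumOrder o o').lt (.inr x) (.inl y) :=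
  Sum.Lex.not_inr_lt_inl

end sumOrder

/-- The condition on the edges of a graph to be a generator of the operad of oriented graphs. -/
def IsOrientedGraph (c : I → Colour) (k : Colour) {ι : Type} (E : ι → I × I) : Prop :=
  Nonempty I ∧ (∀ v, ¬ Relation.TransGen (fun x y => ∃ e, E e = (x, y)) v v) ∧
    match k with
    | .white => ∀ e, c (E e).1 = .black
    | .black => ∀ v, c v = .black

theorem isGraph_comp_equiv {ι : Type} {p : ℕ} (f : Fin p ≃ ι) (E : ι → I × I) :
    IsGraph c k (E ∘ f) ↔ IsOrientedGraph c k E := by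
  unfold IsGraph IsOrientedGraph
  have h : (fun x y => ∃ e, (E ∘ f) e = (x, y)) = fun x y => ∃ e, E e = (x, y) := by
    funext x y
    exact propext (f.exists_congr_left.trans (by simp))
  rw [h]
  cases k with
  | white => simp only [Function.comp_apply, f.forall_congr_left, Equiv.apply_symm_apply]
  | black => rfl

/-- All ways to reattach the edges of a graph after substituting a graph into the vertex `i`. -/
noncomputable def reattach [Finite I] [Finite J] (i : I) {ι : Type} [Finite ι] (E : ι → I × I) :
    Finset (ι → (Without i ⊕ J) × (Without i ⊕ J)) :=
  (Set.toFinite {E' | ∀ e,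
    Prod.map (GraPiece.collapse i) (GraPiece.collapse i) (E' e) = E e}).toFinset

theorem mem_reattach [Finite I] [Finite J] {i : I} {ι : Type} [Finite ι] {E : ι → I × I}
    {E' : ι → (Without i ⊕ J) × (Without i ⊕ J)} : E' ∈ reattach i E ↔ ∀ e,
    Prod.map (GraPiece.collapse i) (GraPiece.collapse i) (E' e) = E e := by
  simp [reattach]

/-- The union of the reattached edges of the first graph and the edges of the second graph. -/
def joinEdges {i : I} {ι κ : Type} (E' : ι → (Without i ⊕ J) × (Without i ⊕ J)) (E₂ : κ → J × J) :
    ι ⊕ κ → (Without i ⊕ J) × (Without i ⊕ J) :=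
  Sum.elim E' (Prod.map Sum.inr Sum.inr ∘ E₂)

theorem comp_graph [Finite I] [Finite J] (i : I) {q r : ℕ} {E₁ : Fin q → I × I}
    {E₂ : Fin r → J × J} (h₁ : IsGraph c k E₁) (h₂ : IsGraph c' l E₂) :
    GraObj.comp i (GraObj.graph d c k E₁ : GraObj K d c k) (GraObj.graph d c' l E₂) =
      ∑ E' ∈ GraPiece.reattachments i E₁,
        GraObj.graph d (graftColour c i c') k (GraPiece.union i rfl E' E₂) := by
  funext p
  rw [Finset.sum_apply]
  change ∑ a : Finset.HasAntidiagonal.antidiagonal p, _ = _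
  by_cases hp : q + r = p
  · subst hp
    rw [Finset.sum_eq_single ⟨(q, r), by simp⟩]
    · simp only [GraObj.graph, Pi.single_eq_same]
      unfold GraPiece.comp
      rw [GraPiece.lift_graph _ _ h₁, GraPiece.lift_graph _ _ h₂]
      rfl
    · rintro ⟨⟨a, b⟩, hab⟩ _ hne
      by_cases ha : a = q
      · subst ha
        have hb : b ≠ r := fun hb => hne (by subst hb; rfl)
        simp [GraObj.graph, Pi.single_eq_of_ne hb]
      · simp [GraObj.graph, Pi.single_eq_of_ne ha]
    · simp
  · rw [Finset.sum_eq_zero, Finset.sum_eq_zero]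
    · intro E' _
      exact Pi.single_eq_of_ne (Ne.symm hp) _
    · rintro ⟨⟨a, b⟩, hab⟩ _
      have hab' : a + b = p := by simpa using hab
      by_cases ha : a = q
      · subst ha
        have hb : b ≠ r := fun hb => hp (by subst hb; exact hab')
        simp [GraObj.graph, Pi.single_eq_of_ne hb]
      · simp [GraObj.graph, Pi.single_eq_of_ne ha]

theorem comp_orderedGraph [Finite I] [Finite J] (i : I) (h : c i = l) {ι κ : Type} [Finite ι]
    [Finite κ]
    (o : LinearOrder ι) (o' : LinearOrder κ) {E₁ : ι → I × I} {E₂ : κ → J × J}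
    (h₁ : IsOrientedGraph c k E₁) (h₂ : IsOrientedGraph c' l E₂) :
    (gra K d).comp i h (orderedGraph K d c k o E₁) (orderedGraph K d c' l o' E₂) =
      ∑ E' ∈ reattach i E₁,
        orderedGraph K d (graftColour c i c') k (sumOrder o o') (joinEdges E' E₂) := by
  refine (comp_graph i ((isGraph_comp_equiv (enum o) _).2 h₁)
    ((isGraph_comp_equiv (enum o') _).2 h₂)).trans ?_
  symm
  refine Finset.sum_bij (fun E' _ => E' ∘ enum o) ?_ ?_ ?_ ?_
  · intro E' hE'
    rw [mem_reattach] at hE'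
    simp only [GraPiece.reattachments, Set.Finite.mem_toFinset, Set.mem_ofPred_eq]
    exact fun e => hE' (enum o e)
  · intro E' _ E'' _ h
    exact (enum o).surjective.injective_comp_right h
  · intro E' hE'
    simp only [GraPiece.reattachments, Set.Finite.mem_toFinset, Set.mem_ofPred_eq] at hE'
    refine ⟨E' ∘ (enum o).symm, ?_, ?_⟩
    · rw [mem_reattach]
      intro e
      simpa using hE' ((enum o).symm e)
    · funext e; simp
  · intro E' _
    let g : Fin (Nat.card ι + Nat.card κ) ≃ ι ⊕ κ :=
      finSumFinEquiv.symm.trans (Equiv.sumCongr (enum o) (enum o'))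
    have hg : GraPiece.union i rfl (E' ∘ enum o) (E₂ ∘ enum o') = joinEdges E' E₂ ∘ g := by
      funext e
      obtain ⟨e, rfl⟩ := (finSumFinEquiv).surjective e
      rcases e with e | e <;> simp [GraPiece.union, joinEdges, g, GraPiece.edgeEquiv] <;> rfl
    rw [hg]
    refine Eq.trans ?_ (graph_comp_equiv g (sumOrder o o') (joinEdges E' E₂)).symm
    rw [edgeSign, koszul_eq_one, map_one, one_smul]
    · intro x y hxy
      obtain ⟨x, rfl⟩ := (finSumFinEquiv).surjective x
      obtain ⟨y, rfl⟩ := (finSumFinEquiv).surjective y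
      simp only [g, Equiv.trans_apply, Equiv.symm_apply_apply]
      rcases x with x | x <;> rcases y with y | y <;>
        simp only [Equiv.sumCongr_apply, Sum.map_inl, Sum.map_inr, sumOrder_inl_inl,
          sumOrder_inr_inr, sumOrder_inl_inr, not_sumOrder_inr_inl]
      · exact enum_lt o _ _ (Fin.lt_def.2 (by simpa using Fin.lt_def.1 hxy))
      · simp [Fin.lt_def] at hxy
        omega
      · exact enum_lt o' _ _ (Fin.lt_def.2 (by simpa using Fin.lt_def.1 hxy))

theorem isOrientedGraph_relabel (e : I ≃ J) (h : ∀ i, c' (e i) = c i) {ι : Type} (E : ι → I × I) :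
    IsOrientedGraph c k E ↔ IsOrientedGraph c' k (Prod.map e e ∘ E) := by
  have hrel : ∀ (f : I ≃ J) (E : ι → I × I),
      (∀ v, ¬ Relation.TransGen (fun x y => ∃ e, (Prod.map f f ∘ E) e = (x, y)) v v) →
      ∀ v, ¬ Relation.TransGen (fun x y => ∃ e, E e = (x, y)) v v := by
    intro f E hE v hv
    refine hE (f v) (Relation.TransGen.lift f ?_ _ _ hv)
    rintro x y ⟨e, he⟩
    exact ⟨e, by simp [he]⟩
  have hrel' : (∀ v, ¬ Relation.TransGen (fun x y => ∃ e, E e = (x, y)) v v) →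
      ∀ v, ¬ Relation.TransGen (fun x y => ∃ e', (Prod.map e e ∘ E) e' = (x, y)) v v := by
    intro hE v hv
    refine hE (e.symm v) (Relation.TransGen.lift e.symm ?_ _ _ hv)
    rintro x y ⟨e', he⟩
    refine ⟨e', ?_⟩
    simp only [Function.comp_apply, Prod.map_apply', Prod.mk.injEq] at he
    simp [← he.1, ← he.2]
  unfold IsOrientedGraph
  refine and_congr e.nonempty_congr (and_congr ⟨hrel', hrel e E⟩ ?_)
  cases k with
  | white => simp [h]
  | black => exact ⟨fun hb v => by rw [← e.apply_symm_apply v, h]; exact hb _,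
      fun hb v => by rw [← h]; exact hb _⟩

theorem relabel_graph (e : I ≃ J) (h : ∀ i, c' (e i) = c i) {p : ℕ} (E : Fin p → I × I) :
    GraObj.relabel e (GraObj.graph d c k E : GraObj K d c k) =
      GraObj.graph d c' k (Prod.map e e ∘ E) := by
  have hgr : IsGraph c k E ↔ IsGraph c' k (Prod.map e e ∘ E) :=
    (isGraph_comp_equiv (Equiv.refl _) E).trans ((isOrientedGraph_relabel e h E).trans
      (isGraph_comp_equiv (Equiv.refl _) (Prod.map e e ∘ E)).symm)
  funext q
  change GraPiece.relabel e ((GraObj.graph d c k E : GraObj K d c k) q) = _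
  unfold GraObj.graph
  by_cases hq : q = p
  · subst hq
    simp only [Pi.single_eq_same]
    by_cases hE : IsGraph c k E
    · exact GraPiece.lift_graph _ _ hE
    · rw [GraPiece.graph, dif_neg hE, map_zero, GraPiece.graph, dif_neg (fun h => hE (hgr.2 h))]
  · rw [Pi.single_eq_of_ne hq, Pi.single_eq_of_ne hq, map_zero]

theorem relabel_orderedGraph [Finite I] [Finite J] (e : I ≃ J) (h : ∀ i, c' (e i) = c i)
    {ι : Type} [Finite ι]
    (o : LinearOrder ι) (E : ι → I × I) :
    (gra K d).relabel e h (orderedGraph K d c k o E) =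
      orderedGraph K d c' k o (Prod.map e e ∘ E) :=
  relabel_graph e h _

/-! ### Reduction of identities to graphs -/

/-- The component with `p` edges. -/
noncomputable def piece [Finite I] (p : ℕ) : GraSpace K d c k →ₗ[K] GraPiece K d c k p :=
  (LinearMap.proj p : GraObj K d c k →ₗ[K] GraPiece K d c k p)

/-- A linear map whose component with `p` edges only depends on the components of the argument with
at most `p` edges. -/
def IsLocal [Finite I] [Finite J] (f : GraSpace K d c k →ₗ[K] GraSpace K d c' l) : Prop :=
  ∀ p x, (∀ q ≤ p, piece q x = 0) → piece p (f x) = 0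

theorem IsLocal.comp [Finite I] [Finite J] [Finite L] {g : GraSpace K d c' l →ₗ[K] GraSpace K d c''
    m}
    {f : GraSpace K d c k →ₗ[K] GraSpace K d c' l} (hg : IsLocal g) (hf : IsLocal f) :
    IsLocal (g ∘ₗ f) :=
  fun p x hx => hg p (f x) fun q hq => hf q x fun r hr => hx r (hr.trans hq)

theorem IsLocal.smul [Finite I] [Finite J] {f : GraSpace K d c k →ₗ[K] GraSpace K d c' l}
    (hf : IsLocal f) (r : K) : IsLocal (r • f) := fun p x hx => by
  rw [LinearMap.smul_apply, map_smul, hf p x hx, smul_zero]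

theorem isLocal_id [Finite I] : IsLocal (LinearMap.id : GraSpace K d c k →ₗ[K] GraSpace K d c k) :=
  fun p _ hx => hx p le_rfl

theorem piece_relabel [Finite I] [Finite J] (e : I ≃ J) (h : ∀ i, c' (e i) = c i)
    (p : ℕ) (x : GraSpace K d c k) :
    piece p ((gra K d).relabel e h x) = GraPiece.relabel e (piece p x) := rfl

theorem piece_comp [Finite I] [Finite J] (i : I) (h : c i = l) (p : ℕ) (x : GraSpace K d c k)
    (y : GraSpace K d c' l) : piece p ((gra K d).comp i h x y) =
      ∑ q : Finset.HasAntidiagonal.antidiagonal p,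
        GraPiece.comp i (Finset.HasAntidiagonal.mem_antidiagonal.1 q.2) (piece q.1.1 x)
          (piece q.1.2 y) := rfl

theorem isLocal_relabel [Finite I] [Finite J] (e : I ≃ J) (h : ∀ i, c' (e i) = c i) :
    IsLocal ((gra K d).relabel (k := k) e h) := fun p x hx => by
  rw [piece_relabel, hx p le_rfl, map_zero]

theorem isLocal_comp_left [Finite I] [Finite J] (i : I) (h : c i = l) (y : GraSpace K d c' l) :
    IsLocal (((gra K d).comp (k := k) i h).flip y) := fun p x hx => by
  rw [LinearMap.flip_apply, piece_comp]
  refine Finset.sum_eq_zero fun q _ => ?_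
  have := Finset.HasAntidiagonal.mem_antidiagonal.1 q.2
  rw [hx q.1.1 (by omega), map_zero, LinearMap.zero_apply]

theorem isLocal_comp_right [Finite I] [Finite J] (i : I) (h : c i = l) (x : GraSpace K d c k) :
    IsLocal ((gra K d).comp (c' := c') i h x) := fun p y hy => by
  rw [piece_comp]
  refine Finset.sum_eq_zero fun q _ => ?_
  have := Finset.HasAntidiagonal.mem_antidiagonal.1 q.2
  rw [hy q.1.2 (by omega), map_zero]

/-- Local maps that agree on graphs whose numbers of edges satisfy `P` agree on all elements whose
components vanish in the other numbers of edges. -/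
theorem eq_of_isLocal [Finite I] [Finite J] {f g : GraSpace K d c k →ₗ[K] GraSpace K d c' l}
    (hf : IsLocal f) (hg : IsLocal g) (P : ℕ → Prop)
    (h : ∀ (p : ℕ) (E : Fin p → I × I), P p → IsOrientedGraph c k E →
      f (orderedGraph K d c k inferInstance E) = g (orderedGraph K d c k inferInstance E))
    (x : GraSpace K d c k) (hx : ∀ q, ¬ P q → piece q x = 0) : f x = g x := by
  classical
  let ι (q : ℕ) : GraPiece K d c k q →ₗ[K] GraSpace K d c k :=
    (LinearMap.single K (GraPiece K d c k) q : GraPiece K d c k q →ₗ[K] GraObj K d c k)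
  have hι (p q : ℕ) (y : GraPiece K d c k q) (hpq : p ≠ q) : piece p (ι q y) = 0 :=
    Pi.single_eq_of_ne hpq y
  have hι' (p : ℕ) (y : GraPiece K d c k p) : piece p (ι p y) = y := Pi.single_eq_same p y
  have hfg : ∀ q, P q → f ∘ₗ ι q = g ∘ₗ ι q := fun q hq => GraPiece.ext fun E hE => by
    have h1 := h q E hq ((isGraph_comp_equiv (Equiv.refl _) E).1 hE)
    rw [← graph_eq_orderedGraph] at h1
    exact h1
  suffices hp : ∀ p, piece p (f x) = piece p (g x) from funext hp
  intro p
  have htrunc : ∀ f : GraSpace K d c k →ₗ[K] GraSpace K d c' l, IsLocal f →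
      piece p (f x) = ∑ q ∈ Finset.range (p + 1), piece p (f (ι q (piece q x))) := by
    intro f hf
    rw [← map_sum, ← map_sum, ← sub_eq_zero, ← map_sub, ← map_sub]
    refine hf p _ fun q hq => ?_
    rw [map_sub, map_sum, Finset.sum_eq_single q, hι', sub_self]
    · exact fun r _ hr => hι _ _ _ (Ne.symm hr)
    · exact fun hq' => absurd (Finset.mem_range.2 (by omega)) hq'
  rw [htrunc f hf, htrunc g hg]
  refine Finset.sum_congr rfl fun q _ => ?_
  by_cases hq : P q
  · exact congrArg (piece p) (LinearMap.congr_fun (hfg q hq) _)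
  · simp only [hx q hq, map_zero]

theorem eq_of_isLocal' [Finite I] [Finite J] {f g : GraSpace K d c k →ₗ[K] GraSpace K d c' l}
    (hf : IsLocal f) (hg : IsLocal g)
    (h : ∀ (p : ℕ) (E : Fin p → I × I), IsOrientedGraph c k E →
      f (orderedGraph K d c k inferInstance E) = g (orderedGraph K d c k inferInstance E))
    (x : GraSpace K d c k) : f x = g x :=
  eq_of_isLocal hf hg (fun _ => True) (fun p E _ => h p E) x (fun _ hq => absurd trivial hq)

theorem mem_gra_deg [Finite I] {n : ℤ} {x : GraSpace K d c k} :
    x ∈ (gra K d).deg n ↔ ∀ p : ℕ, -d * p ≠ n → piece p x = 0 := Iff.rfl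

theorem gra_relabel_mem_deg [Finite I] [Finite J] (e : I ≃ J) (h : ∀ i, c' (e i) = c i) {n : ℤ}
    {x : GraSpace K d c k} (hx : x ∈ (gra K d).deg n) :
    (gra K d).relabel e h x ∈ (gra K d).deg n := by
  rw [mem_gra_deg] at hx ⊢
  intro p hp
  rw [piece_relabel, hx p hp, map_zero]

theorem gra_comp_mem_deg [Finite I] [Finite J] (i : I) (h : c i = l) {n n' : ℤ}
    {x : GraSpace K d c k} {y : GraSpace K d c' l} (hx : x ∈ (gra K d).deg n)
    (hy : y ∈ (gra K d).deg n') : (gra K d).comp i h x y ∈ (gra K d).deg (n + n') := by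
  rw [mem_gra_deg] at hx hy ⊢
  intro p hp
  rw [piece_comp]
  refine Finset.sum_eq_zero fun q _ => ?_
  have hq := Finset.HasAntidiagonal.mem_antidiagonal.1 q.2
  by_cases h1 : -d * q.1.1 = n
  · rw [hy q.1.2, map_zero]
    rintro h2
    apply hp
    rw [← hq, ← h1, ← h2]
    push_cast
    ring
  · rw [hx q.1.1 h1, map_zero, LinearMap.zero_apply]

theorem orderedGraph_mem_deg [Finite I] {ι : Type} [Finite ι] (o : LinearOrder ι)
    (E : ι → I × I) : orderedGraph K d c k o E ∈ (gra K d).deg (-d * Nat.card ι) := by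
  rw [mem_gra_deg]
  intro p hp
  exact Pi.single_eq_of_ne (fun hh => hp (by rw [hh])) _

/-! ### The axioms of an operad for oriented graphs -/

theorem gra_relabel_refl [Finite I] (x : GraSpace K d c k) (h : ∀ i, c (Equiv.refl I i) = c i) :
    (gra K d).relabel (Equiv.refl I) h x = x := by
  refine eq_of_isLocal' (isLocal_relabel _ h) isLocal_id (fun p E _ => ?_) x
  rw [relabel_orderedGraph]
  rfl

theorem gra_relabel_relabel [Finite I] [Finite J] [Finite L] (x : GraSpace K d c k) (e : I ≃ J)
    (h : ∀ i, c' (e i) = c i) (e' : J ≃ L) (h' : ∀ j, c'' (e' j) = c' j)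
    (h'' : ∀ i, c'' (e.trans e' i) = c i) :
    (gra K d).relabel e' h' ((gra K d).relabel e h x) = (gra K d).relabel (e.trans e') h'' x := by
  refine eq_of_isLocal' ((isLocal_relabel e' h').comp (isLocal_relabel e h))
    (isLocal_relabel _ h'') (fun p E _ => ?_) x
  rw [LinearMap.comp_apply, relabel_orderedGraph, relabel_orderedGraph, relabel_orderedGraph]
  rfl

theorem isOrientedGraph_joinEdges [Finite I] [Finite J] {i : I} (hi : c i = l) {ι κ : Type}
    [Finite ι] [Finite κ] {E₁ : ι → I × I} {E₂ : κ → J × J} (h₁ : IsOrientedGraph c k E₁)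
    (h₂ : IsOrientedGraph c' l E₂) {E' : ι → (Without i ⊕ J) × (Without i ⊕ J)}
    (hE' : E' ∈ reattach i E₁) :
    IsOrientedGraph (graftColour c i c') k (joinEdges E' E₂) := by
  have e₁ := Finite.equivFin ι
  have e₂ := Finite.equivFin κ
  have h := GraPiece.isGraph_union hi rfl ((isGraph_comp_equiv e₁.symm _).2 h₁)
    ((isGraph_comp_equiv e₂.symm _).2 h₂) (E' := E' ∘ e₁.symm) (by
      simp only [GraPiece.reattachments, Set.Finite.mem_toFinset, Set.mem_ofPred_eq]
      exact fun e => mem_reattach.1 hE' (e₁.symm e))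
  rw [← isGraph_comp_equiv (finSumFinEquiv.symm.trans (Equiv.sumCongr e₁.symm e₂.symm))]
  convert h using 1
  funext e
  obtain ⟨e, rfl⟩ := (finSumFinEquiv).surjective e
  rcases e with e | e <;> simp [GraPiece.union, joinEdges, GraPiece.edgeEquiv] <;> rfl

theorem collapse_graftEquiv {I' J' : Type} (e : I ≃ I') (e' : J ≃ J') (i : I)
    (x : Without i ⊕ J) :
    GraPiece.collapse (e i) (graftEquiv e i e' x) = e (GraPiece.collapse i x) := by
  rcases x with x | x <;> rfl

theorem gra_comp_relabel {I' J' : Type} [Finite I] [Finite J] [Finite I'] [Finite J']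
    {c₁ : I' → Colour} {c₁' : J' → Colour}
    (x : GraSpace K d c k) (y : GraSpace K d c' l) (i : I) (h : c i = l)
    (e : I ≃ I') (he : ∀ i, c₁ (e i) = c i) (e' : J ≃ J') (he' : ∀ j, c₁' (e' j) = c' j)
    (h' : c₁ (e i) = l)
    (hg : ∀ x, graftColour c₁ (e i) c₁' (graftEquiv e i e' x) = graftColour c i c' x) :
    (gra K d).comp (e i) h' ((gra K d).relabel e he x) ((gra K d).relabel e' he' y) =
      (gra K d).relabel (graftEquiv e i e') hg ((gra K d).comp i h x y) := by
  refine eq_of_isLocal' (f := ((gra K d).comp (e i) h').flip ((gra K d).relabel e' he' y) ∘ₗ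
      (gra K d).relabel e he)
    (g := (gra K d).relabel (graftEquiv e i e') hg ∘ₗ ((gra K d).comp i h).flip y)
    ((isLocal_comp_left _ _ _).comp (isLocal_relabel _ _))
    ((isLocal_relabel _ _).comp (isLocal_comp_left _ _ _)) (fun q E₁ h₁ => ?_) x
  simp only [LinearMap.comp_apply, LinearMap.flip_apply]
  refine eq_of_isLocal' (f := ((gra K d).comp (e i) h' _) ∘ₗ (gra K d).relabel e' he')
    (g := (gra K d).relabel (graftEquiv e i e') hg ∘ₗ ((gra K d).comp i h _))
    ((isLocal_comp_right _ _ _).comp (isLocal_relabel _ _))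
    ((isLocal_relabel _ _).comp (isLocal_comp_right _ _ _)) (fun r E₂ h₂ => ?_) y
  simp only [LinearMap.comp_apply]
  rw [comp_orderedGraph i h _ _ h₁ h₂, map_sum, relabel_orderedGraph, relabel_orderedGraph,
    comp_orderedGraph]
  rotate_left
  · exact (isOrientedGraph_relabel e he _).1 h₁
  · exact (isOrientedGraph_relabel e' he' _).1 h₂
  symm
  refine Finset.sum_bij (fun E' _ => Prod.map (graftEquiv e i e') (graftEquiv e i e') ∘ E')
    ?_ ?_ ?_ ?_
  · intro E' hE'
    rw [mem_reattach] at hE' ⊢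
    intro a
    rw [Function.comp_apply, Function.comp_apply, ← hE' a]
    simp only [Prod.map, collapse_graftEquiv]
  · intro E' _ E'' _ hh
    exact (Function.Injective.prodMap (graftEquiv e i e').injective
      (graftEquiv e i e').injective).comp_left hh
  · intro E' hE'
    rw [mem_reattach] at hE'
    refine ⟨Prod.map (graftEquiv e i e').symm (graftEquiv e i e').symm ∘ E', ?_, ?_⟩
    · rw [mem_reattach]
      intro a
      apply Function.Injective.prodMap e.injective e.injective
      refine Eq.trans ?_ (hE' a)
      simp only [Prod.map, Function.comp_apply, ← collapse_graftEquiv (e' := e'),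
        Equiv.apply_symm_apply]
    · funext a
      simp only [Function.comp_apply, Prod.map_apply', Equiv.apply_symm_apply]
  · intro E' _
    rw [relabel_orderedGraph]
    congr 1
    funext a
    rcases a with a | a <;> rfl

theorem collapse_inr_assoc_symm (i : I) (j : J) (v : Without j ⊕ L) :
    GraPiece.collapse (Sum.inr j : Without i ⊕ J) ((assocEquiv i j).symm (Sum.inr v)) =
      Sum.inr (GraPiece.collapse j v) := by
  rcases v with v | v <;> rfl

theorem collapse_collapse_inr (i : I) (j : J) (z : Without (Sum.inr j : Without i ⊕ J) ⊕ L) :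
    GraPiece.collapse i (GraPiece.collapse (Sum.inr j : Without i ⊕ J) z) =
      GraPiece.collapse i (assocEquiv i j z) := by
  rcases z with ⟨z | z, hz⟩ | z <;> rfl

theorem exists_of_collapse_eq_inr {i : I} {j : J} {z : Without (Sum.inr j : Without i ⊕ J) ⊕ L}
    {w : J} (h : GraPiece.collapse (Sum.inr j : Without i ⊕ J) z = Sum.inr w) :
    ∃ v, assocEquiv i j z = Sum.inr v ∧ GraPiece.collapse j v = w := by
  rcases z with ⟨z | z, hz⟩ | z
  · simp [GraPiece.collapse] at h
  · exact ⟨_, rfl, Sum.inr_injective h⟩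
  · exact ⟨_, rfl, Sum.inr_injective h⟩

theorem gra_assoc [Finite I] [Finite J] [Finite L] (x : GraSpace K d c k) (y : GraSpace K d c' l)
    (z : GraSpace K d c'' m) (i : I) (h : c i = l) (j : J) (h' : c' j = m)
    (h'' : graftColour c i c' (Sum.inr j) = m)
    (hg : ∀ y, graftColour c i (graftColour c' j c'') (assocEquiv i j y) =
      graftColour (graftColour c i c') (Sum.inr j) c'' y) :
    (gra K d).relabel (assocEquiv i j) hg
        ((gra K d).comp (Sum.inr j) h'' ((gra K d).comp i h x y) z) =
      (gra K d).comp i h x ((gra K d).comp j h' y z) := by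
  refine eq_of_isLocal' (f := (gra K d).relabel (assocEquiv i j) hg ∘ₗ
      ((gra K d).comp (Sum.inr j) h'').flip z ∘ₗ ((gra K d).comp i h).flip y)
    (g := ((gra K d).comp i h).flip ((gra K d).comp j h' y z))
    ((isLocal_relabel _ _).comp ((isLocal_comp_left _ _ _).comp (isLocal_comp_left _ _ _)))
    (isLocal_comp_left _ _ _) (fun p E₁ h₁ => ?_) x
  simp only [LinearMap.comp_apply, LinearMap.flip_apply]
  refine eq_of_isLocal' (f := (gra K d).relabel (assocEquiv i j) hg ∘ₗ
      ((gra K d).comp (Sum.inr j) h'').flip z ∘ₗ ((gra K d).comp i h _))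
    (g := ((gra K d).comp i h _) ∘ₗ ((gra K d).comp j h').flip z)
    ((isLocal_relabel _ _).comp ((isLocal_comp_left _ _ _).comp (isLocal_comp_right _ _ _)))
    ((isLocal_comp_right _ _ _).comp (isLocal_comp_left _ _ _)) (fun q E₂ h₂ => ?_) y
  simp only [LinearMap.comp_apply, LinearMap.flip_apply]
  refine eq_of_isLocal' (f := (gra K d).relabel (assocEquiv i j) hg ∘ₗ
      ((gra K d).comp (Sum.inr j) h'' _))
    (g := ((gra K d).comp i h _) ∘ₗ ((gra K d).comp j h' _))
    ((isLocal_relabel _ _).comp (isLocal_comp_right _ _ _))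
    ((isLocal_comp_right _ _ _).comp (isLocal_comp_right _ _ _)) (fun r E₃ h₃ => ?_) z
  simp only [LinearMap.comp_apply]
  rw [comp_orderedGraph i h _ _ h₁ h₂, comp_orderedGraph j h' _ _ h₂ h₃, map_sum, map_sum,
    LinearMap.sum_apply, map_sum]
  have hl : ∀ E' ∈ reattach i E₁, (gra K d).relabel (assocEquiv i j) hg
      ((gra K d).comp (Sum.inr j) h''
        (orderedGraph K d (graftColour c i c') k (sumOrder inferInstance inferInstance)
          (joinEdges E' E₂)) (orderedGraph K d c'' m inferInstance E₃)) =
      ∑ E'' ∈ reattach (Sum.inr j) (joinEdges E' E₂),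
        orderedGraph K d (graftColour c i (graftColour c' j c'')) k
          (sumOrder (sumOrder inferInstance inferInstance) inferInstance)
          (Prod.map (assocEquiv i j) (assocEquiv i j) ∘ joinEdges E'' E₃) := by
    intro E' hE'
    rw [comp_orderedGraph _ h'' _ _ (isOrientedGraph_joinEdges h h₁ h₂ hE') h₃, map_sum]
    exact Finset.sum_congr rfl fun E'' _ => relabel_orderedGraph _ _ _ _
  have hr : ∀ F' ∈ reattach j E₂, (gra K d).comp i h (orderedGraph K d c k inferInstance E₁)
      (orderedGraph K d (graftColour c' j c'') l (sumOrder inferInstance inferInstance)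
          (joinEdges F' E₃)) =
      ∑ F'' ∈ reattach i E₁,
        orderedGraph K d (graftColour c i (graftColour c' j c'')) k
          (sumOrder inferInstance (sumOrder inferInstance inferInstance))
          (joinEdges F'' (joinEdges F' E₃)) := by
    intro F' hF'
    rw [comp_orderedGraph _ h _ _ h₁ (isOrientedGraph_joinEdges h' h₂ h₃ hF')]
  rw [Finset.sum_congr rfl hl, Finset.sum_congr rfl hr, Finset.sum_sigma', ← Finset.sum_product']
  symm
  set a := (assocEquiv i j : _ ≃ Without i ⊕ (Without j ⊕ L)) with ha
  refine Finset.sum_bij (fun F _ => (⟨Prod.map (GraPiece.collapse (Sum.inr j))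
      (GraPiece.collapse (Sum.inr j)) ∘ Prod.map a.symm a.symm ∘ F.2,
      Sum.elim (Prod.map a.symm a.symm ∘ F.2) (Prod.map a.symm a.symm ∘ Prod.map Sum.inr Sum.inr ∘
        F.1)⟩ :
      (_ : Fin p → (Without i ⊕ J) × (Without i ⊕ J)) × _)) ?_ ?_ ?_ ?_
  · rintro ⟨F', F''⟩ hF
    rw [Finset.mem_product, mem_reattach, mem_reattach] at hF
    rw [Finset.mem_sigma, mem_reattach, mem_reattach]
    refine ⟨fun e => ?_, ?_⟩
    · rw [← hF.2 e]
      simp [Prod.map, collapse_collapse_inr, ← ha]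
    · rintro (e | e)
      · rfl
      · simp [Prod.map, collapse_inr_assoc_symm, ← hF.1 e, joinEdges, ha]
  · rintro ⟨F', F''⟩ _ ⟨G', G''⟩ _ hFG
    have h2 := eq_of_heq (Sigma.mk.inj hFG).2
    have h3 : F'' = G'' := by
      funext e
      have := congrFun h2 (Sum.inl e)
      exact Function.Injective.prodMap a.symm.injective a.symm.injective this
    have h4 : F' = G' := by
      funext e
      have := congrFun h2 (Sum.inr e)
      exact Function.Injective.prodMap Sum.inr_injective Sum.inr_injective
        (Function.Injective.prodMap a.symm.injective a.symm.injective this)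
    rw [h3, h4]
  · rintro ⟨E', E''⟩ hE
    rw [Finset.mem_sigma, mem_reattach, mem_reattach] at hE
    have h4 : ∀ e, ∃ v : (Without j ⊕ L) × (Without j ⊕ L),
        Prod.map a a (E'' (.inr e)) = Prod.map Sum.inr Sum.inr v ∧
          Prod.map (GraPiece.collapse j) (GraPiece.collapse j) v = E₂ e := by
      intro e
      have h5 := hE.2 (.inr e)
      obtain ⟨v₁, h6, h7⟩ := exists_of_collapse_eq_inr (congrArg Prod.fst h5)
      obtain ⟨v₂, h8, h9⟩ := exists_of_collapse_eq_inr (congrArg Prod.snd h5)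
      exact ⟨(v₁, v₂), Prod.ext h6 h8, Prod.ext h7 h9⟩
    choose F' hF' hF2 using h4
    refine ⟨(F', Prod.map a a ∘ E'' ∘ Sum.inl), ?_, ?_⟩
    · rw [Finset.mem_product, mem_reattach, mem_reattach]
      refine ⟨hF2, fun e => ?_⟩
      rw [← hE.1 e]
      have h5 := hE.2 (.inl e)
      simp only [joinEdges, Sum.elim_inl] at h5
      change _ = Prod.map _ _ (E' e)
      rw [← h5]
      simp [Prod.map, collapse_collapse_inr, ← ha]
    · have h6 : Prod.map (GraPiece.collapse (Sum.inr j)) (GraPiece.collapse (Sum.inr j)) ∘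
          Prod.map a.symm a.symm ∘ Prod.map a a ∘ E'' ∘ Sum.inl = E' := by
        funext e
        have h5 := hE.2 (.inl e)
        simp only [joinEdges, Sum.elim_inl] at h5
        simpa [Prod.map] using h5
      have h7 : Sum.elim (Prod.map a.symm a.symm ∘ Prod.map a a ∘ E'' ∘ Sum.inl)
          (Prod.map a.symm a.symm ∘ Prod.map Sum.inr Sum.inr ∘ F') = E'' := by
        funext e
        rcases e with e | e
        · simp [Prod.map]
        · simpa [Prod.map] using (congrArg (Prod.map a.symm a.symm) (hF' e)).symm
      exact Sigma.ext h6 (heq_of_eq h7)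
  · rintro ⟨F', F''⟩ _
    rw [← orderedGraph_congr (Equiv.sumAssoc (Fin p) (Fin q) (Fin r))
      (sumOrder (sumOrder inferInstance inferInstance) inferInstance)]
    · congr 1
      funext e
      rcases e with (e | e) | e
      · simp [joinEdges, Prod.map]
      · simp [joinEdges, Prod.map]
      · rfl
    · rintro ((x | x) | x) ((y | y) | y) <;> simp

theorem reattach_empty [Finite I] [Finite J] (i : I) (E : Fin 0 → I × I) :
    reattach (J := J) i E = {Fin.elim0} := by
  ext E'
  simp only [mem_reattach, Finset.mem_singleton, IsEmpty.forall_iff, true_iff]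
  exact Subsingleton.elim _ _

theorem isOrientedGraph_unit (k : Colour) :
    IsOrientedGraph (fun _ : Unit => k) k (Fin.elim0 : Fin 0 → Unit × Unit) := by
  refine ⟨inferInstance, fun v hv => ?_, ?_⟩
  · have key : ∀ x y : Unit, ¬ Relation.TransGen
        (fun x y => ∃ e, (Fin.elim0 : Fin 0 → Unit × Unit) e = (x, y)) x y := by
      intro x y hxy
      induction hxy with
      | single h => exact h.elim fun e _ => e.elim0
      | tail _ h => exact h.elim fun e _ => e.elim0
    exact key v v hv
  · cases k with
    | white => exact fun e => e.elim0
    | black => exact fun _ => rfl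

theorem gra_unit_eq (k : Colour) : (gra K d).unit k =
    orderedGraph K d (fun _ => k) k inferInstance (Fin.elim0 : Fin 0 → Unit × Unit) :=
  graph_eq_orderedGraph _

theorem gra_unit_comp [Finite I] (x : GraSpace K d c k)
    (hg : ∀ y, c (unitLeftEquiv I y) = graftColour (fun _ : Unit => k) () c y) :
    (gra K d).relabel (unitLeftEquiv I) hg ((gra K d).comp () rfl ((gra K d).unit k) x) = x := by
  refine eq_of_isLocal' (f := (gra K d).relabel (unitLeftEquiv I) hg ∘ₗ
      ((gra K d).comp () rfl ((gra K d).unit k))) (g := LinearMap.id)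
    ((isLocal_relabel _ _).comp (isLocal_comp_right _ _ _)) isLocal_id (fun p E h => ?_) x
  rw [LinearMap.comp_apply, LinearMap.id_apply, gra_unit_eq,
    comp_orderedGraph _ _ _ _ (isOrientedGraph_unit k) h, reattach_empty, Finset.sum_singleton,
    relabel_orderedGraph, ← orderedGraph_congr (Equiv.emptySum (Fin 0) (Fin p))
      (sumOrder inferInstance inferInstance)]
  · congr 1
    funext e
    rcases e with e | e
    · exact e.elim0
    · rfl
  · rintro (x | x) (y | y)
    · exact x.elim0
    · exact x.elim0
    · exact y.elim0
    · simp

theorem collapse_eq_unitRightEquiv (i : I) (x : Without i ⊕ Unit) :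
    GraPiece.collapse i x = unitRightEquiv i x := by
  rcases x with x | x <;> rfl

theorem gra_comp_unit [Finite I] (x : GraSpace K d c k) (i : I) (h : c i = l)
    (hg : ∀ y, c (unitRightEquiv i y) = graftColour c i (fun _ : Unit => l) y) :
    (gra K d).relabel (unitRightEquiv i) hg ((gra K d).comp i h x ((gra K d).unit l)) = x := by
  refine eq_of_isLocal' (f := (gra K d).relabel (unitRightEquiv i) hg ∘ₗ
      ((gra K d).comp i h).flip ((gra K d).unit l)) (g := LinearMap.id)
    ((isLocal_relabel _ _).comp (isLocal_comp_left _ _ _)) isLocal_id (fun p E hE => ?_) x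
  have hr : reattach i E = {Prod.map (unitRightEquiv i).symm (unitRightEquiv i).symm ∘ E} := by
    ext E'
    simp only [mem_reattach, Finset.mem_singleton, Prod.map, collapse_eq_unitRightEquiv]
    constructor
    · intro h
      funext e
      simp [← h]
    · rintro rfl e
      simp
  rw [LinearMap.comp_apply, LinearMap.flip_apply, LinearMap.id_apply, gra_unit_eq,
    comp_orderedGraph _ _ _ _ hE (isOrientedGraph_unit l), hr, Finset.sum_singleton,
    relabel_orderedGraph, ← orderedGraph_congr (Equiv.sumEmpty (Fin p) (Fin 0))
      (sumOrder inferInstance inferInstance)]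
  · congr 1
    funext e
    rcases e with e | e
    · simp [joinEdges, Prod.map]
    · exact e.elim0
  · rintro (x | x) (y | y)
    · simp
    · exact y.elim0
    · exact x.elim0
    · exact x.elim0

/-- All ways to reattach the edges of a graph after substituting graphs into two vertices. -/
noncomputable def reattachTwo [Finite I] [Finite J] [Finite L] (i : I) (j : Without i) {ι : Type}
    [Finite ι] (E : ι → I × I) :
    Finset (ι → (Without (Sum.inl j : Without i ⊕ J) ⊕ L) ×
      (Without (Sum.inl j : Without i ⊕ J) ⊕ L)) :=
  (Set.toFinite {G | ∀ e, Prod.map (GraPiece.collapse i) (GraPiece.collapse i)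
    (Prod.map (GraPiece.collapse (Sum.inl j : Without i ⊕ J)) (GraPiece.collapse (Sum.inl j))
      (G e)) = E e}).toFinset

theorem mem_reattachTwo [Finite I] [Finite J] [Finite L] {i : I} {j : Without i} {ι : Type}
    [Finite ι] {E : ι → I × I} {G : ι → (Without (Sum.inl j : Without i ⊕ J) ⊕ L) ×
      (Without (Sum.inl j : Without i ⊕ J) ⊕ L)} :
    G ∈ reattachTwo i j E ↔ ∀ e, Prod.map (GraPiece.collapse i) (GraPiece.collapse i)
    (Prod.map (GraPiece.collapse (Sum.inl j : Without i ⊕ J)) (GraPiece.collapse (Sum.inl j))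
      (G e)) = E e := by
  simp [reattachTwo]

/-- The inclusion of the vertices of the graph substituted first. -/
def firstVertex {i : I} (j : Without i) (y : J) : Without (Sum.inl j : Without i ⊕ J) ⊕ L :=
  Sum.inl ⟨Sum.inr y, Sum.inr_ne_inl⟩

theorem eq_firstVertex {i : I} {j : Without i} {y : J}
    {z : Without (Sum.inl j : Without i ⊕ J) ⊕ L}
    (h : GraPiece.collapse (Sum.inl j : Without i ⊕ J) z = Sum.inr y) : z = firstVertex j y := by
  rcases z with ⟨z, hz⟩ | z
  · exact congrArg Sum.inl (Subtype.ext h)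
  · simp [GraPiece.collapse] at h

theorem sum_reattach_reattach {M : Type*} [AddCommMonoid M] [Finite I] [Finite J] [Finite L]
    (i : I) (j : Without i) {ι κ : Type} [Finite ι] [Finite κ] (E₁ : ι → I × I) (E₂ : κ → J × J)
    (f : (ι ⊕ κ → (Without (Sum.inl j : Without i ⊕ J) ⊕ L) ×
      (Without (Sum.inl j : Without i ⊕ J) ⊕ L)) → M) :
    ∑ E' ∈ reattach i E₁, ∑ E'' ∈ reattach (Sum.inl j) (joinEdges E' E₂), f E'' =
      ∑ G ∈ reattachTwo i j E₁, f (Sum.elim G (Prod.map (firstVertex j) (firstVertex j) ∘ E₂)) := by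
  rw [Finset.sum_sigma']
  symm
  refine Finset.sum_bij (fun G _ => (⟨Prod.map (GraPiece.collapse (Sum.inl j))
      (GraPiece.collapse (Sum.inl j)) ∘ G,
      Sum.elim G (Prod.map (firstVertex j) (firstVertex j) ∘ E₂)⟩ :
      (_ : ι → (Without i ⊕ J) × (Without i ⊕ J)) × _)) ?_ ?_ ?_ ?_
  · intro G hG
    rw [mem_reattachTwo] at hG
    rw [Finset.mem_sigma, mem_reattach, mem_reattach]
    refine ⟨hG, ?_⟩
    rintro (e | e) <;> rfl
  · intro G _ G' _ hGG
    have h2 := eq_of_heq (Sigma.mk.inj hGG).2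
    funext e
    exact congrFun h2 (Sum.inl e)
  · rintro ⟨E', E''⟩ hE
    rw [Finset.mem_sigma, mem_reattach, mem_reattach] at hE
    have h1 : Prod.map (GraPiece.collapse (Sum.inl j)) (GraPiece.collapse (Sum.inl j)) ∘
        E'' ∘ Sum.inl = E' := funext fun e => hE.2 (Sum.inl e)
    refine ⟨E'' ∘ Sum.inl, ?_, ?_⟩
    · rw [mem_reattachTwo]
      intro e
      refine Eq.trans ?_ (hE.1 e)
      exact congrArg _ (congrFun h1 e)
    · refine Sigma.ext h1 (heq_of_eq ?_)
      funext e
      rcases e with e | e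
      · rfl
      · have h2 := hE.2 (Sum.inr e)
        exact (Prod.ext (eq_firstVertex (congrArg Prod.fst h2))
          (eq_firstVertex (congrArg Prod.snd h2))).symm
  · intro G _
    rfl

theorem collapse_parallel (i : I) (j : Without i) (z : Without (Sum.inl j : Without i ⊕ J) ⊕ L) :
    GraPiece.collapse j.1 (GraPiece.collapse (Sum.inl ⟨i, j.2.symm⟩ : Without j.1 ⊕ L)
      (parallelEquiv i j z)) =
      GraPiece.collapse i (GraPiece.collapse (Sum.inl j : Without i ⊕ J) z) := by
  rcases z with ⟨z | z, hz⟩ | z <;> rfl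

theorem collapse_parallel_symm (i : I) (j : Without i)
    (z : Without (Sum.inl ⟨i, j.2.symm⟩ : Without j.1 ⊕ L) ⊕ J) :
    GraPiece.collapse i (GraPiece.collapse (Sum.inl j : Without i ⊕ J)
      ((parallelEquiv i j).symm z)) =
      GraPiece.collapse j.1 (GraPiece.collapse (Sum.inl ⟨i, j.2.symm⟩ : Without j.1 ⊕ L) z) := by
  rw [← collapse_parallel, Equiv.apply_symm_apply]

/-- The exchange of the second and the third summand. -/
def sumSwap (α β γ : Type) : (α ⊕ β) ⊕ γ ≃ (α ⊕ γ) ⊕ β :=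
  (Equiv.sumAssoc α β γ).trans
    (((Equiv.refl α).sumCongr (Equiv.sumComm β γ)).trans (Equiv.sumAssoc α γ β).symm)

theorem edgeSign_sumSwap (d : ℤ) {α β γ : Type} [Fintype α] [Fintype β] [Fintype γ]
    (o : LinearOrder α) (o' : LinearOrder β) (o'' : LinearOrder γ) :
    edgeSign d (sumOrder (sumOrder o o') o'') (sumSwap α β γ) (sumOrder (sumOrder o o'') o') =
      (d * (Fintype.card β * Fintype.card γ)).negOnePow := by
  classical
  have h1 : ∀ {ι : Type} (o : LinearOrder ι) (x y : ι), ¬ (o.lt x y ∧ o.lt y x) :=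
    fun o x y h => @lt_asymm _ o.toPreorder _ _ h.1 h.2
  rw [edgeSign_eq_prod]
  simp only [Fintype.prod_sum_type, sumSwap, Equiv.trans_apply, Equiv.sumAssoc_apply_inl_inl,
    Equiv.sumAssoc_apply_inl_inr, Equiv.sumAssoc_apply_inr, Equiv.sumCongr_apply, Sum.map_inl,
    Sum.map_inr, Equiv.refl_apply, Equiv.sumComm_apply, Sum.swap_inl, Sum.swap_inr,
    Equiv.sumAssoc_symm_apply_inl, Equiv.sumAssoc_symm_apply_inr_inl,
    Equiv.sumAssoc_symm_apply_inr_inr, sumOrder_inl_inl, sumOrder_inl_inr, sumOrder_inr_inr,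
    not_sumOrder_inr_inl, h1, if_false, Finset.prod_const_one, mul_one, one_mul, and_true,
      and_false,
    true_and, if_true, Finset.prod_const, Finset.card_univ]
  rw [← neg_one_zpow_eq, ← neg_one_zpow_eq, zpow_mul, ← Nat.cast_mul, zpow_natCast, ← pow_mul,
    mul_comm]

theorem gra_parallel [Finite I] [Finite J] [Finite L] (x : GraSpace K d c k) {n₁ n₂ : ℤ}
    {y : GraSpace K d c' l} (hy : y ∈ (gra K d).deg n₁) {z : GraSpace K d c'' m}
    (hz : z ∈ (gra K d).deg n₂) (i : I) (h : c i = l) (j : Without i) (h' : c j.1 = m)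
    (h₁ : graftColour c i c' (Sum.inl j) = m)
    (h₂ : graftColour c j.1 c'' (Sum.inl ⟨i, j.2.symm⟩) = l)
    (hg : ∀ y, graftColour (graftColour c j.1 c'') (Sum.inl ⟨i, j.2.symm⟩) c'
          (parallelEquiv i j y) = graftColour (graftColour c i c') (Sum.inl j) c'' y) :
    (gra K d).relabel (parallelEquiv i j) hg
        ((gra K d).comp (Sum.inl j) h₁ ((gra K d).comp i h x y) z) =
      signScalar K (n₁ * n₂).negOnePow •
        (gra K d).comp (Sum.inl ⟨i, j.2.symm⟩) h₂ ((gra K d).comp j.1 h' x z) y := by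
  set s := signScalar K (n₁ * n₂).negOnePow with hs
  refine eq_of_isLocal' (f := (gra K d).relabel (parallelEquiv i j) hg ∘ₗ
      ((gra K d).comp (Sum.inl j) h₁).flip z ∘ₗ ((gra K d).comp i h).flip y)
    (g := s • (((gra K d).comp (Sum.inl ⟨i, j.2.symm⟩) h₂).flip y ∘ₗ
      ((gra K d).comp j.1 h').flip z))
    ((isLocal_relabel _ _).comp ((isLocal_comp_left _ _ _).comp (isLocal_comp_left _ _ _)))
    (((isLocal_comp_left _ _ _).comp (isLocal_comp_left _ _ _)).smul s) (fun p E₁ hE₁ => ?_) x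
  simp only [LinearMap.comp_apply, LinearMap.flip_apply, LinearMap.smul_apply]
  refine eq_of_isLocal (f := (gra K d).relabel (parallelEquiv i j) hg ∘ₗ
      ((gra K d).comp (Sum.inl j) h₁).flip z ∘ₗ ((gra K d).comp i h _))
    (g := s • ((gra K d).comp (Sum.inl ⟨i, j.2.symm⟩ : Without j.1 ⊕ L) h₂ _))
    ((isLocal_relabel _ _).comp ((isLocal_comp_left _ _ _).comp (isLocal_comp_right _ _ _)))
    ((isLocal_comp_right _ _ _).smul s) (fun q => -d * q = n₁) (fun q E₂ hq hE₂ => ?_) y hy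
  simp only [LinearMap.comp_apply, LinearMap.flip_apply, LinearMap.smul_apply]
  refine eq_of_isLocal (f := (gra K d).relabel (parallelEquiv i j) hg ∘ₗ
      ((gra K d).comp (Sum.inl j) h₁ _))
    (g := s • (((gra K d).comp (Sum.inl ⟨i, j.2.symm⟩) h₂).flip _ ∘ₗ ((gra K d).comp j.1 h' _)))
    ((isLocal_relabel _ _).comp (isLocal_comp_right _ _ _))
    (((isLocal_comp_left _ _ _).comp (isLocal_comp_right _ _ _)).smul s)
    (fun r => -d * r = n₂) (fun r E₃ hr hE₃ => ?_) z hz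
  simp only [LinearMap.comp_apply, LinearMap.flip_apply, LinearMap.smul_apply]
  rw [comp_orderedGraph i h _ _ hE₁ hE₂, comp_orderedGraph j.1 h' _ _ hE₁ hE₃, map_sum, map_sum,
    LinearMap.sum_apply, LinearMap.sum_apply, map_sum]
  have hL : ∀ E' ∈ reattach i E₁, (gra K d).relabel (parallelEquiv i j) hg
      ((gra K d).comp (Sum.inl j) h₁
        (orderedGraph K d (graftColour c i c') k (sumOrder inferInstance inferInstance)
          (joinEdges E' E₂)) (orderedGraph K d c'' m inferInstance E₃)) =
      ∑ E'' ∈ reattach (Sum.inl j) (joinEdges E' E₂),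
        orderedGraph K d (graftColour (graftColour c j.1 c'') (Sum.inl ⟨i, j.2.symm⟩) c') k
          (sumOrder (sumOrder inferInstance inferInstance) inferInstance)
          (Prod.map (parallelEquiv i j) (parallelEquiv i j) ∘ joinEdges E'' E₃) := by
    intro E' hE'
    rw [comp_orderedGraph _ h₁ _ _ (isOrientedGraph_joinEdges h hE₁ hE₂ hE') hE₃, map_sum]
    exact Finset.sum_congr rfl fun E'' _ => relabel_orderedGraph _ _ _ _
  have hR : ∀ E' ∈ reattach j.1 E₁, (gra K d).comp (Sum.inl ⟨i, j.2.symm⟩) h₂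
        (orderedGraph K d (graftColour c j.1 c'') k (sumOrder inferInstance inferInstance)
          (joinEdges E' E₃)) (orderedGraph K d c' l inferInstance E₂) =
      ∑ E'' ∈ reattach (Sum.inl ⟨i, j.2.symm⟩) (joinEdges E' E₃),
        orderedGraph K d (graftColour (graftColour c j.1 c'') (Sum.inl ⟨i, j.2.symm⟩) c') k
          (sumOrder (sumOrder inferInstance inferInstance) inferInstance) (joinEdges E'' E₂) := by
    intro E' hE'
    rw [comp_orderedGraph _ h₂ _ _ (isOrientedGraph_joinEdges h' hE₁ hE₃ hE') hE₂]
  rw [Finset.sum_congr rfl hL, Finset.sum_congr rfl hR,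
    sum_reattach_reattach i j E₁ E₂ (fun E'' => orderedGraph K d _ k _
      (Prod.map (parallelEquiv i j) (parallelEquiv i j) ∘ joinEdges E'' E₃)),
    sum_reattach_reattach j.1 ⟨i, j.2.symm⟩ E₁ E₃ (fun E'' => orderedGraph K d _ k _
      (joinEdges E'' E₂)), Finset.smul_sum]
  refine Finset.sum_bij (fun G _ => Prod.map (parallelEquiv i j) (parallelEquiv i j) ∘ G)
    ?_ ?_ ?_ ?_
  · intro G hG
    rw [mem_reattachTwo] at hG ⊢
    intro e
    rw [← hG e]
    simp [Prod.map, collapse_parallel]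
  · intro G _ G' _ hGG
    exact (Function.Injective.prodMap (parallelEquiv i j).injective
      (parallelEquiv i j).injective).comp_left hGG
  · intro G hG
    refine ⟨Prod.map (parallelEquiv i j).symm (parallelEquiv i j).symm ∘ G, ?_, ?_⟩
    · rw [mem_reattachTwo] at hG ⊢
      intro e
      rw [← hG e]
      simp [Prod.map, collapse_parallel_symm]
    · funext e
      simp [Prod.map]
  · intro G _
    have hsign : s = signScalar K (edgeSign d
        (sumOrder (sumOrder inferInstance inferInstance) inferInstance)
        (sumSwap (Fin p) (Fin q) (Fin r))
        (sumOrder (sumOrder inferInstance inferInstance) inferInstance)) := by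
      rw [edgeSign_sumSwap, hs, ← hq, ← hr, Fintype.card_fin, Fintype.card_fin,
        show -d * (q : ℤ) * (-d * (r : ℤ)) = d * d * (q * r) by ring, ← neg_one_zpow_eq, zpow_mul,
        neg_one_zpow_eq (d * d), negOnePow_mul_self, ← neg_one_zpow_eq, ← zpow_mul]
      rfl
    rw [hsign, ← orderedGraph_comp_equiv]
    congr 1
    funext e
    rcases e with (e | e) | e <;> rfl

/-! ### Evaluation of formal composites -/

theorem Mono.finite : ∀ {I : Type} {c : I → Colour} {k : Colour}, Mono I c k → Finite I
  | _, _, _, .unit _ => inferInstance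
  | _, _, _, @Mono.gen _ h _ _ _ _ => h
  | _, _, _, .relabel e _ a => have := a.finite; Finite.of_equiv _ e
  | _, _, _, .comp _ _ a b => have := a.finite; have := b.finite; inferInstance

/-- The value of a formal composite if the corollas are replaced by the values of a family. -/
noncomputable def Mono.eval (F : GraFamily K d) : ∀ {I : Type} {c : I → Colour} {k : Colour}
    (_ : Mono I c k) [Finite I], GraSpace K d c k
  | _, _, _, .unit k, _ => (gra K d).unit k
  | _, _, _, @Mono.gen I _ o c k _, _ => F ⟨I, o, c, k⟩
  | _, _, _, .relabel e h a, _ => have := a.finite; (gra K d).relabel e h (a.eval F)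
  | _, _, _, .comp i h a b, _ =>
    have := a.finite; have := b.finite; (gra K d).comp i h (a.eval F) (b.eval F)

theorem Mono.eval_mem_deg {F : GraFamily K d} (hF : (gra K d).toOperadData.HasDegree d 1 F)
    (a : Mono I c k) : ∀ [Finite I],
    a.eval F ∈ (gra K d).deg (a.deg d) := by
  induction a with
  | unit k =>
    intro _
    have h := orderedGraph_mem_deg (K := K) (d := d) (c := fun _ => k) (k := k)
      (inferInstance : LinearOrder (Fin 0)) (Fin.elim0 : Fin 0 → Unit × Unit)
    rw [← gra_unit_eq] at h
    change (gra K d).unit k ∈ (gra K d).deg 0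
    simpa using h
  | gen o c k h =>
    intro _
    exact hF ⟨_, o, c, k⟩
  | relabel e h a ih =>
    intro _
    have := a.finite
    exact gra_relabel_mem_deg e h ih
  | comp i h a b iha ihb =>
    intro _
    have := a.finite
    have := b.finite
    exact gra_comp_mem_deg i h iha ihb

theorem Mono.eval_rel {F : GraFamily K d} (hF : F ∈ fOGC K d)
    (hF' : (gra K d).toOperadData.HasDegree d 1 F) {s : ℤˣ} {a b : Mono I c k}
    (hr : Mono.Rel d s a b) : ∀ [Finite I], a.eval F = signScalar K s • b.eval F := by
  induction hr with
  | refl a =>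
    intro _
    rw [map_one, one_smul]
  | @symm _ _ _ s a b _ ih =>
    intro _
    rw [ih, smul_smul, signScalar_mul_self, one_smul]
  | trans _ _ ih1 ih2 =>
    intro _
    rw [ih1, ih2, smul_smul, map_mul]
  | @relabel_congr _ _ _ _ _ _ a b e h _ ih =>
    intro _
    have := a.finite
    simp only [Mono.eval, ih, map_smul]
  | @comp_congr _ _ _ _ _ _ _ _ a a' b b' i h _ _ ih1 ih2 =>
    intro _
    have := a.finite
    have := b.finite
    simp only [Mono.eval, ih1, ih2, map_smul, LinearMap.smul_apply, smul_smul, map_mul, mul_comm]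
  | gen o o' c c' k e h hc hc' =>
    intro _
    exact (hF.1 _ _ o o' c c' k e h).trans (units_smul_eq K _ _)
  | relabel_refl a h =>
    intro _
    rw [map_one, one_smul]
    exact gra_relabel_refl _ h
  | relabel_trans a e h e' h' h'' =>
    intro _
    have := a.finite
    have := (a.relabel e h).finite
    rw [map_one, one_smul]
    exact gra_relabel_relabel _ e h e' h' h''
  | comp_relabel a b i h e he e' he' h' hg =>
    intro _
    have := a.finite
    have := b.finite
    have := (a.relabel e he).finite
    have := (b.relabel e' he').finite
    rw [map_one, one_smul]
    exact gra_comp_relabel _ _ i h e he e' he' h' hg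
  | assoc a b x i h j h' h'' hg =>
    intro _
    have := a.finite
    have := b.finite
    have := x.finite
    rw [map_one, one_smul]
    exact gra_assoc _ _ _ i h j h' h'' hg
  | parallel a b x i h j h' h₁ h₂ hg =>
    intro _
    have := a.finite
    have := b.finite
    have := x.finite
    exact gra_parallel _ (b.eval_mem_deg hF') (x.eval_mem_deg hF') i h j h' h₁ h₂ hg
  | unit_comp a hg =>
    intro _
    have := a.finite
    rw [map_one, one_smul]
    exact gra_unit_comp _ hg
  | comp_unit a i h hg =>
    intro _
    have := a.finite
    rw [map_one, one_smul]
    exact gra_comp_unit _ i h hg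

/-- The map of operads that extends a family of degree one in the deformation complex. -/
noncomputable def evalMap {F : GraFamily K d} (hF : F ∈ fOGC K d)
    (hF' : (gra K d).toOperadData.HasDegree d 1 F) (I : Type) [Finite I] (c : I → Colour)
    (k : Colour) : FreeObj K d I c k →ₗ[K] GraSpace K d c k :=
  FreeObj.lift (fun a => a.eval F)
    (fun _ _ _ hr => (Mono.eval_rel hF hF' hr).trans (units_smul_eq K _ _).symm)

section evalMap

variable {F : GraFamily K d} (hF : F ∈ fOGC K d) (hF' : (gra K d).toOperadData.HasDegree d 1 F)

theorem evalMap_mk [Finite I] (a : Mono I c k) : evalMap hF hF' I c k (FreeObj.mk a) = a.eval F :=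
  FreeObj.lift_mk _ _ a

theorem evalMap_corolla (p : Profile) : evalMap hF hF' p.I p.c p.k (corolla K d p) = F p := by
  unfold corolla FreeObj.gen
  split_ifs with h
  · exact evalMap_mk hF hF' _
  · rw [map_zero, hF.2 p h]

theorem evalMap_relabel [Finite I] [Finite J] (e : I ≃ J) (h : ∀ i, c' (e i) = c i)
    (x : FreeObj K d I c k) : evalMap hF hF' J c' k (FreeObj.relabel e h x) =
      (gra K d).relabel e h (evalMap hF hF' I c k x) := by
  induction x using FreeObj.induction with
  | hmk a => rw [FreeObj.relabel_mk, evalMap_mk, evalMap_mk]; rfl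
  | hadd x y hx hy => simp only [map_add, hx, hy]
  | hsmul r x hx => simp only [map_smul, hx]
  | h0 => simp only [map_zero]

theorem evalMap_comp [Finite I] [Finite J] (i : I) (h : c i = l) (x : FreeObj K d I c k)
    (y : FreeObj K d J c' l) : evalMap hF hF' _ _ k (FreeObj.comp i h x y) =
      (gra K d).comp i h (evalMap hF hF' I c k x) (evalMap hF hF' J c' l y) := by
  induction x using FreeObj.induction with
  | hmk a =>
    induction y using FreeObj.induction with
    | hmk b => rw [FreeObj.comp_mk, evalMap_mk, evalMap_mk, evalMap_mk]; rfl
    | hadd x y hx hy => simp only [map_add, hx, hy]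
    | hsmul r x hx => simp only [map_smul, hx]
    | h0 => simp only [map_zero]
  | hadd x y hx hy => simp only [map_add, LinearMap.add_apply, hx, hy]
  | hsmul r x hx => simp only [map_smul, LinearMap.smul_apply, hx]
  | h0 => simp only [map_zero, LinearMap.zero_apply]

theorem evalMap_mem_deg [Finite I] {n : ℤ} {x : FreeObj K d I c k} (hx : x ∈ FreeObj.deg n) :
    evalMap hF hF' I c k x ∈ (gra K d).deg n := by
  unfold FreeObj.deg at hx
  induction hx using Submodule.span_induction with
  | mem x hx =>
    obtain ⟨a, ha, rfl⟩ := hx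
    rw [evalMap_mk]
    have := a.eval_mem_deg hF'
    rwa [ha] at this
  | zero => rw [map_zero]; exact zero_mem _
  | add x y _ _ hx hy => rw [map_add]; exact add_mem hx hy
  | smul r x _ hx => rw [map_smul]; exact Submodule.smul_mem _ _ hx

end evalMap

/-- Maps that are compatible with relabellings and partial compositions preserve the pre-Lie
product. -/
theorem map_conv (φ : ∀ (I : Type) [Finite I] (c : I → Colour) (k : Colour),
      FreeObj K d I c k →ₗ[K] GraSpace K d c k)
    (hrel : ∀ {I J : Type} [Finite I] [Finite J] {c : I → Colour} {c' : J → Colour} {k : Colour}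
      (e : I ≃ J) (h : ∀ i, c' (e i) = c i) (x : FreeObj K d I c k),
      φ J c' k (FreeObj.relabel e h x) = (gra K d).relabel e h (φ I c k x))
    (hcomp : ∀ {I J : Type} [Finite I] [Finite J] {c : I → Colour} {c' : J → Colour}
      {k l : Colour} (i : I) (h : c i = l) (x : FreeObj K d I c k) (y : FreeObj K d J c' l),
      φ _ _ k (FreeObj.comp i h x y) = (gra K d).comp i h (φ I c k x) (φ J c' l y))
    (F G : (freeOperad K d).Family) (g : ℤ) (p : Profile) :
    φ p.I p.c p.k ((freeOperad K d).conv d g F G p) =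
      (gra K d).toOperadData.conv d g (fun p => φ p.I p.c p.k (F p))
        (fun p => φ p.I p.c p.k (G p)) p := by
  have hterm : ∀ (l : Colour) (S : Set p.I),
      φ p.I p.c p.k ((freeOperad K d).convTerm d g F G p l S) =
        (gra K d).toOperadData.convTerm d g (fun p => φ p.I p.c p.k (F p))
          (fun p => φ p.I p.c p.k (G p)) p l S := by
    intro l S
    unfold OperadData.convTerm
    rw [units_smul_eq K, units_smul_eq K]
    exact (map_smul (φ p.I p.c p.k) _ _).trans (congrArg _ ((hrel _ _ _).trans
      (congrArg _ (hcomp _ _ _ _))))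
  unfold OperadData.conv
  refine (map_finsum_lin K (φ p.I p.c p.k) _).trans (finsum_congr fun S => ?_)
  rw [← hterm, ← hterm]
  exact map_add _ _ _

/-! ### Maurer-Cartan elements and morphisms -/

theorem card_withBot (α : Type) [Finite α] : Nat.card (WithBot α) = Nat.card α + 1 :=
  Finite.card_option

theorem admissible_of_split [Finite I] {S : Set I}
    (h₁ : Admissible (outerColour c S l) k) (h₂ : Admissible (fun x : {x : I // x ∈ S} => c x.1) l)
      :
    Admissible c k := by
  classical
  have hcard : Nat.card I = Nat.card {x : I // x ∈ S} + Nat.card {x : I // x ∉ S} := by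
    rw [← Nat.card_congr (Equiv.sumCompl (fun x => x ∈ S)), Nat.card_sum]
  have hbot := card_withBot {x : I // x ∉ S}
  cases k with
  | black =>
    obtain ⟨h3, h4⟩ := h₁
    have hl : l = .black := h4 ⊥
    subst hl
    obtain ⟨h5, h6⟩ := h₂
    refine ⟨by omega, fun i => ?_⟩
    by_cases hi : i ∈ S
    · exact h6 ⟨i, hi⟩
    · exact h4 ((⟨i, hi⟩ : {x : I // x ∉ S}) : WithBot {x : I // x ∉ S})
  | white =>
    left
    cases l with
    | black =>
      have := h₂.1
      omega
    | white =>
      rcases h₂ with h3 | ⟨h3, -⟩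
      · omega
      · rcases h₁ with h4 | ⟨-, h5⟩
        · omega
        · exact absurd (h5 ⊥) (by simp [outerColour])

theorem convTerm_eq_zero {F : GraFamily K d} (hF : F ∈ fOGC K d) (p : Profile)
    (hp : ¬ Admissible p.c p.k) (l : Colour) (S : Set p.I) (g : ℤ) :
    (gra K d).toOperadData.convTerm d g F F p l S = 0 := by
  unfold OperadData.convTerm
  rw [units_smul_eq K]
  by_cases h₁ : Admissible (outerColour p.c S l) p.k
  · have h₂ : ¬ Admissible (fun x : {x : p.I // x ∈ S} => p.c x.1) l :=
      fun h₂ => hp (admissible_of_split h₁ h₂)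
    rw [hF.2 ⟨{x : p.I // x ∈ S}, innerOrder p.ord S, fun x => p.c x.1, l⟩ h₂, map_zero, map_zero,
      smul_zero]
  · rw [hF.2 ⟨WithBot {x : p.I // x ∉ S}, outerOrder p.ord S, outerColour p.c S l, p.k⟩ h₁,
    map_zero,
      LinearMap.zero_apply, map_zero, smul_zero]

theorem conv_eq_zero_of_not_admissible {F : GraFamily K d} (hF : F ∈ fOGC K d) (p : Profile)
    (hp : ¬ Admissible p.c p.k) (g : ℤ) : (gra K d).toOperadData.conv d g F F p = 0 := by
  unfold OperadData.conv
  refine finsum_eq_zero_of_forall_eq_zero fun S => ?_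
  rw [convTerm_eq_zero hF p hp, convTerm_eq_zero hF p hp, add_zero]

theorem evalMap_diff {F : GraFamily K d} (hF : IsMaurerCartan K d F)
    (a : Mono I c k) : ∀ [Finite I], evalMap hF.mem hF.degree I c k (Mono.diff K d a) = 0 := by
  induction a with
  | unit k =>
    intro _
    exact map_zero _
  | gen o c k h =>
    intro _
    simp only [Mono.diff]
    rw [units_smul_eq K]
    refine (map_smul (evalMap hF.mem hF.degree _ c k) _ _).trans ?_
    have h1 := map_conv (fun I _ c k => evalMap hF.mem hF.degree I c k)
      (evalMap_relabel hF.mem hF.degree) (evalMap_comp hF.mem hF.degree) (corolla K d)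
      (corolla K d) 1 ⟨_, o, c, k⟩
    simp only [evalMap_corolla] at h1
    rw [h1, hF.equation]
    exact smul_zero _
  | relabel e h a ih =>
    intro _
    have := a.finite
    simp only [Mono.diff, evalMap_relabel, ih, map_zero]
  | comp i h a b iha ihb =>
    intro _
    have := a.finite
    have := b.finite
    simp only [Mono.diff, map_add, units_smul_eq K, map_smul, evalMap_comp, iha, ihb, map_zero,
      LinearMap.zero_apply, smul_zero, add_zero]

/-- The morphism of dg operads given by a Maurer-Cartan element. -/
noncomputable def IsMaurerCartan.hom {F : GraFamily K d} (hF : IsMaurerCartan K d F) :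
    DGOperadHom (holie K d) (gra K d) where
  map {I} _ c k := evalMap hF.mem hF.degree I c k
  map_deg _ _ hx := evalMap_mem_deg hF.mem hF.degree hx
  map_relabel e h x := evalMap_relabel hF.mem hF.degree e h x
  map_unit k := evalMap_mk hF.mem hF.degree (Mono.unit k)
  map_comp i h x y := evalMap_comp hF.mem hF.degree i h x y
  map_diff {I} _ c k x := by
    change evalMap hF.mem hF.degree I c k (FreeObj.diff K d I c k x) = 0
    induction x using FreeObj.induction with
    | hmk a => exact (congrArg _ (FreeObj.lift_mk _ _ a)).trans (evalMap_diff hF a)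
    | hadd x y hx hy => rw [map_add, map_add, hx, hy, add_zero]
    | hsmul r x hx => rw [map_smul, map_smul, hx, smul_zero]
    | h0 => rw [map_zero, map_zero]

theorem IsMaurerCartan.hom_onGenerators {F : GraFamily K d} (hF : IsMaurerCartan K d F) :
    hF.hom.onGenerators = F :=
  funext fun p => evalMap_corolla hF.mem hF.degree p

theorem DGOperadHom.map_mk (f : DGOperadHom (holie K d) (gra K d)) (a : Mono I c k) : ∀ [Finite I],
    f.map (FreeObj.mk a : FreeObj K d I c k) = a.eval f.onGenerators := by
  induction a with
  | unit k =>
    intro _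
    exact f.map_unit k
  | gen o c k h =>
    intro _
    unfold Mono.eval DGOperadHom.onGenerators holieGen corolla FreeObj.gen
    rw [dif_pos h]
  | relabel e h a ih =>
    intro _
    have := a.finite
    rw [← FreeObj.relabel_mk]
    exact (f.map_relabel e h _).trans (congrArg _ ih)
  | comp i h a b iha ihb =>
    intro _
    have := a.finite
    have := b.finite
    rw [← FreeObj.comp_mk]
    refine (f.map_comp i h _ _).trans ?_
    rw [iha, ihb]
    rfl

theorem DGOperadHom.eq_of_onGenerators {f g : DGOperadHom (holie K d) (gra K d)}
    (h : f.onGenerators = g.onGenerators) : f = g := by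
  have hmap : ∀ (I : Type) [Finite I] (c : I → Colour) (k : Colour)
      (x : FreeObj K d I c k), f.map x = g.map x := by
    intro I _ c k x
    induction x using FreeObj.induction with
    | hmk a => rw [f.map_mk, g.map_mk, h]
    | hadd x y hx hy => exact (map_add f.map x y).trans ((congrArg₂ _ hx hy).trans
        (map_add g.map x y).symm)
    | hsmul r x hx => exact (map_smul f.map r x).trans ((congrArg _ hx).trans
        (map_smul g.map r x).symm)
    | h0 => exact (map_zero f.map).trans (map_zero g.map).symm
  obtain ⟨fmap, _, _, _, _, _⟩ := f
  obtain ⟨gmap, _, _, _, _, _⟩ := g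
  congr
  funext I _ c k
  exact LinearMap.ext (hmap I c k)

theorem DGOperadHom.isMaurerCartan (f : DGOperadHom (holie K d) (gra K d)) :
    IsMaurerCartan K d f.onGenerators := by
  have hmem : f.onGenerators ∈ fOGC K d := by
    refine ⟨fun I J _ _ o o' c c' k e h => ?_, fun p hp => ?_⟩
    · refine (f.map_relabel e h _).symm.trans ?_
      refine (congrArg _ (FreeObj.relabel_gen K d k e h o o')).trans ?_
      exact FreeObj.map_units_smul (f.map (c := c')) _ _
    · unfold DGOperadHom.onGenerators holieGen corolla FreeObj.gen
      rw [dif_neg hp]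
      exact map_zero _
  refine ⟨hmem, fun p => f.map_deg _ _ (FreeObj.gen_mem_deg K d p.ord p.c p.k), ?_⟩
  funext p
  by_cases hp : Admissible p.c p.k
  · have h1 := map_conv (fun I _ c k => f.map (I := I) (c := c) (k := k))
      f.map_relabel f.map_comp (corolla K d) (corolla K d) 1 p
    refine h1.symm.trans ?_
    have h2 := f.map_diff (FreeObj.mk (Mono.gen p.ord p.c p.k hp))
    have h3 : (holie K d).diff (FreeObj.mk (Mono.gen p.ord p.c p.k hp)) =
        outSign p.k • (freeOperad K d).conv d 1 (corolla K d) (corolla K d) p :=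
      FreeObj.lift_mk (fun a => Mono.diff K d a) (fun _ _ _ hr => Mono.diff_rel K d hr) _
    rw [h3] at h2
    have h4 := (FreeObj.map_units_smul (f.map (c := p.c)) (outSign p.k)
      ((freeOperad K d).conv d 1 (corolla K d) (corolla K d) p)).symm.trans h2
    have h5 := congrArg (outSign p.k • ·) h4
    simp only [smul_smul, Int.units_mul_self, one_smul] at h5
    exact h5.trans (smul_zero _)
  · exact conv_eq_zero_of_not_admissible hmem p hp 1

theorem isMaurerCartan_iff (F : GraFamily K d) : IsMaurerCartan K d F ↔
    ∃! f : DGOperadHom (holie K d) (gra K d), f.onGenerators = F :=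
  ⟨fun hF => ⟨hF.hom, hF.hom_onGenerators, fun _ hg =>
    DGOperadHom.eq_of_onGenerators (hg.trans hF.hom_onGenerators.symm)⟩,
    fun ⟨f, hf, _⟩ => hf ▸ f.isMaurerCartan⟩

/-! ### The values of the element `γ` -/

theorem units_smul_graObj [Finite I] (s : ℤˣ) (x : GraObj K d c k) :
    (show GraSpace K d c k from s • x) = signScalar K s • (show GraSpace K d c k from x) := by
  rcases Int.units_eq_one_or s with rfl | rfl
  · rw [map_one, one_smul]
    exact one_smul ℤˣ x
  · rw [signScalar_neg, map_one, neg_one_smul]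
    exact (Units.neg_smul (1 : ℤˣ) x).trans (congrArg _ (one_smul ℤˣ x))

theorem symmetrize_eq [Finite I] {N n : ℕ} (c₀ : Fin N → Colour) (E : Fin n → Fin N × Fin N)
    (o : LinearOrder I) : (show GraSpace K d c k from symmetrize K d c₀ E o c k) =
      ∑ᶠ e : {e : Fin N ≃ I // ∀ i, c (e i) = c₀ i},
        signScalar K (koszul d c₀ inferInstance e.1 o) •
          (show GraSpace K d c k from GraObj.graph d c k (Prod.map e.1 e.1 ∘ E)) :=
  finsum_congr fun _ => units_smul_graObj _ _

theorem relabel_symmetrize [Finite I] [Finite J] {N n : ℕ} (c₀ : Fin N → Colour)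
    (E : Fin n → Fin N × Fin N) (o : LinearOrder I) (o' : LinearOrder J) (e : I ≃ J)
    (h : ∀ i, c' (e i) = c i) :
    (gra K d).relabel e h (symmetrize K d c₀ E o c k) =
      signScalar K (koszul d c o e o') •
        (show GraSpace K d c' k from symmetrize K d c₀ E o' c' k) := by
  refine (congrArg _ (symmetrize_eq c₀ E o)).trans ?_
  rw [symmetrize_eq c₀ E o']
  have hfin : Finite {e : Fin N ≃ I // ∀ i, c (e i) = c₀ i} := Subtype.finite
  have hfin' : Finite {e : Fin N ≃ J // ∀ i, c' (e i) = c₀ i} := Subtype.finite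
  let q : {e : Fin N ≃ I // ∀ i, c (e i) = c₀ i} ≃ {e : Fin N ≃ J // ∀ i, c' (e i) = c₀ i} :=
    (Equiv.equivCongr (Equiv.refl _) e).subtypeEquiv fun f => by
      simp [Equiv.equivCongr, h]
  have hsmul : ∀ x : {e : Fin N ≃ J // ∀ i, c' (e i) = c₀ i} → GraSpace K d c' k,
      signScalar K (koszul d c o e o') • ∑ᶠ e, x e =
        ∑ᶠ f, signScalar K (koszul d c o e o') • x f := fun x =>
    map_finsum_lin K (LinearMap.lsmul K (GraSpace K d c' k) _) x
  rw [hsmul, ← finsum_comp_equiv q]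
  refine (map_finsum_lin K _ _).trans (finsum_congr fun f => ?_)
  rw [map_smul, smul_smul, ← map_mul]
  have h1 : koszul d c o e o' * koszul d c₀ inferInstance (q f).1 o' =
      koszul d c₀ inferInstance f.1 o := by
    have : (q f).1 = f.1.trans e := rfl
    rw [this, koszul_trans d f.1 f.2 e _ o, mul_left_comm, Int.units_mul_self, mul_one]
  rw [h1]
  congr 1
  exact relabel_graph e h _

/-- The order on the set of white inputs. -/
@[reducible] def whiteOrder (o : LinearOrder I) (c : I → Colour) :
    LinearOrder {x : I // c x = .white} :=
  inferInstance

variable (K) in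
/-- The star with centre `b`, whose edges are ordered by their ends. -/
noncomputable def starGraph (d : ℤ) [Finite I] (o : LinearOrder I) (c : I → Colour) (b : I) :
    GraSpace K d c .white :=
  orderedGraph K d c .white (whiteOrder o c) fun w => (b, w.1)

variable (K) in
/-- The graph with one edge. -/
noncomputable def edgeGraph (d : ℤ) [Finite I] (c : I → Colour) (k : Colour) (x y : I) :
    GraSpace K d c k :=
  orderedGraph K d c k (inferInstance : LinearOrder (Fin 1)) fun _ => (x, y)

theorem Colour.ne_black_iff {x : Colour} : x ≠ .black ↔ x = .white := by
  cases x <;> simp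

theorem Colour.ne_white_iff {x : Colour} : x ≠ .white ↔ x = .black := by
  cases x <;> simp

theorem smul_graph_star [Finite I] {n : ℕ} (o : LinearOrder I) {b : I}
    (hb : ∀ x, c x = .black ↔ x = b) (e : Fin (n + 1) ≃ I) (he : ∀ i, c (e i) = starColour n i) :
    signScalar K (koszul d (starColour n) inferInstance e o) •
      (show GraSpace K d c .white from GraObj.graph d c .white (Prod.map e e ∘ star n)) =
      starGraph K d o c b := by
  have he0 : e 0 = b := (hb _).1 (he 0)
  let φ : Fin n ≃ {x : I // c x = .white} := Equiv.ofBijective (fun j => ⟨e j.succ, he j.succ⟩)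
    ⟨fun i j hij => Fin.succ_injective _ (e.injective (congrArg Subtype.val hij)), by
      rintro ⟨w, hw⟩
      obtain ⟨j, rfl⟩ := e.surjective w
      cases j using Fin.cases with
      | zero => rw [he] at hw; exact absurd hw (by simp [starColour])
      | succ j => exact ⟨j, rfl⟩⟩
  have h1 : Prod.map e e ∘ star n = (fun w : {x : I // c x = .white} => (b, w.1)) ∘ φ := by
    funext j
    simp only [star, he0, Function.comp_apply, Prod.map_apply']
    rfl
  have h2 : koszul d (starColour n) inferInstance e o =
      edgeSign d inferInstance φ (whiteOrder o c) := by
    classical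
    rw [koszul_eq_prod, edgeSign_eq_prod, Fin.prod_univ_succ, Finset.prod_eq_one, one_mul]
    · refine Finset.prod_congr rfl fun x _ => ?_
      rw [Fin.prod_univ_succ, if_neg, one_mul]
      · refine Finset.prod_congr rfl fun y _ => ?_
        have hd : (eps d (starColour n x.succ) * eps d (starColour n y.succ)).negOnePow =
            d.negOnePow := by simp [starColour, eps]
        rw [hd]
        exact if_congr (and_congr Fin.succ_lt_succ_iff Iff.rfl) rfl rfl
      · exact fun hh => absurd hh.1 (by simp)
    · intro y _
      cases y using Fin.cases with
      | zero => exact if_neg fun hh => absurd hh.1 (by simp)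
      | succ y =>
        have hd : (eps d (starColour n 0) * eps d (starColour n y.succ)).negOnePow = 1 := by
          simp [starColour, eps, mul_comm (d + 1), negOnePow_mul_succ]
        rw [hd, ite_self]
  rw [h1, graph_comp_equiv φ (whiteOrder o c), smul_smul, ← map_mul, h2, Int.units_mul_self,
    map_one, one_smul]
  rfl

theorem card_starLabellings [Finite I] {n : ℕ} {b : I} (hb : ∀ x, c x = .black ↔ x = b)
    (hn : Nat.card I = n + 1) :
    Nat.card {e : Fin (n + 1) ≃ I // ∀ i, c (e i) = starColour n i} = n.factorial := by
  classical
  cases nonempty_fintype I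
  have hW : Fintype.card {x : I // x ≠ b} = n := by
    rw [Fintype.card_subtype_compl, Fintype.card_subtype_eq, ← Nat.card_eq_fintype_card, hn]
    rfl
  have h1 : ∀ e : Fin (n + 1) ≃ I, (∀ i, c (e i) = starColour n i) ↔
      (Equiv.equivCongr (finSuccEquiv n) (Equiv.refl I) e) none = b := by
    intro e
    have h2 : (Equiv.equivCongr (finSuccEquiv n) (Equiv.refl I) e) none = e 0 := by
      simp [Equiv.equivCongr]
    rw [h2, ← hb]
    refine ⟨fun h => h 0, fun h i => ?_⟩
    cases i using Fin.cases with
    | zero => exact h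
    | succ i =>
      change c (e i.succ) = .white
      rw [← Colour.ne_black_iff, Ne, hb, ← (hb _).1 h, e.apply_eq_iff_eq]
      exact Fin.succ_ne_zero i
  have q : {e : Fin (n + 1) ≃ I // ∀ i, c (e i) = starColour n i} ≃ (Fin n ≃ {x : I // x ≠ b}) :=
    ((Equiv.equivCongr (finSuccEquiv n) (Equiv.refl I)).subtypeEquiv h1).trans
      (Equiv.optionSubtype b)
  rw [Nat.card_congr q, Nat.card_eq_fintype_card,
    Fintype.card_equiv (Fintype.equivOfCardEq (by rw [hW, Fintype.card_fin])), Fintype.card_fin]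

theorem gamma_white_eq [Finite I] (o : LinearOrder I) (c : I → Colour) :
    (gamma K d ⟨I, o, c, .white⟩ : GraSpace K d c .white) =
      ∑ n ∈ Finset.range (Nat.card I), ((n.factorial : K)⁻¹) •
        (show GraSpace K d c .white from symmetrize K d (starColour n) (star n) o c .white) := rfl

theorem finsum_const_eq_card_smul (K : Type u) [Field K] {M ι : Type*} [AddCommGroup M]
    [Module K M] [Finite ι] (x : M) : ∑ᶠ _ : ι, x = (Nat.card ι : K) • x := by
  cases nonempty_fintype ι
  rw [finsum_eq_sum_of_fintype, Finset.sum_const, Finset.card_univ, Nat.card_eq_fintype_card,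
    Nat.cast_smul_eq_nsmul K]

theorem gamma_white_of_unique [CharZero K] [Finite I] (o : LinearOrder I) {b : I}
    (hb : ∀ x, c x = .black ↔ x = b) :
    gamma K d ⟨I, o, c, .white⟩ = starGraph K d o c b := by
  have hpos : 0 < Nat.card I := Nat.card_pos_iff.2 ⟨⟨b⟩, inferInstance⟩
  obtain ⟨n, hn⟩ : ∃ n, Nat.card I = n + 1 := ⟨Nat.card I - 1, by omega⟩
  refine (gamma_white_eq o c).trans ?_
  rw [Finset.sum_eq_single n]
  · have hfin : Finite {e : Fin (n + 1) ≃ I // ∀ i, c (e i) = starColour n i} := Subtype.finite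
    have h1 : (show GraSpace K d c .white from symmetrize K d (starColour n) (star n) o c .white) =
        (n.factorial : K) • starGraph K d o c b := by
      have h2 : ∀ e : {e : Fin (n + 1) ≃ I // ∀ i, c (e i) = starColour n i},
          signScalar K (koszul d (starColour n) inferInstance e.1 o) •
            (show GraSpace K d c .white from
              GraObj.graph d c .white (Prod.map e.1 e.1 ∘ star n)) = starGraph K d o c b :=
        fun e => smul_graph_star o hb e.1 e.2
      refine (symmetrize_eq (starColour n) (star n) o).trans ((finsum_congr h2).trans ?_)
      rw [finsum_const_eq_card_smul K, card_starLabellings hb hn]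
    rw [h1, smul_smul, inv_mul_cancel₀ (Nat.cast_ne_zero.2 n.factorial_ne_zero), one_smul]
  · intro r _ hr
    have : IsEmpty {e : Fin (r + 1) ≃ I // ∀ i, c (e i) = starColour r i} := by
      refine ⟨fun e => hr ?_⟩
      have := Nat.card_congr e.1
      rw [hn, Nat.card_fin] at this
      omega
    rw [symmetrize_eq, finsum_of_isEmpty, smul_zero]
  · exact fun h => absurd (Finset.mem_range.2 (by omega)) h

theorem gamma_white_eq_zero [Finite I] (o : LinearOrder I)
    (hb : ¬ ∃ b, ∀ x, c x = .black ↔ x = b) : gamma K d ⟨I, o, c, .white⟩ = 0 := by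
  refine (gamma_white_eq o c).trans (Finset.sum_eq_zero fun n _ => ?_)
  have : IsEmpty {e : Fin (n + 1) ≃ I // ∀ i, c (e i) = starColour n i} := by
    refine ⟨fun e => hb ⟨e.1 0, fun x => ⟨fun hx => ?_, fun hx => hx ▸ e.2 0⟩⟩⟩
    obtain ⟨j, rfl⟩ := e.1.surjective x
    rw [e.2] at hx
    cases j using Fin.cases with
    | zero => rfl
    | succ j => exact absurd hx (by simp [starColour])
  rw [symmetrize_eq, finsum_of_isEmpty, smul_zero]

theorem gamma_black_eq [Finite I] (o : LinearOrder I) (c : I → Colour) :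
    (gamma K d ⟨I, o, c, .black⟩ : GraSpace K d c .black) =
        symmetrize K d (fun _ => .black) arrow o c .black := rfl

theorem gamma_black_eq_zero [Finite I] (o : LinearOrder I)
    (h : ¬ (Nat.card I = 2 ∧ ∀ x, c x = .black)) : gamma K d ⟨I, o, c, .black⟩ = 0 := by
  refine (gamma_black_eq o c).trans ?_
  have : IsEmpty {e : Fin 2 ≃ I // ∀ i, c (e i) = .black} := by
    refine ⟨fun e => h ⟨by rw [← Nat.card_congr e.1, Nat.card_fin], fun x => ?_⟩⟩
    rw [← e.1.apply_symm_apply x, e.2]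
  exact (symmetrize_eq _ _ _).trans (finsum_of_isEmpty _)

theorem gamma_black_of_pair [Finite I] (o : LinearOrder I) {y z : I} (hyz : o.lt y z)
    (hI : ∀ x, x = y ∨ x = z) (hc : ∀ x, c x = .black) :
    gamma K d ⟨I, o, c, .black⟩ = edgeGraph K d c .black y z +
      signScalar K (d + 1).negOnePow • edgeGraph K d c .black z y := by
  classical
  have hne : y ≠ z := fun h => @lt_irrefl _ o.toPreorder y (by rw [← h] at hyz; exact hyz)
  have hnlt : ¬ o.lt z y := fun h => @lt_asymm _ o.toPreorder _ _ h hyz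
  let e : Fin 2 ≃ I := Equiv.ofBijective ![y, z] ⟨by
    intro i j hij
    fin_cases i <;> fin_cases j <;> simp_all [hne.symm], fun x => by
      rcases hI x with rfl | rfl
      · exact ⟨0, rfl⟩
      · exact ⟨1, rfl⟩⟩
  have he0 : e 0 = y := rfl
  have he1 : e 1 = z := rfl
  let q : Equiv.Perm (Fin 2) ≃ {e : Fin 2 ≃ I // ∀ i, c (e i) = .black} :=
    { toFun := fun σ => ⟨σ.trans e, fun i => hc _⟩
      invFun := fun f => f.1.trans e.symm
      left_inv := fun σ => by ext i; simp
      right_inv := fun f => by ext i; simp }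
  have huniv : (Finset.univ : Finset (Equiv.Perm (Fin 2))) = {1, Equiv.swap 0 1} := by decide
  refine (gamma_black_eq o c).trans ((symmetrize_eq _ _ _).trans ?_)
  rw [← finsum_comp_equiv q, finsum_eq_sum_of_fintype, huniv,
    Finset.sum_pair (by decide)]
  have hk1 : koszul d (fun _ : Fin 2 => Colour.black) inferInstance (q 1).1 o = 1 := by
    rw [koszul_eq_prod]
    simp only [Fin.prod_univ_two]
    simp [q, he0, he1, hnlt]
  have hk2 : koszul d (fun _ : Fin 2 => Colour.black) inferInstance (q (Equiv.swap 0 1)).1 o =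
      (d + 1).negOnePow := by
    rw [koszul_eq_prod]
    simp only [Fin.prod_univ_two]
    simp [q, he0, he1, hyz, eps]
  rw [hk1, hk2, map_one, one_smul]
  congr 1
  · refine Eq.trans ?_ (graph_eq_orderedGraph _)
    rfl
  · congr 1
    refine Eq.trans ?_ (graph_eq_orderedGraph _)
    congr 1

/-! ### Degrees, symmetry and connectedness of `γ` -/

theorem totalEps_const (d : ℤ) [Finite I] (x : Colour) (h : ∀ i, c i = x) :
    totalEps d c = Nat.card I * eps d x := by
  cases nonempty_fintype I
  simp [totalEps, h, finsum_eq_sum_of_fintype, Nat.card_eq_fintype_card]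

theorem totalEps_eq (d : ℤ) [Finite I] (c : I → Colour) :
    totalEps d c = Nat.card {i // c i = .white} * d + Nat.card {i // c i = .black} * (d + 1) := by
  rw [totalEps_split d c {i | c i = .white}, totalEps_const d .white fun i => i.2,
    totalEps_const d .black fun i => Colour.ne_white_iff.1 i.2]
  have h : Nat.card {x : I // x ∉ {i | c i = .white}} = Nat.card {i // c i = .black} :=
    Nat.card_congr (Equiv.subtypeEquivRight fun _ => Colour.ne_white_iff)
  rw [h]
  rfl

theorem card_black_of_unique {b : I} (hb : ∀ x, c x = .black ↔ x = b) :
    Nat.card {i // c i = .black} = 1 := by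
  rw [Nat.card_congr (Equiv.subtypeEquivRight hb)]
  simp

theorem exists_pair [Finite I] (o : LinearOrder I) (h : Nat.card I = 2) :
    ∃ y z, o.lt y z ∧ ∀ x, x = y ∨ x = z := by
  classical
  cases nonempty_fintype I
  rw [Nat.card_eq_two_iff] at h
  obtain ⟨y, z, hne, huniv⟩ := h
  have hI : ∀ x, x = y ∨ x = z := fun x => by
    have : x ∈ ({y, z} : Set I) := huniv ▸ Set.mem_univ x
    simpa using this
  rcases @lt_or_gt_of_ne _ o _ _ hne with h | h
  · exact ⟨y, z, h, hI⟩
  · exact ⟨z, y, h, fun x => (hI x).symm⟩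

theorem gamma_hasDegree [CharZero K] : (gra K d).toOperadData.HasDegree d 1 (gamma K d) := by
  rintro ⟨I, o, c, k⟩
  cases k with
  | white =>
    by_cases hb : ∃ b, ∀ x, c x = .black ↔ x = b
    · obtain ⟨b, hb⟩ := hb
      rw [gamma_white_of_unique o hb]
      have := orderedGraph_mem_deg (K := K) (d := d) (c := c) (k := .white) (whiteOrder o c)
        (fun w => (b, w.1))
      refine (congrArg (_ ∈ (gra K d).deg ·) ?_).mp this
      dsimp only
      rw [totalEps_eq, card_black_of_unique hb]
      simp only [eps]
      push_cast
      ring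
    · rw [gamma_white_eq_zero o hb]
      exact zero_mem _
  | black =>
    by_cases h : Nat.card I = 2 ∧ ∀ x, c x = .black
    · obtain ⟨y, z, hyz, hI⟩ := exists_pair o h.1
      rw [gamma_black_of_pair o hyz hI h.2]
      have key : ∀ x y, edgeGraph K d c .black x y ∈
          (gra K d).deg (1 + eps d .black - totalEps d c) := by
        intro x y
        have := orderedGraph_mem_deg (K := K) (d := d) (c := c) (k := .black)
          (inferInstance : LinearOrder (Fin 1)) (fun _ => (x, y))
        refine (congrArg (_ ∈ (gra K d).deg ·) ?_).mp this
        rw [totalEps_const d .black h.2, h.1]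
        simp only [eps, Nat.card_fin]
        push_cast
        ring
      exact add_mem (key y z) (Submodule.smul_mem _ _ (key z y))
    · rw [gamma_black_eq_zero o h]
      exact zero_mem _

theorem gamma_mem_fOGC : gamma K d ∈ fOGC K d := by
  refine ⟨fun I J _ _ o o' c c' k e h => ?_, ?_⟩
  · refine Eq.trans ?_ (units_smul_eq K _ _).symm
    cases k with
    | black => exact relabel_symmetrize _ _ o o' e h
    | white =>
      have hcard : Nat.card I = Nat.card J := Nat.card_congr e
      refine (congrArg _ (gamma_white_eq o c)).trans ?_
      refine Eq.trans ?_ (congrArg _ (gamma_white_eq o' c').symm)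
      rw [map_sum, Finset.smul_sum, hcard]
      refine Finset.sum_congr rfl fun n _ => ?_
      rw [map_smul, smul_comm]
      exact congrArg _ (relabel_symmetrize _ _ o o' e h)
  · rintro ⟨I, o, c, k⟩ hp
    cases k with
    | black => exact gamma_black_eq_zero o fun h => hp ⟨h.1.ge, h.2⟩
    | white =>
      refine gamma_white_eq_zero o ?_
      rintro ⟨b, hb⟩
      have hpos : 0 < Nat.card I := Nat.card_pos_iff.2 ⟨⟨b⟩, inferInstance⟩
      apply hp
      by_cases h1 : Nat.card I = 1
      · have := (Nat.card_eq_one_iff_unique.1 h1).1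
        exact Or.inr ⟨h1, fun i => (hb i).2 (Subsingleton.elim _ _)⟩
      · exact Or.inl (show 2 ≤ Nat.card I by omega)

theorem piece_orderedGraph_mem_connectedSpan [Finite I] {ι : Type} [Finite ι] (o : LinearOrder ι)
    (E : ι → I × I) (b : I) (hE : ∀ x, x = b ∨ ∃ e, E e = (b, x) ∨ E e = (x, b)) (n : ℕ) :
    piece n (orderedGraph K d c k o E) ∈ connectedSpan K d c k n := by
  have hcon : IsConnectedGraph (E ∘ enum o) := by
    have key : ∀ x, Relation.EqvGen (fun x y => ∃ e, (E ∘ enum o) e = (x, y)) x b := by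
      intro x
      rcases hE x with rfl | ⟨e, he | he⟩
      · exact .refl _
      · exact .symm _ _ (.rel _ _ ⟨(enum o).symm e, by simpa using he⟩)
      · exact .rel _ _ ⟨(enum o).symm e, by simpa using he⟩
    exact fun u v => .trans _ _ _ (key u) (.symm _ _ (key v))
  by_cases hn : n = Nat.card ι
  · subst hn
    have h1 : piece (Nat.card ι) (orderedGraph K d c k o E) = GraPiece.graph K d c k (E ∘ enum o) :=
      Pi.single_eq_same (M := fun p => GraPiece K d c k p) _ _
    rw [h1]
    exact Submodule.subset_span ⟨_, hcon, rfl⟩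
  · have h1 : piece n (orderedGraph K d c k o E) = 0 :=
      Pi.single_eq_of_ne (M := fun p => GraPiece K d c k p) hn _
    rw [h1]
    exact zero_mem _

theorem gamma_mem_OGChat [CharZero K] : gamma K d ∈ OGChat K d := by
  refine ⟨gamma_mem_fOGC, ?_⟩
  rintro ⟨I, o, c, k⟩ n
  change piece n (gamma K d ⟨I, o, c, k⟩) ∈ connectedSpan K d c k n
  cases k with
  | white =>
    by_cases hb : ∃ b, ∀ x, c x = .black ↔ x = b
    · obtain ⟨b, hb⟩ := hb
      rw [gamma_white_of_unique o hb]
      refine piece_orderedGraph_mem_connectedSpan _ _ b (fun x => ?_) n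
      by_cases hx : x = b
      · exact Or.inl hx
      · exact Or.inr ⟨⟨x, Colour.ne_black_iff.1 fun h => hx ((hb x).1 h)⟩, Or.inl rfl⟩
    · rw [gamma_white_eq_zero o hb, map_zero]
      exact zero_mem _
  | black =>
    by_cases h : Nat.card I = 2 ∧ ∀ x, c x = .black
    · obtain ⟨y, z, hyz, hI⟩ := exists_pair o h.1
      rw [gamma_black_of_pair o hyz hI h.2, map_add, map_smul]
      refine add_mem (piece_orderedGraph_mem_connectedSpan _ _ y (fun x => ?_) n)
        (Submodule.smul_mem _ _ (piece_orderedGraph_mem_connectedSpan _ _ y (fun x => ?_) n))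
      · exact (hI x).imp_right fun hx => ⟨0, Or.inl (by rw [hx])⟩
      · exact (hI x).imp_right fun hx => ⟨0, Or.inr (by rw [hx])⟩
    · rw [gamma_black_eq_zero o h, map_zero]
      exact zero_mem _

/-! ### The terms of the pre-Lie square of `γ` with white output -/

/-- The sign of a term of the pre-Lie product with a family of degree one. -/
noncomputable def splitSign (d : ℤ) (o : LinearOrder I) (c : I → Colour) (l : Colour)
    (S : Set I) : ℤˣ :=
  unshuffle d c o S * colourSign d l *
    ((1 + eps d l - totalEps d (fun x : {x : I // x ∈ S} => c x.1)) *
      totalEps d (fun x : {x : I // x ∉ S} => c x.1)).negOnePow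

theorem convTerm_gamma [Finite I] (o : LinearOrder I) (c : I → Colour) (k l : Colour) (S : Set I) :
    (gra K d).toOperadData.convTerm d 1 (gamma K d) (gamma K d) ⟨I, o, c, k⟩ l S =
      signScalar K (splitSign d o c l S) •
        (gra K d).relabel (unsplit S) (unsplit_colour c S l)
          ((gra K d).comp (⊥ : WithBot {x : I // x ∉ S}) (outerColour_bot c S l)
            (gamma K d ⟨WithBot {x : I // x ∉ S}, outerOrder o S, outerColour c S l, k⟩)
            (gamma K d ⟨{x : I // x ∈ S}, innerOrder o S, fun x => c x.1, l⟩)) :=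
  units_smul_eq K _ _

theorem isOrientedGraph_star {b : I} (hb : c b = .black) :
    IsOrientedGraph c .white (fun w : {x : I // c x = .white} => (b, w.1)) := by
  refine ⟨⟨b⟩, fun v hv => ?_, fun _ => hb⟩
  have key : ∀ x y, Relation.TransGen (fun x y => ∃ e : {x : I // c x = .white},
      (b, e.1) = (x, y)) x y → x = b ∧ c y = .white := by
    intro x y h
    induction h with
    | single h =>
      obtain ⟨e, he⟩ := h
      obtain ⟨rfl, rfl⟩ := Prod.mk.inj he
      exact ⟨rfl, e.2⟩
    | tail _ h ih =>
      obtain ⟨e, he⟩ := h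
      obtain ⟨_, rfl⟩ := Prod.mk.inj he
      exact ⟨ih.1, e.2⟩
  obtain ⟨h1, h2⟩ := key v v hv
  rw [h1, hb] at h2
  cases h2

theorem isOrientedGraph_edge (hc : ∀ x, c x = .black) {y z : I} (hyz : y ≠ z) :
    IsOrientedGraph c .black (fun _ : Fin 1 => (y, z)) := by
  refine ⟨⟨y⟩, fun v hv => ?_, hc⟩
  have key : ∀ x x', Relation.TransGen (fun x x' => ∃ _ : Fin 1, (y, z) = (x, x')) x x' →
      x = y ∧ x' = z := by
    intro x x' h
    induction h with
    | single h =>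
      obtain ⟨_, he⟩ := h
      exact ⟨(congrArg Prod.fst he).symm, (congrArg Prod.snd he).symm⟩
    | tail _ h ih =>
      obtain ⟨_, he⟩ := h
      exact ⟨ih.1, (congrArg Prod.snd he).symm⟩
  obtain ⟨h1, h2⟩ := key v v hv
  exact hyz (h1.symm.trans h2)

variable (K) in
/-- The graph with an edge `e`, followed by one edge from `g w` to `w` for each white vertex `w`. -/
noncomputable def twoStar (d : ℤ) [Finite I] (o : LinearOrder I) (c : I → Colour) (e : I × I)
    (g : {x : I // c x = .white} → I) : GraSpace K d c .white :=
  orderedGraph K d c .white (sumOrder (inferInstance : LinearOrder (Fin 1)) (whiteOrder o c))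
    (Sum.elim (fun _ => e) fun w => (g w, w.1))

open Classical in
/-- The white inputs of the two corollas obtained by splitting a corolla along an edge of white
colour. -/
noncomputable def whiteSplit (c : I → Colour) (S : Set I) : Fin 1 ⊕ {x : I // c x = .white} ≃
    {x : WithBot {x : I // x ∉ S} // outerColour c S .white x = .white} ⊕
      {x : {x : I // x ∈ S} // c x.1 = .white} :=
  Equiv.ofBijective (Sum.elim (fun _ => .inl ⟨⊥, rfl⟩) fun w =>
    if h : w.1 ∈ S then .inr ⟨⟨w.1, h⟩, w.2⟩
    else .inl ⟨((⟨w.1, h⟩ : {x : I // x ∉ S}) : WithBot {x : I // x ∉ S}), w.2⟩) (by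
    constructor
    · rintro (x | ⟨x, hx⟩) (y | ⟨y, hy⟩) hxy
      · rw [Subsingleton.elim x y]
      · by_cases h : y ∈ S
        · simp [h] at hxy
        · simp only [Sum.elim_inl, Sum.elim_inr, h, dite_false, Sum.inl.injEq] at hxy
          exact absurd (congrArg Subtype.val hxy) WithBot.bot_ne_coe
      · by_cases h : x ∈ S
        · simp [h] at hxy
        · simp only [Sum.elim_inl, Sum.elim_inr, h, dite_false, Sum.inl.injEq] at hxy
          exact absurd (congrArg Subtype.val hxy) WithBot.coe_ne_bot
      · by_cases h : x ∈ S <;> by_cases h' : y ∈ S <;> simp [h, h'] at hxy ⊢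
        · exact hxy
        · exact congrArg Subtype.val (WithBot.coe_injective (congrArg Subtype.val hxy))
    · rintro (⟨x, hx⟩ | ⟨x, hx⟩)
      · induction x using WithBot.recBotCoe with
        | bot => exact ⟨.inl 0, rfl⟩
        | coe x => exact ⟨.inr ⟨x.1, hx⟩, dif_neg x.2⟩
      · exact ⟨.inr ⟨x.1, hx⟩, dif_pos x.2⟩)

theorem whiteSplit_inl (S : Set I) (i : Fin 1) : whiteSplit c S (.inl i) = .inl ⟨⊥, rfl⟩ := rfl

theorem whiteSplit_of_mem {S : Set I} (w : {x : I // c x = .white}) (h : w.1 ∈ S) :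
    whiteSplit c S (.inr w) = .inr ⟨⟨w.1, h⟩, w.2⟩ :=
  dif_pos h

theorem whiteSplit_of_notMem {S : Set I} (w : {x : I // c x = .white}) (h : w.1 ∉ S) :
    whiteSplit c S (.inr w) =
      .inl ⟨((⟨w.1, h⟩ : {x : I // x ∉ S}) : WithBot {x : I // x ∉ S}), w.2⟩ :=
  dif_neg h

open Classical in
theorem edgeSign_whiteSplit (d : ℤ) [Fintype I] (o : LinearOrder I) (c : I → Colour) (S : Set I) :
    edgeSign d (sumOrder (inferInstance : LinearOrder (Fin 1)) (whiteOrder o c)) (whiteSplit c S)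
      (sumOrder (whiteOrder (outerOrder o S) (outerColour c S .white))
        (whiteOrder (innerOrder o S) (fun x : {x : I // x ∈ S} => c x.1))) =
      ∏ w : {x : I // c x = .white}, ∏ v : {x : I // c x = .white},
        if w.1 ∈ S ∧ v.1 ∉ S ∧ o.lt w.1 v.1 then d.negOnePow else 1 := by
  have hbot : ∀ y : WithBot {x : I // x ∉ S}, ¬ (outerOrder o S).lt y ⊥ := fun y =>
    @not_lt_bot _ (outerOrder o S).toPreorder _ y
  have hcoe : ∀ x y : {x : I // x ∉ S}, (outerOrder o S).lt (x : WithBot {x : I // x ∉ S}) y ↔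
      o.lt x.1 y.1 := fun x y => @WithBot.coe_lt_coe {x : I // x ∉ S} x y _
  have hasymm : ∀ x y : I, o.lt x y → ¬ o.lt y x := fun x y h h' =>
    @lt_asymm _ o.toPreorder _ _ h h'
  rw [edgeSign_eq_prod, Fintype.prod_sum_type, Finset.prod_eq_one, one_mul]
  · refine Finset.prod_congr rfl fun w _ => ?_
    rw [Fintype.prod_sum_type, Finset.prod_eq_one, one_mul]
    · refine Finset.prod_congr rfl fun v _ => if_congr ?_ rfl rfl
      by_cases hw : w.1 ∈ S <;> by_cases hv : v.1 ∈ S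
      · rw [whiteSplit_of_mem w hw, whiteSplit_of_mem v hv, sumOrder_inr_inr, sumOrder_inr_inr]
        exact ⟨fun h => absurd h.2 (hasymm _ _ h.1), fun h => absurd hv h.2.1⟩
      · rw [whiteSplit_of_mem w hw, whiteSplit_of_notMem v hv, sumOrder_inr_inr]
        exact ⟨fun h => ⟨hw, hv, h.1⟩, fun h => ⟨h.2.2, sumOrder_inl_inr _ _ _ _⟩⟩
      · rw [whiteSplit_of_notMem w hw, whiteSplit_of_mem v hv, sumOrder_inr_inr]
        exact ⟨fun h => absurd h.2 (not_sumOrder_inr_inl _ _ _ _), fun h => absurd h.1 hw⟩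
      · rw [whiteSplit_of_notMem w hw, whiteSplit_of_notMem v hv, sumOrder_inr_inr,
          sumOrder_inl_inl]
        exact ⟨fun h => absurd ((hcoe _ _).1 h.2) (hasymm _ _ h.1), fun h => absurd h.1 hw⟩
    · exact fun i _ => if_neg fun h => not_sumOrder_inr_inl _ _ _ _ h.1
  · intro i _
    refine Finset.prod_eq_one fun v _ => if_neg fun h => ?_
    rcases v with v | v
    · rw [Subsingleton.elim i v] at h
      exact @lt_irrefl _ (sumOrder (inferInstance : LinearOrder (Fin 1))
        (whiteOrder o c)).toPreorder _ h.1
    · rw [whiteSplit_inl] at h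
      by_cases hv : v.1 ∈ S
      · rw [whiteSplit_of_mem v hv] at h
        exact not_sumOrder_inr_inl _ _ _ _ h.2
      · rw [whiteSplit_of_notMem v hv, sumOrder_inl_inl] at h
        exact hbot _ h.2

@[to_additive]
theorem prod_two_blacks {M : Type*} [CommMonoid M] [Fintype I] [Fintype {x : I // c x = .white}]
    {b b' : I} (hne : b ≠ b') (hb : ∀ x, c x = .black ↔ x = b ∨ x = b') (h : I → M) :
    ∏ x, h x = h b * h b' * ∏ w : {x : I // c x = .white}, h w.1 := by
  classical
  rw [← Fintype.prod_subtype_mul_prod_subtype (fun x => c x = .white) h, mul_comm]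
  congr 1
  · have h1 : ∀ x, x ∈ ({b, b'} : Finset I) ↔ ¬ c x = .white := fun x => by
      rw [Finset.mem_insert, Finset.mem_singleton, ← hb]
      exact Colour.ne_white_iff.symm
    rw [← Finset.prod_pair hne, Finset.prod_subtype {b, b'} h1]
  · exact Finset.prod_congr (by ext; simp) fun _ _ => rfl

theorem card_white_subtype [Finite I] (S : Set I) :
    Nat.card {x : {x : I // x ∈ S} // c x.1 = .white} =
      Nat.card {w : {x : I // c x = .white} // w.1 ∈ S} :=
  Nat.card_congr
    { toFun := fun x => ⟨⟨x.1.1, x.2⟩, x.1.2⟩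
      invFun := fun w => ⟨⟨w.1.1, w.2⟩, w.1.2⟩ }

theorem splitSign_white (d : ℤ) [Finite I] (o : LinearOrder I) {b b' : I} (hne : b ≠ b')
    (hb : ∀ x, c x = .black ↔ x = b ∨ x = b') {S : Set I} (hbS : b ∉ S) (hbS' : b' ∈ S)
    [Decidable (o.lt b b')] :
    splitSign d o c .white S *
      edgeSign d (sumOrder (inferInstance : LinearOrder (Fin 1)) (whiteOrder o c))
        (whiteSplit c S) (sumOrder (whiteOrder (outerOrder o S) (outerColour c S .white))
          (whiteOrder (innerOrder o S) (fun x : {x : I // x ∈ S} => c x.1))) =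
      d.negOnePow * if o.lt b b' then (d + 1).negOnePow else 1 := by
  classical
  cases nonempty_fintype I
  have hcb : c b = .black := (hb b).2 (Or.inl rfl)
  have hcb' : c b' = .black := (hb b').2 (Or.inr rfl)
  have hun : unshuffle d c o S = (if o.lt b b' then (d + 1).negOnePow else 1) *
      ∏ w : {x : I // c x = .white}, ∏ v : {x : I // c x = .white},
        if w.1 ∈ S ∧ v.1 ∉ S ∧ o.lt v.1 w.1 then d.negOnePow else 1 := by
    unfold unshuffle
    rw [finprod_pair]
    simp only [finprod_eq_prod_of_fintype]
    rw [prod_two_blacks hne hb, prod_two_blacks hne hb, prod_two_blacks hne hb]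
    simp only [prod_two_blacks hne hb (fun y => ite (_ ∧ y ∉ S ∧ o.lt y _) _ _)]
    have h1 : ∀ w : {x : I // c x = .white},
        (eps d (c b') * eps d (c w.1)).negOnePow = 1 := fun w => by
      rw [hcb', w.2]
      simp only [eps]
      rw [mul_comm, negOnePow_mul_succ]
    have h2 : ∀ w : {x : I // c x = .white},
        (eps d (c w.1) * eps d (c b)).negOnePow = 1 := fun w => by
      rw [hcb, w.2]
      simp only [eps]
      rw [negOnePow_mul_succ]
    have h3 : (eps d (c b') * eps d (c b)).negOnePow = (d + 1).negOnePow := by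
      rw [hcb, hcb']
      exact negOnePow_mul_self _
    have h4 : ∀ w v : {x : I // c x = .white},
        (eps d (c w.1) * eps d (c v.1)).negOnePow = d.negOnePow := fun w v => by
      rw [w.2, v.2]
      exact negOnePow_mul_self _
    simp only [h1, h2, h3, h4, hbS, hbS', false_and, and_false, not_true, not_false_eq_true,
      true_and, if_false, ite_self, Finset.prod_const_one, mul_one, one_mul]
  have hin : totalEps d (fun x : {x : I // x ∈ S} => c x.1) =
      Fintype.card {w : {x : I // c x = .white} // w.1 ∈ S} * d + (d + 1) := by
    rw [totalEps_eq, card_white_subtype, card_black_of_unique (b := ⟨b', hbS'⟩),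
      Nat.card_eq_fintype_card, Nat.cast_one, one_mul]
    rintro ⟨x, hx⟩
    rw [hb, Subtype.mk.injEq]
    exact or_iff_right fun h : x = b => hbS (h ▸ hx)
  have hout : totalEps d (fun x : {x : I // x ∉ S} => c x.1) =
      Fintype.card {w : {x : I // c x = .white} // w.1 ∉ S} * d + (d + 1) := by
    have h := card_white_subtype (c := c) Sᶜ
    have h' : Nat.card {x : {x : I // x ∉ S} // c x.1 = .white} =
      Nat.card {w : {x : I // c x = .white} // w.1 ∉ S} := h
    rw [totalEps_eq, h', card_black_of_unique (b := ⟨b, hbS⟩),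
      Nat.card_eq_fintype_card, Nat.cast_one, one_mul]
    rintro ⟨x, hx⟩
    rw [hb, Subtype.mk.injEq]
    exact or_iff_left fun h : x = b' => hx (h ▸ hbS')
  have hprod : (∏ w : {x : I // c x = .white}, ∏ v : {x : I // c x = .white},
        if w.1 ∈ S ∧ v.1 ∉ S ∧ o.lt v.1 w.1 then d.negOnePow else 1) *
      (∏ w : {x : I // c x = .white}, ∏ v : {x : I // c x = .white},
        if w.1 ∈ S ∧ v.1 ∉ S ∧ o.lt w.1 v.1 then d.negOnePow else 1) =
      (d * (Fintype.card {w : {x : I // c x = .white} // w.1 ∈ S} *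
        Fintype.card {w : {x : I // c x = .white} // w.1 ∉ S})).negOnePow := by
    have h1 : ∀ w v : {x : I // c x = .white},
        ((if w.1 ∈ S ∧ v.1 ∉ S ∧ o.lt v.1 w.1 then d.negOnePow else 1) *
          if w.1 ∈ S ∧ v.1 ∉ S ∧ o.lt w.1 v.1 then d.negOnePow else 1) =
        if w.1 ∈ S then (if v.1 ∉ S then d.negOnePow else 1) else 1 := by
      intro w v
      by_cases hw : w.1 ∈ S
      · by_cases hv : v.1 ∈ S
        · simp [hv]
        · have hwv : w.1 ≠ v.1 := fun h => hv (h ▸ hw)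
          rcases @lt_or_gt_of_ne _ o _ _ hwv with h | h
          · have h' : ¬ o.lt v.1 w.1 := fun h' => @lt_asymm _ o.toPreorder _ _ h h'
            simp [hw, hv, h', show o.lt w.1 v.1 from h]
          · have h' : ¬ o.lt w.1 v.1 := fun h' => @lt_asymm _ o.toPreorder _ _ h h'
            simp [hw, hv, h', show o.lt v.1 w.1 from h]
      · simp [hw]
    simp only [← Finset.prod_mul_distrib, h1]
    have h2 : ∀ w : {x : I // c x = .white}, (∏ v : {x : I // c x = .white},
        if w.1 ∈ S then (if v.1 ∉ S then d.negOnePow else 1) else 1) =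
        if w.1 ∈ S then
          d.negOnePow ^ Fintype.card {w : {x : I // c x = .white} // w.1 ∉ S} else 1 := by
      intro w
      by_cases hw : w.1 ∈ S
      · simp only [hw, if_true]
        rw [Finset.prod_ite, Finset.prod_const, Finset.prod_const_one, mul_one,
          Fintype.card_subtype]
      · simp [hw]
    rw [Finset.prod_congr rfl fun w _ => h2 w, Finset.prod_ite, Finset.prod_const,
      Finset.prod_const_one, mul_one, ← Fintype.card_subtype, ← neg_one_zpow_eq, ← neg_one_zpow_eq,
      zpow_mul, ← Nat.cast_mul, zpow_natCast, ← pow_mul, mul_comm]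
  have hexp : ((1 + eps d .white - totalEps d (fun x : {x : I // x ∈ S} => c x.1)) *
      totalEps d (fun x : {x : I // x ∉ S} => c x.1)).negOnePow =
      (d * (Fintype.card {w : {x : I // c x = .white} // w.1 ∈ S} *
        Fintype.card {w : {x : I // c x = .white} // w.1 ∉ S})).negOnePow := by
    rw [hin, hout]
    generalize (Fintype.card {w : {x : I // c x = .white} // w.1 ∈ S} : ℤ) = p
    generalize (Fintype.card {w : {x : I // c x = .white} // w.1 ∉ S} : ℤ) = q
    rw [Int.negOnePow_eq_iff]
    simp only [eps]
    have h1 : (1 + d - (p * d + (d + 1))) * (q * d + (d + 1)) - d * (p * q) =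
        -(d * (d + 1)) * (p * q + p) := by ring
    rw [h1]
    exact (Int.even_mul_succ_self d).neg.mul_right _
  unfold splitSign
  rw [edgeSign_whiteSplit, hun, hexp, ← hprod, colourSign]
  generalize (∏ w : {x : I // c x = .white}, ∏ v : {x : I // c x = .white},
        if w.1 ∈ S ∧ v.1 ∉ S ∧ o.lt v.1 w.1 then d.negOnePow else 1) = A
  generalize (∏ w : {x : I // c x = .white}, ∏ v : {x : I // c x = .white},
        if w.1 ∈ S ∧ v.1 ∉ S ∧ o.lt w.1 v.1 then d.negOnePow else 1) = B
  generalize (if o.lt b b' then (d + 1).negOnePow else 1) = s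
  calc s * A * d.negOnePow * (A * B) * B = d.negOnePow * s * (A * A) * (B * B) := by ac_rfl
    _ = _ := by rw [Int.units_mul_self, Int.units_mul_self, mul_one, mul_one]

theorem outer_unique_of_two_blacks {b b' : I} (hb : ∀ x, c x = .black ↔ x = b ∨ x = b') {S : Set I}
    (hbS : b ∉ S) (hbS' : b' ∈ S) (x : WithBot {x : I // x ∉ S}) :
    outerColour c S .white x = .black ↔ x = ((⟨b, hbS⟩ : {x : I // x ∉ S}) : WithBot _) := by
  induction x using WithBot.recBotCoe with
  | bot => exact iff_of_false (by simp [outerColour]) WithBot.bot_ne_coe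
  | coe x =>
    change c x.1 = .black ↔ _
    rw [hb, WithBot.coe_inj, Subtype.ext_iff]
    exact or_iff_left fun h => x.2 (h ▸ hbS')

theorem inner_unique_of_two_blacks {b b' : I} (hb : ∀ x, c x = .black ↔ x = b ∨ x = b') {S : Set I}
    (hbS : b ∉ S) (hbS' : b' ∈ S) (x : {x : I // x ∈ S}) :
    c x.1 = .black ↔ x = ⟨b', hbS'⟩ := by
  rw [hb, Subtype.ext_iff]
  exact or_iff_right fun h => hbS (h ▸ x.2)

open Classical in
/-- The reattachment of the edges of a star which attaches the edge ending at the vertex `⊥` to the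
vertex `x`, where `b` is the centre of the star. -/
noncomputable def reattachTarget {S : Set I} (b : {x : I // x ∉ S}) (x : {x : I // x ∈ S})
    (w : {x : WithBot {x : I // x ∉ S} // outerColour c S .white x = .white}) :
    (Without (⊥ : WithBot {x : I // x ∉ S}) ⊕ {x : I // x ∈ S}) ×
      (Without (⊥ : WithBot {x : I // x ∉ S}) ⊕ {x : I // x ∈ S}) :=
  (.inl ⟨(b : WithBot _), WithBot.coe_ne_bot⟩, if h : w.1 = ⊥ then .inr x else .inl ⟨w.1, h⟩)

theorem sum_reattach_star [Finite I] {M : Type*} [AddCommMonoid M] {S : Set I}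
    [Fintype {x : I // x ∈ S}] (b : {x : I // x ∉ S})
    (f : ({x : WithBot {x : I // x ∉ S} // outerColour c S .white x = .white} →
      (Without (⊥ : WithBot {x : I // x ∉ S}) ⊕ {x : I // x ∈ S}) ×
      (Without (⊥ : WithBot {x : I // x ∉ S}) ⊕ {x : I // x ∈ S})) → M) :
    ∑ E' ∈ reattach (⊥ : WithBot {x : I // x ∉ S})
      (fun w : {x // outerColour c S .white x = .white} => ((b : WithBot {x : I // x ∉ S}), w.1)),
      f E' = ∑ x : {x : I // x ∈ S}, f (reattachTarget b x) := by
  symm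
  refine Finset.sum_bij (fun x _ => reattachTarget b x) ?_ ?_ ?_ fun _ _ => rfl
  · intro x _
    rw [mem_reattach]
    intro w
    by_cases h : w.1 = ⊥
    · simp only [reattachTarget, h, dite_true]
      rfl
    · simp only [reattachTarget, h, dite_false]
      rfl
  · intro x _ y _ hxy
    have h := congrArg Prod.snd (congrFun hxy ⟨⊥, rfl⟩)
    simp only [reattachTarget, dite_true] at h
    exact Sum.inr_injective h
  · intro E' hE'
    rw [mem_reattach] at hE'
    have h0 := congrArg Prod.snd (hE' ⟨⊥, rfl⟩)
    rcases hx : (E' ⟨⊥, rfl⟩).2 with x | x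
    · simp only [Prod.map_snd, hx] at h0
      exact absurd h0 x.2
    · refine ⟨x, Finset.mem_univ _, ?_⟩
      funext w
      have h1 := congrArg Prod.fst (hE' w)
      have h2 := congrArg Prod.snd (hE' w)
      refine Prod.ext ?_ ?_
      · rcases hy : (E' w).1 with y | y
        · simp only [Prod.map_fst, hy] at h1
          exact congrArg Sum.inl (Subtype.ext h1.symm)
        · simp only [Prod.map_fst, hy] at h1
          exact absurd h1 WithBot.bot_ne_coe
      · by_cases h : w.1 = ⊥
        · have hw : w = ⟨⊥, rfl⟩ := Subtype.ext h
          subst hw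
          simp only [reattachTarget, dite_true, hx]
        · simp only [reattachTarget, h, dite_false]
          rcases hy : (E' w).2 with y | y
          · simp only [Prod.map_snd, hy] at h2
            exact congrArg Sum.inl (Subtype.ext h2.symm)
          · simp only [Prod.map_snd, hy] at h2
            exact absurd h2.symm h

open Classical in
theorem convTerm_gamma_white [CharZero K] [Finite I] (o : LinearOrder I) {b b' : I} (hne : b ≠ b')
    (hb : ∀ x, c x = .black ↔ x = b ∨ x = b') {S : Set I} (hbS : b ∉ S) (hbS' : b' ∈ S)
    [Fintype {x : I // x ∈ S}] (g : {x : I // c x = .white} → I)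
    (hg : ∀ w, g w = if w.1 ∈ S then b' else b) :
    (gra K d).toOperadData.convTerm d 1 (gamma K d) (gamma K d) ⟨I, o, c, .white⟩ .white S =
      signScalar K (d.negOnePow * if o.lt b b' then (d + 1).negOnePow else 1) •
        ∑ x : {x : I // x ∈ S}, twoStar K d o c (b, x.1) g := by
  have hout := outer_unique_of_two_blacks hb hbS hbS'
  have hin := inner_unique_of_two_blacks hb hbS hbS'
  have h1 := isOrientedGraph_star ((hout _).2 rfl)
  have h2 := isOrientedGraph_star (c := fun x : {x : I // x ∈ S} => c x.1) ((hin _).2 rfl)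
  rw [convTerm_gamma, gamma_white_of_unique _ hout, gamma_white_of_unique _ hin]
  unfold starGraph
  rw [comp_orderedGraph _ _ _ _ h1 h2, sum_reattach_star, map_sum, Finset.smul_sum,
    Finset.smul_sum]
  refine Finset.sum_congr rfl fun x _ => ?_
  rw [relabel_orderedGraph, ← splitSign_white d o hne hb hbS hbS', map_mul, mul_smul]
  congr 1
  have h3 : Sum.elim (fun _ => (b, x.1)) (fun w => (g w, w.1)) =
      (Prod.map (unsplit S) (unsplit S) ∘ joinEdges (reattachTarget (c := c) ⟨b, hbS⟩ x)
        (fun w : {x : {x : I // x ∈ S} // c x.1 = .white} => (⟨b', hbS'⟩, w.1))) ∘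
        whiteSplit c S := by
    funext e
    rcases e with e | w
    · simp only [Function.comp_apply, whiteSplit_inl, joinEdges, Sum.elim_inl, reattachTarget,
        dite_true]
      rfl
    · by_cases hw : w.1 ∈ S
      · simp only [Function.comp_apply, whiteSplit_of_mem w hw, joinEdges, Sum.elim_inr, hg, hw,
          if_true]
        rfl
      · simp only [Function.comp_apply, whiteSplit_of_notMem w hw, joinEdges, Sum.elim_inl,
          Sum.elim_inr, hg, hw, if_false, reattachTarget, WithBot.coe_ne_bot, dite_false]
        rfl
  rw [twoStar, h3, orderedGraph_comp_equiv (whiteSplit c S), smul_smul, signScalar_mul_self,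
    one_smul]

variable (K) in
open Classical in
/-- The graph with an edge `e`, followed by edges to the white vertices `w`, which start at `b'`
if `w` belongs to `T` and at `b` otherwise. -/
noncomputable def twoStarSet (d : ℤ) [Finite I] (o : LinearOrder I) (c : I → Colour) (b b' : I)
    (T : Set {x : I // c x = .white}) (e : I × I) : GraSpace K d c .white :=
  twoStar K d o c e fun w => if w ∈ T then b' else b

theorem twoStarSet_compl [Finite I] (o : LinearOrder I) (b b' : I)
    (T : Set {x : I // c x = .white}) (e : I × I) :
    twoStarSet K d o c b b' Tᶜ e = twoStarSet K d o c b' b T e := by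
  classical
  unfold twoStarSet
  congr 1
  funext w
  by_cases h : w ∈ T <;> simp [h]

theorem twoStarSet_exchange [Finite I] (o : LinearOrder I) (b b' : I)
    {T T' : Set {x : I // c x = .white}} {w : {x : I // c x = .white}} (hw : w ∈ T) (hw' : w ∉ T')
    (hT : ∀ v, v ≠ w → (v ∈ T ↔ v ∈ T')) :
    twoStarSet K d o c b b' T' (b', w.1) =
      signScalar K d.negOnePow • twoStarSet K d o c b b' T (b, w.1) := by
  classical
  cases nonempty_fintype I
  have h := orderedGraph_perm (K := K) (d := d) (c := c) (k := .white)
    (Equiv.swap (.inl 0) (.inr w) : Equiv.Perm (Fin 1 ⊕ {x : I // c x = .white}))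
    (sumOrder (inferInstance : LinearOrder (Fin 1)) (whiteOrder o c))
    (Sum.elim (fun _ => (b, w.1)) fun w => (if w ∈ T then b' else b, w.1))
  rw [Equiv.Perm.sign_swap Sum.inl_ne_inr] at h
  refine Eq.trans ?_ h
  unfold twoStarSet twoStar
  congr 1
  funext e
  rcases e with e | v
  · rw [Subsingleton.elim e 0, Function.comp_apply, Equiv.swap_apply_left]
    simp [hw]
  · by_cases hv : v = w
    · subst hv
      rw [Function.comp_apply, Equiv.swap_apply_right]
      simp [hw']
    · rw [Function.comp_apply, Equiv.swap_apply_of_ne_of_ne Sum.inr_ne_inl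
        (Sum.inr_injective.ne hv)]
      simp [hT v hv]

/-- The sum of the terms of a pre-Lie square with three edges at a white vertex vanishes. -/
theorem sum_twoStarSet_eq_zero [Fintype I] (o : LinearOrder I) (b b' : I)
    [Fintype {x : I // c x = .white}] [DecidableEq {x : I // c x = .white}]
    [∀ (T : Set {x : I // c x = .white}) w, Decidable (w ∈ T)] :
    ∑ T : Set {x : I // c x = .white}, ∑ w, (if w ∈ T then twoStarSet K d o c b b' T (b, w.1)
      else signScalar K (d + 1).negOnePow • twoStarSet K d o c b b' T (b', w.1)) = 0 := by
  classical
  have key : ∀ (T T' : Set {x : I // c x = .white}) (w : {x : I // c x = .white}), w ∈ T → w ∉ T' →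
      (∀ v, v ≠ w → (v ∈ T ↔ v ∈ T')) → twoStarSet K d o c b b' T (b, w.1) +
        signScalar K (d + 1).negOnePow • twoStarSet K d o c b b' T' (b', w.1) = 0 := by
    intro T T' w hw hw' hT
    rw [twoStarSet_exchange o b b' hw hw' hT, Int.negOnePow_succ, signScalar_neg, smul_smul,
      neg_mul,
      signScalar_mul_self, neg_smul, one_smul, add_neg_cancel]
  have hmem : ∀ (T : Set {x : I // c x = .white}) (w v : {x : I // c x = .white}),
      v ∈ symmDiff T {w} ↔ (v ∈ T ∧ v ≠ w ∨ v = w ∧ v ∉ T) := fun T w v => Set.mem_symmDiff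
  rw [Finset.sum_comm]
  refine Finset.sum_eq_zero fun w _ => ?_
  refine Finset.sum_involution (fun T _ => symmDiff T {w}) ?_ ?_ (fun _ _ => Finset.mem_univ _)
    (fun T _ => symmDiff_symmDiff_cancel_right _ _)
  · intro T _
    by_cases hw : w ∈ T
    · have hw' : w ∉ symmDiff T {w} := by simp [hmem, hw]
      rw [if_pos hw, if_neg hw']
      exact key _ _ w hw hw' fun v hv => by simp [hmem, hv]
    · have hw' : w ∈ symmDiff T {w} := by simp [hmem, hw]
      rw [if_neg hw, if_pos hw', add_comm]
      exact key _ _ w hw' hw fun v hv => by simp [hmem, hv]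
  · intro T _ _ h
    have := hmem T w w
    rw [h] at this
    by_cases hw : w ∈ T <;> simp [hw] at this

open Classical in
/-- The white inputs of the corolla obtained by splitting off all black inputs. -/
noncomputable def outerWhite (c : I → Colour) : {x : I // c x = .white} ≃
    {x : WithBot {x : I // x ∉ {x | c x = .black}} //
      outerColour c {x | c x = .black} .black x = .white} :=
  Equiv.ofBijective (fun w => ⟨((⟨w.1, Colour.ne_black_iff.2 w.2⟩ :
    {x : I // x ∉ {x | c x = .black}}) : WithBot {x : I // x ∉ {x | c x = .black}}), w.2⟩) (by
    constructor
    · intro v w h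
      have h' := @WithBot.coe_injective {x : I // x ∉ {x | c x = .black}}
        ⟨v.1, Colour.ne_black_iff.2 v.2⟩ ⟨w.1, Colour.ne_black_iff.2 w.2⟩ (congrArg Subtype.val h)
      exact Subtype.ext (Subtype.mk.inj h')
    · rintro ⟨x, hx⟩
      induction x using WithBot.recBotCoe with
      | bot => cases (show Colour.black = .white from hx)
      | coe x => exact ⟨⟨x.1, hx⟩, rfl⟩)

theorem splitSign_black (d : ℤ) [Finite I] (o : LinearOrder I) {b b' : I} (hne : b ≠ b')
    (hb : ∀ x, c x = .black ↔ x = b ∨ x = b') :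
    splitSign d o c .black {x | c x = .black} *
      edgeSign d (sumOrder (inferInstance : LinearOrder (Fin 1)) (whiteOrder o c))
        ((Equiv.sumComm _ _).trans (Equiv.sumCongr (outerWhite c) (Equiv.refl (Fin 1))))
        (sumOrder (whiteOrder (outerOrder o {x | c x = .black})
          (outerColour c {x | c x = .black} .black)) (inferInstance : LinearOrder (Fin 1))) = 1 :=
            by
  classical
  cases nonempty_fintype I
  have hun : unshuffle d c o {x | c x = .black} = 1 := by
    unfold unshuffle
    refine finprod_eq_one_of_forall_eq_one fun p => ?_
    by_cases hp : p.1 ∈ {x | c x = .black} ∧ p.2 ∉ {x | c x = .black} ∧ o.lt p.2 p.1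
    · rw [if_pos hp, show c p.1 = .black from hp.1, Colour.ne_black_iff.1 hp.2.1]
      simp only [eps]
      rw [mul_comm, negOnePow_mul_succ]
    · rw [if_neg hp]
  have hcard : Nat.card {x : I // x ∈ {x | c x = .black}} = 2 := by
    rw [Nat.card_congr (Equiv.subtypeEquivRight (q := fun x => x ∈ ({b, b'} : Finset I)) fun x => by
      rw [Finset.mem_insert, Finset.mem_singleton]
      exact hb x), Nat.card_eq_fintype_card, Fintype.card_coe, Finset.card_pair hne]
  have hW : Nat.card {x : I // x ∉ {x | c x = .black}} =
      Fintype.card {x : I // c x = .white} := by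
    rw [← Nat.card_eq_fintype_card]
    exact Nat.card_congr (Equiv.subtypeEquivRight fun x => Colour.ne_black_iff)
  have hedge : edgeSign d (sumOrder (inferInstance : LinearOrder (Fin 1)) (whiteOrder o c))
        ((Equiv.sumComm _ _).trans (Equiv.sumCongr (outerWhite c) (Equiv.refl (Fin 1))))
        (sumOrder (whiteOrder (outerOrder o {x | c x = .black})
          (outerColour c {x | c x = .black} .black)) (inferInstance : LinearOrder (Fin 1))) =
      d.negOnePow ^ Fintype.card {x : I // c x = .white} := by
    rw [edgeSign_eq_prod, Fintype.prod_sum_type, Fin.prod_univ_one, Fintype.prod_sum_type,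
      Fin.prod_univ_one, if_neg, one_mul, Finset.prod_congr rfl (g := fun _ => d.negOnePow),
      Finset.prod_const, Finset.card_univ, Finset.prod_eq_one, mul_one]
    · intro w _
      rw [Fintype.prod_sum_type, Fin.prod_univ_one, if_neg, one_mul, Finset.prod_eq_one]
      · intro v _
        refine if_neg fun h => ?_
        have h1 : o.lt w.1 v.1 := (sumOrder_inr_inr _ (whiteOrder o c) w v).1 h.1
        have h2 : o.lt v.1 w.1 := (@WithBot.coe_lt_coe {x : I // x ∉ {x | c x = .black}}
          ⟨v.1, Colour.ne_black_iff.2 v.2⟩ ⟨w.1, Colour.ne_black_iff.2 w.2⟩ _).1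
          ((sumOrder_inl_inl (whiteOrder (outerOrder o {x | c x = .black})
            (outerColour c {x | c x = .black} .black)) _ (outerWhite c v) (outerWhite c w)).1 h.2)
        exact @lt_asymm _ o.toPreorder _ _ h1 h2
      · exact fun h => not_sumOrder_inr_inl _ _ _ _ h.1
    · intro w _
      exact if_pos ⟨sumOrder_inl_inr _ _ _ _, sumOrder_inl_inr _ _ _ _⟩
    · exact fun h => @lt_irrefl _ (sumOrder (inferInstance : LinearOrder (Fin 1))
        (whiteOrder o c)).toPreorder _ h.1
  unfold splitSign
  rw [hun, hedge, totalEps_const d .black fun i => i.2, totalEps_const d .white fun i =>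
    Colour.ne_black_iff.1 i.2, hcard, hW, colourSign, one_mul, one_mul]
  generalize Fintype.card {x : I // c x = .white} = n
  rw [← neg_one_zpow_eq, ← neg_one_zpow_eq, ← zpow_natCast, ← zpow_mul, ← zpow_add,
    neg_one_zpow_eq]
  simp only [eps]
  refine Int.negOnePow_even _ ?_
  have h : (1 + (d + 1) - ((2 : ℕ) : ℤ) * (d + 1)) * (n * d) + d * n = -((d - 1) * (d - 1 + 1)) * n
    := by
    push_cast
    ring
  rw [h]
  exact (Int.even_mul_succ_self (d - 1)).neg.mul_right _

open Classical in
/-- The reattachment of the edges of a star with centre `⊥` such that an edge to a white vertex `w`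
starts at `b'` if `w` belongs to `T` and at `b` otherwise. -/
noncomputable def reattachSource (b b' : {x : I // x ∈ {x | c x = .black}})
    (T : Set {x : I // c x = .white})
    (w : {x : WithBot {x : I // x ∉ {x | c x = .black}} //
      outerColour c {x | c x = .black} .black x = .white}) :
    (Without (⊥ : WithBot {x : I // x ∉ {x | c x = .black}}) ⊕ {x : I // x ∈ {x | c x = .black}}) ×
      (Without (⊥ : WithBot {x : I // x ∉ {x | c x = .black}}) ⊕
        {x : I // x ∈ {x | c x = .black}}) :=
  (.inr (if (outerWhite c).symm w ∈ T then b' else b), .inl ⟨w.1, fun h => by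
    have hw := w.2
    rw [h] at hw
    cases (show Colour.black = .white from hw)⟩)

theorem relabel_comp_starGraph [Fintype I] (o : LinearOrder I) {b b' : I} (hne : b ≠ b')
    (hb : ∀ x, c x = .black ↔ x = b ∨ x = b') (y z : {x : I // x ∈ {x | c x = .black}})
    (hyz : y ≠ z) [Fintype {x : I // c x = .white}] :
    signScalar K (splitSign d o c .black {x | c x = .black}) •
      (gra K d).relabel (unsplit {x | c x = .black}) (unsplit_colour c {x | c x = .black} .black)
        ((gra K d).comp (⊥ : WithBot {x : I // x ∉ {x | c x = .black}}) (outerColour_bot c _ .black)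
          (starGraph K d (outerOrder o {x | c x = .black})
            (outerColour c {x | c x = .black} .black) ⊥)
          (edgeGraph K d (fun x : {x : I // x ∈ {x | c x = .black}} => c x.1) .black y z)) =
      ∑ T : Set {x : I // c x = .white}, twoStarSet K d o c b b' T (y.1, z.1) := by
  classical
  have h1 := isOrientedGraph_star (outerColour_bot c {x | c x = .black} .black)
  have h2 := isOrientedGraph_edge (c := fun x : {x : I // x ∈ {x | c x = .black}} => c x.1)
    (fun x => x.2) hyz
  unfold starGraph edgeGraph
  rw [comp_orderedGraph _ _ _ _ h1 h2, map_sum, Finset.smul_sum]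
  symm
  have hB : ∀ x : {x : I // x ∈ {x | c x = .black}}, x = ⟨b, (hb b).2 (.inl rfl)⟩ ∨
      x = ⟨b', (hb b').2 (.inr rfl)⟩ := fun x => by
    rw [Subtype.ext_iff, Subtype.ext_iff]
    exact (hb _).1 x.2
  have hBne : (⟨b, (hb b).2 (.inl rfl)⟩ : {x : I // x ∈ {x | c x = .black}}) ≠
      ⟨b', (hb b').2 (.inr rfl)⟩ := fun h => hne (congrArg Subtype.val h)
  refine Finset.sum_bij (fun T _ => reattachSource ⟨b, (hb b).2 (.inl rfl)⟩
    ⟨b', (hb b').2 (.inr rfl)⟩ T) ?_ ?_ ?_ ?_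
  · intro T _
    rw [mem_reattach]
    exact fun w => rfl
  · intro T _ T' _ h
    ext w
    have h3 := Sum.inr_injective (congrArg Prod.fst (congrFun h (outerWhite c w)))
    rw [Equiv.symm_apply_apply] at h3
    by_cases hw : w ∈ T <;> by_cases hw' : w ∈ T'
    · exact iff_of_true hw hw'
    · rw [if_pos hw, if_neg hw'] at h3
      exact absurd h3.symm hBne
    · rw [if_neg hw, if_pos hw'] at h3
      exact absurd h3 hBne
    · exact iff_of_false hw hw'
  · intro E' hE'
    rw [mem_reattach] at hE'
    refine ⟨{w | (E' (outerWhite c w)).1 = .inr ⟨b', (hb b').2 (.inr rfl)⟩}, Finset.mem_univ _, ?_⟩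
    funext w
    have h3 := congrArg Prod.fst (hE' w)
    have h4 := congrArg Prod.snd (hE' w)
    refine Prod.ext ?_ ?_
    · rcases hx : (E' w).1 with x | x
      · simp only [Prod.map_fst, hx] at h3
        exact absurd h3 x.2
      · simp only [reattachSource, Set.mem_ofPred_eq, Equiv.apply_symm_apply, hx, Sum.inr.injEq]
        rcases hB x with rfl | rfl
        · rw [if_neg hBne]
        · rw [if_pos rfl]
    · rcases hx : (E' w).2 with x | x
      · simp only [Prod.map_snd, hx] at h4
        exact congrArg Sum.inl (Subtype.ext h4.symm)
      · simp only [Prod.map_snd, hx] at h4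
        have hw := w.2
        rw [← h4] at hw
        cases (show Colour.black = .white from hw)
  · intro T _
    rw [relabel_orderedGraph]
    have h3 : Sum.elim (fun _ : Fin 1 => (y.1, z.1))
        (fun w : {x : I // c x = .white} => (if w ∈ T then b' else b, w.1)) =
      (Prod.map (unsplit {x | c x = .black}) (unsplit {x | c x = .black}) ∘
        joinEdges (reattachSource ⟨b, (hb b).2 (.inl rfl)⟩ ⟨b', (hb b').2 (.inr rfl)⟩ T)
          (fun _ : Fin 1 => (y, z))) ∘
        ((Equiv.sumComm _ _).trans (Equiv.sumCongr (outerWhite c) (Equiv.refl (Fin 1)))) := by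
      funext e
      rcases e with e | w
      · rfl
      · have h4 : ∀ e : Fin 1 ⊕ {x : I // c x = .white}, e = .inr w → (Prod.map (unsplit {x | c x =
        .black}) (unsplit {x | c x = .black}) ∘
        joinEdges (reattachSource ⟨b, (hb b).2 (.inl rfl)⟩ ⟨b', (hb b').2 (.inr rfl)⟩ T)
          (fun _ : Fin 1 => (y, z))) (((Equiv.sumComm _ _).trans
            (Equiv.sumCongr (outerWhite c) (Equiv.refl (Fin 1)))) e) =
            ((if (outerWhite c).symm (outerWhite c w) ∈ T then
              (⟨b', (hb b').2 (.inr rfl)⟩ : {x : I // x ∈ {x | c x = .black}})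
              else ⟨b, (hb b).2 (.inl rfl)⟩).1, w.1) := by
          rintro _ rfl
          rfl
        refine Eq.trans ?_ (h4 _ rfl).symm
        rw [Equiv.symm_apply_apply, apply_ite Subtype.val]
        rfl
    have h5 := splitSign_black d o hne hb
    unfold twoStarSet twoStar
    rw [h3, orderedGraph_comp_equiv ((Equiv.sumComm _ _).trans
      (Equiv.sumCongr (outerWhite c) (Equiv.refl (Fin 1)))) _
      (sumOrder (whiteOrder (outerOrder o {x | c x = .black})
          (outerColour c {x | c x = .black} .black)) (inferInstance : LinearOrder (Fin 1)))]
    congr 2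
    have h6 := congrArg (splitSign d o c .black {x | c x = .black} * ·) h5
    simpa only [← mul_assoc, Int.units_mul_self, one_mul, mul_one] using h6

theorem convTerm_gamma_black [CharZero K] [Fintype I] (o : LinearOrder I) {b b' : I}
    (hlt : o.lt b b') (hb : ∀ x, c x = .black ↔ x = b ∨ x = b')
    [Fintype {x : I // c x = .white}] :
    (gra K d).toOperadData.convTerm d 1 (gamma K d) (gamma K d) ⟨I, o, c, .white⟩ .black
        {x | c x = .black} =
      ∑ T : Set {x : I // c x = .white}, (twoStarSet K d o c b b' T (b, b') +
        signScalar K (d + 1).negOnePow • twoStarSet K d o c b b' T (b', b)) := by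
  have hne : b ≠ b' := fun h => @lt_irrefl _ o.toPreorder b (by rw [← h] at hlt; exact hlt)
  have hout : ∀ x, outerColour c {x | c x = .black} .black x = .black ↔ x = ⊥ := fun x => by
    induction x using WithBot.recBotCoe with
    | bot => exact iff_of_true rfl rfl
    | coe x => exact iff_of_false x.2 WithBot.coe_ne_bot
  have hcb : c b = .black := (hb b).2 (.inl rfl)
  have hcb' : c b' = .black := (hb b').2 (.inr rfl)
  rw [convTerm_gamma, gamma_white_of_unique _ hout, gamma_black_of_pair (y := ⟨b, hcb⟩)
    (z := ⟨b', hcb'⟩) (innerOrder o {x | c x = .black}) hlt ?_ fun x => x.2]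
  · rw [map_add, map_smul, map_add, map_smul, smul_add, smul_comm,
      relabel_comp_starGraph o hne hb _ _ fun h => hne (congrArg Subtype.val h),
      relabel_comp_starGraph o hne hb _ _ fun h => hne.symm (congrArg Subtype.val h),
      Finset.sum_add_distrib, Finset.smul_sum]
  · intro x
    rw [Subtype.ext_iff, Subtype.ext_iff]
    exact (hb _).1 x.2

theorem convTerm_gamma_eq_zero_of_outer [Finite I] (o : LinearOrder I) (S : Set I)
    (h : gamma K d ⟨WithBot {x : I // x ∉ S}, outerOrder o S, outerColour c S l, k⟩ = 0) :
    (gra K d).toOperadData.convTerm d 1 (gamma K d) (gamma K d) ⟨I, o, c, k⟩ l S = 0 := by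
  rw [convTerm_gamma, h, map_zero, LinearMap.zero_apply, map_zero, smul_zero]

theorem convTerm_gamma_eq_zero_of_inner [Finite I] (o : LinearOrder I) (S : Set I)
    (h : gamma K d ⟨{x : I // x ∈ S}, innerOrder o S, fun x => c x.1, l⟩ = 0) :
    (gra K d).toOperadData.convTerm d 1 (gamma K d) (gamma K d) ⟨I, o, c, k⟩ l S = 0 := by
  rw [convTerm_gamma, h, map_zero, map_zero, smul_zero]

theorem convTerm_gamma_black_eq_zero [Finite I] (o : LinearOrder I) {S : Set I}
    (h : ¬ (Nat.card {x : I // x ∈ S} = 2 ∧ S = {x | c x = .black})) :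
    (gra K d).toOperadData.convTerm d 1 (gamma K d) (gamma K d) ⟨I, o, c, .white⟩ .black S = 0 := by
  by_cases h1 : Nat.card {x : I // x ∈ S} = 2 ∧ ∀ x : {x : I // x ∈ S}, c x.1 = .black
  · refine convTerm_gamma_eq_zero_of_outer o S (gamma_white_eq_zero _ ?_)
    rintro ⟨b, hb⟩
    obtain rfl : ⊥ = b := (hb ⊥).1 rfl
    refine h ⟨h1.1, Set.ext fun x => ⟨fun hx => h1.2 ⟨x, hx⟩, fun hx => ?_⟩⟩
    by_contra hxS
    exact WithBot.coe_ne_bot ((hb ((⟨x, hxS⟩ : {x : I // x ∉ S}) :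
      WithBot {x : I // x ∉ S})).1 hx)
  · exact convTerm_gamma_eq_zero_of_inner o S (gamma_black_eq_zero _ h1)

theorem convTerm_gamma_white_eq_zero [Finite I] (o : LinearOrder I) {S : Set I}
    (h : ¬ ∃ b b', b ∉ S ∧ b' ∈ S ∧ ∀ x, c x = .black ↔ x = b ∨ x = b') :
    (gra K d).toOperadData.convTerm d 1 (gamma K d) (gamma K d) ⟨I, o, c, .white⟩ .white S = 0 := by
  by_cases h1 : ∃ b, ∀ x : {x : I // x ∈ S}, c x.1 = .black ↔ x = b
  · refine convTerm_gamma_eq_zero_of_outer o S (gamma_white_eq_zero _ ?_)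
    rintro ⟨b, hb⟩
    obtain ⟨b', hb'⟩ := h1
    induction b using WithBot.recBotCoe with
    | bot => cases (show Colour.white = .black from (hb ⊥).2 rfl)
    | coe b =>
      refine h ⟨b.1, b'.1, b.2, b'.2, fun x => ?_⟩
      by_cases hx : x ∈ S
      · refine (hb' ⟨x, hx⟩).trans (Subtype.ext_iff.trans (or_iff_right ?_).symm)
        rintro rfl
        exact b.2 hx
      · refine (hb ((⟨x, hx⟩ : {x : I // x ∉ S}) : WithBot _)).trans
          (WithBot.coe_inj.trans (Subtype.ext_iff.trans (or_iff_left ?_).symm))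
        rintro rfl
        exact hx b'.2
  · exact convTerm_gamma_eq_zero_of_inner o S (gamma_white_eq_zero _ h1)

/-- The set which consists of `b` and the white inputs in `T`. -/
def withWhites (b : I) (T : Set {x : I // c x = .white}) : Set I :=
  insert b (Subtype.val '' T)

theorem mem_withWhites {b : I} (hb : c b = .black) {T : Set {x : I // c x = .white}}
    (w : {x : I // c x = .white}) : w.1 ∈ withWhites b T ↔ w ∈ T := by
  unfold withWhites
  rw [Set.mem_insert_iff, Subtype.val_injective.mem_set_image]
  refine or_iff_right fun h => ?_
  have := w.2
  rw [h, hb] at this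
  cases this

theorem notMem_withWhites {b b' : I} (hb : c b = .black) (hne : b ≠ b')
    (T : Set {x : I // c x = .white}) : b ∉ withWhites b' T := by
  rintro (h | ⟨w, _, h⟩)
  · exact hne h
  · have := w.2
    rw [h, hb] at this
    cases this

open Classical in
theorem sum_mem_withWhites [Fintype I] [Fintype {x : I // c x = .white}] {b b' : I} (hne : b ≠ b')
    (hb : ∀ x, c x = .black ↔ x = b ∨ x = b') (T : Set {x : I // c x = .white})
    [Fintype {x : I // x ∈ withWhites b' T}] {M : Type*} [AddCommMonoid M] (f : I → M) :
    ∑ x : {x : I // x ∈ withWhites b' T}, f x.1 =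
      f b' + ∑ w : {x : I // c x = .white}, if w ∈ T then f w.1 else 0 := by
  have hcb : c b = .black := (hb b).2 (.inl rfl)
  have hcb' : c b' = .black := (hb b').2 (.inr rfl)
  have h1 : ∑ x : {x : I // x ∈ withWhites b' T}, f x.1 =
      ∑ x, if x ∈ withWhites b' T then f x else 0 := by
    rw [← Finset.sum_filter]
    exact (Finset.sum_subtype _ (fun x => by simp) f).symm
  rw [h1, sum_two_blacks hne hb, if_neg (notMem_withWhites hcb hne T),
    if_pos (show b' ∈ withWhites b' T from Set.mem_insert _ _), zero_add]
  simp only [mem_withWhites hcb']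

open Classical in
theorem convTerm_gamma_withWhites [CharZero K] [Fintype I] [Fintype {x : I // c x = .white}]
    (o : LinearOrder I) {b b' : I} (hne : b ≠ b') (hb : ∀ x, c x = .black ↔ x = b ∨ x = b')
    (T : Set {x : I // c x = .white}) :
    (gra K d).toOperadData.convTerm d 1 (gamma K d) (gamma K d) ⟨I, o, c, .white⟩ .white
        (withWhites b' T) =
      signScalar K (d.negOnePow * if o.lt b b' then (d + 1).negOnePow else 1) •
        (twoStarSet K d o c b b' T (b, b') +
          ∑ w, if w ∈ T then twoStarSet K d o c b b' T (b, w.1) else 0) := by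
  have hcb : c b = .black := (hb b).2 (.inl rfl)
  have hcb' : c b' = .black := (hb b').2 (.inr rfl)
  rw [convTerm_gamma_white o hne hb (notMem_withWhites hcb hne T) (Set.mem_insert _ _)
    (fun w => if w ∈ T then b' else b) (fun w => if_congr (mem_withWhites hcb' w).symm rfl rfl),
    ← sum_mem_withWhites hne hb T fun x => twoStarSet K d o c b b' T (b, x)]
  rfl

theorem sum_convTerm_gamma_white [CharZero K] [Fintype I] [Fintype {x : I // c x = .white}]
    (o : LinearOrder I) {b b' : I} (hlt : o.lt b b') (hb : ∀ x, c x = .black ↔ x = b ∨ x = b') :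
    ∑ S : Set I, (gra K d).toOperadData.convTerm d 1 (gamma K d) (gamma K d) ⟨I, o, c, .white⟩
        .white S =
      -∑ T : Set {x : I // c x = .white}, (twoStarSet K d o c b b' T (b, b') +
        signScalar K (d + 1).negOnePow • twoStarSet K d o c b b' T (b', b)) := by
  classical
  have hne : b ≠ b' := fun h => @lt_irrefl _ o.toPreorder b (by rw [← h] at hlt; exact hlt)
  have hngt : ¬ o.lt b' b := fun h => @lt_asymm _ o.toPreorder _ _ h hlt
  have hcb : c b = .black := (hb b).2 (.inl rfl)
  have hcb' : c b' = .black := (hb b').2 (.inr rfl)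
  have hb_symm : ∀ x, c x = .black ↔ x = b' ∨ x = b := fun x => (hb x).trans or_comm
  have hinj : Function.Injective (Sum.elim (fun T : Set {x : I // c x = .white} => withWhites b' T)
      fun T : Set {x : I // c x = .white} => withWhites b Tᶜ) := by
    rintro (T | T) (T' | T') h
    · congr 1
      ext w
      rw [← mem_withWhites hcb', ← mem_withWhites hcb']
      exact Set.ext_iff.1 h w.1
    · exact absurd ((Set.ext_iff.1 h b).2 (Set.mem_insert _ _)) (notMem_withWhites hcb hne T)
    · exact absurd ((Set.ext_iff.1 h b).1 (Set.mem_insert _ _)) (notMem_withWhites hcb hne T')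
    · congr 1
      rw [← compl_inj_iff]
      ext w
      rw [← mem_withWhites hcb, ← mem_withWhites hcb]
      exact Set.ext_iff.1 h w.1
  have hsum := Fintype.sum_of_injective _ hinj
    (fun T => (gra K d).toOperadData.convTerm d 1 (gamma K d) (gamma K d) ⟨I, o, c, .white⟩
        .white (Sum.elim (fun T : Set {x : I // c x = .white} => withWhites b' T)
          (fun T : Set {x : I // c x = .white} => withWhites b Tᶜ) T))
    (fun S => (gra K d).toOperadData.convTerm d 1 (gamma K d) (gamma K d) ⟨I, o, c, .white⟩
        .white S) (fun S hS => convTerm_gamma_white_eq_zero o ?_) fun _ => rfl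
  · rw [← hsum, Fintype.sum_sum_type]
    simp only [Sum.elim_inl, Sum.elim_inr]
    simp only [convTerm_gamma_withWhites o hne hb, convTerm_gamma_withWhites o hne.symm hb_symm,
      twoStarSet_compl, if_pos hlt, if_neg hngt]
    rw [← Finset.sum_add_distrib, ← add_eq_zero_iff_eq_neg, ← Finset.sum_add_distrib,
      ← neg_eq_zero, ← Finset.sum_neg_distrib]
    refine (Finset.sum_congr rfl fun T _ => ?_).trans
      (sum_twoStarSet_eq_zero (K := K) (d := d) o b b')
    have h1 : ∀ w : {x : I // c x = .white}, (if w ∈ T then twoStarSet K d o c b b' T (b, w.1)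
        else signScalar K (d + 1).negOnePow • twoStarSet K d o c b b' T (b', w.1)) =
        (if w ∈ T then twoStarSet K d o c b b' T (b, w.1) else 0) +
        signScalar K (d + 1).negOnePow •
          if w ∈ Tᶜ then twoStarSet K d o c b b' T (b', w.1) else 0 := fun w => by
      by_cases hw : w ∈ T <;> simp [hw]
    simp only [h1, Finset.sum_add_distrib, ← Finset.smul_sum]
    generalize (∑ w, if w ∈ T then twoStarSet K d o c b b' T (b, w.1) else 0) = x
    generalize (∑ w, if w ∈ Tᶜ then twoStarSet K d o c b b' T (b', w.1) else 0) = y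
    have h2 : signScalar K (d.negOnePow * (d + 1).negOnePow) = -1 := by
      rw [Int.negOnePow_succ, mul_neg, Int.units_mul_self, signScalar_neg, map_one]
    have h3 : signScalar K (d.negOnePow * 1) = -signScalar K (d + 1).negOnePow := by
      rw [Int.negOnePow_succ, signScalar_neg, mul_one, neg_neg]
    rw [h2, h3]
    module
  · rintro ⟨y, z, hy, hz, hyz⟩
    apply hS
    have hmem : ∀ x, x ∈ S ↔ x = z ∨ ∃ h : c x = .white, x ∈ S := fun x => by
      constructor
      · intro hx
        by_cases hw : c x = .white
        · exact .inr ⟨hw, hx⟩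
        · exact .inl (((hyz x).1 (Colour.ne_white_iff.1 hw)).resolve_left
            fun h => hy (by rw [← h]; exact hx))
      · rintro (rfl | ⟨_, hx⟩)
        · exact hz
        · exact hx
    have hS' : S = withWhites z {w : {x : I // c x = .white} | w.1 ∈ S} := by
      ext x
      rw [hmem]
      refine or_congr Iff.rfl ⟨fun ⟨h, hx⟩ => ⟨⟨x, h⟩, hx, rfl⟩, ?_⟩
      rintro ⟨w, hw, rfl⟩
      exact ⟨w.2, hw⟩
    have hz2 : z = b' ∨ z = b := ((hb z).1 ((hyz z).2 (.inr rfl))).symm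
    rcases hz2 with rfl | rfl
    · exact ⟨.inl _, hS'.symm⟩
    · refine ⟨.inr {w : {x : I // c x = .white} | w.1 ∈ S}ᶜ, ?_⟩
      rw [Sum.elim_inr, compl_compl]
      exact hS'.symm

theorem conv_gamma_white [CharZero K] [Finite I] (o : LinearOrder I) (c : I → Colour) :
    (gra K d).toOperadData.conv d 1 (gamma K d) (gamma K d) ⟨I, o, c, .white⟩ = 0 := by
  classical
  cases nonempty_fintype I
  unfold OperadData.conv
  by_cases h : ∃ b b', o.lt b b' ∧ ∀ x, c x = .black ↔ x = b ∨ x = b'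
  · obtain ⟨b, b', hlt, hb⟩ := h
    dsimp only
    rw [finsum_eq_sum_of_fintype, Finset.sum_add_distrib, sum_convTerm_gamma_white o hlt hb,
      Finset.sum_eq_single {x | c x = .black}, convTerm_gamma_black o hlt hb, add_neg_cancel]
    · exact fun S _ hS => convTerm_gamma_black_eq_zero o fun h => hS h.2
    · exact fun h => absurd (Finset.mem_univ _) h
  · refine finsum_eq_zero_of_forall_eq_zero fun S => ?_
    dsimp only
    rw [convTerm_gamma_black_eq_zero, convTerm_gamma_white_eq_zero, add_zero]
    · rintro ⟨b, b', hbS, hbS', hb⟩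
      rcases @lt_or_gt_of_ne _ o b b' (fun h => hbS (by rw [h]; exact hbS')) with hlt | hlt
      · exact h ⟨b, b', hlt, hb⟩
      · exact h ⟨b', b, hlt, fun x => (hb x).trans or_comm⟩
    · rintro ⟨hcard, hS⟩
      obtain ⟨y, z, hyz, hI⟩ := exists_pair (innerOrder o S) hcard
      refine h ⟨y.1, z.1, hyz, fun x => ⟨fun hx => ?_, ?_⟩⟩
      · have hx' : x ∈ S := by rw [hS]; exact hx
        exact (hI ⟨x, hx'⟩).imp (congrArg Subtype.val) (congrArg Subtype.val)
      · have key : ∀ y : {x : I // x ∈ S}, c y.1 = .black := fun y => by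
          exact (Set.ext_iff.1 hS y.1).1 y.2
        rintro (rfl | rfl) <;> exact key _

/-! ### The terms of the pre-Lie square of `γ` with black output -/

variable (K) in
/-- The graph with black output and the two edges `e`, `f`, in this order. -/
noncomputable def twoEdges (d : ℤ) [Finite I] (c : I → Colour) (e f : I × I) :
    GraSpace K d c .black :=
  orderedGraph K d c .black
    (sumOrder (inferInstance : LinearOrder (Fin 1)) (inferInstance : LinearOrder (Fin 1)))
    (Sum.elim (fun _ => e) fun _ => f)

theorem twoEdges_comm [Finite I] (e f : I × I) :
    twoEdges K d c f e = signScalar K d.negOnePow • twoEdges K d c e f := by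
  have h := orderedGraph_perm (K := K) (d := d) (c := c) (k := .black)
    (Equiv.swap (.inl 0) (.inr 0) : Equiv.Perm (Fin 1 ⊕ Fin 1))
    (sumOrder (inferInstance : LinearOrder (Fin 1)) (inferInstance : LinearOrder (Fin 1)))
    (Sum.elim (fun _ => e) fun _ => f)
  rw [Equiv.Perm.sign_swap Sum.inl_ne_inr] at h
  refine Eq.trans ?_ h
  unfold twoEdges
  congr 1
  funext i
  rcases i with i | i
  · rw [Subsingleton.elim i 0, Function.comp_apply, Equiv.swap_apply_left]
    rfl
  · rw [Subsingleton.elim i 0, Function.comp_apply, Equiv.swap_apply_right]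
    rfl

theorem relabel_comp_edgeGraph_bot_left [Finite I] {S : Set I} [Fintype {x : I // x ∈ S}]
    (hc : ∀ x, c x = .black) (a : {x : I // x ∉ S}) (y z : {x : I // x ∈ S}) (hyz : y ≠ z) :
    (gra K d).relabel (unsplit S) (unsplit_colour c S .black)
        ((gra K d).comp (⊥ : WithBot {x : I // x ∉ S}) (outerColour_bot c S .black)
          (edgeGraph K d (outerColour c S .black) .black ⊥ a)
          (edgeGraph K d (fun x : {x : I // x ∈ S} => c x.1) .black y z)) =
      ∑ p : {x : I // x ∈ S}, twoEdges K d c (p.1, a.1) (y.1, z.1) := by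
  have hc' : ∀ x, outerColour c S .black x = .black := fun x => by
    induction x using WithBot.recBotCoe with
    | bot => rfl
    | coe x => exact hc x.1
  have h1 := isOrientedGraph_edge hc' (y := ⊥) (z := (a : WithBot {x : I // x ∉ S}))
    WithBot.bot_ne_coe
  have h2 := isOrientedGraph_edge (c := fun x : {x : I // x ∈ S} => c x.1) (fun x => hc x.1) hyz
  unfold edgeGraph
  rw [comp_orderedGraph _ _ _ _ h1 h2, map_sum]
  symm
  refine Finset.sum_bij (fun p _ _ => (.inr p, .inl ⟨(a : WithBot _), WithBot.coe_ne_bot⟩))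
    ?_ ?_ ?_ ?_
  · intro p _
    rw [mem_reattach]
    exact fun _ => rfl
  · intro p _ q _ h
    exact Sum.inr_injective (congrArg Prod.fst (congrFun h 0))
  · intro E' hE'
    rw [mem_reattach] at hE'
    have h3 := congrArg Prod.fst (hE' 0)
    have h4 := congrArg Prod.snd (hE' 0)
    rcases hx : (E' 0).1 with x | x
    · simp only [Prod.map_fst, hx] at h3
      exact absurd h3 x.2
    · refine ⟨x, Finset.mem_univ _, ?_⟩
      funext i
      rw [Subsingleton.elim i 0]
      refine Prod.ext hx.symm ?_
      rcases hy : (E' 0).2 with y | y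
      · simp only [Prod.map_snd, hy] at h4
        exact congrArg Sum.inl (Subtype.ext h4.symm)
      · simp only [Prod.map_snd, hy] at h4
        exact absurd h4 WithBot.bot_ne_coe
  · intro p _
    rw [relabel_orderedGraph]
    unfold twoEdges
    congr 1
    funext i
    rcases i with i | i <;> rfl

theorem relabel_comp_edgeGraph_bot_right [Finite I] {S : Set I} [Fintype {x : I // x ∈ S}]
    (hc : ∀ x, c x = .black) (a : {x : I // x ∉ S}) (y z : {x : I // x ∈ S}) (hyz : y ≠ z) :
    (gra K d).relabel (unsplit S) (unsplit_colour c S .black)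
        ((gra K d).comp (⊥ : WithBot {x : I // x ∉ S}) (outerColour_bot c S .black)
          (edgeGraph K d (outerColour c S .black) .black a ⊥)
          (edgeGraph K d (fun x : {x : I // x ∈ S} => c x.1) .black y z)) =
      ∑ p : {x : I // x ∈ S}, twoEdges K d c (a.1, p.1) (y.1, z.1) := by
  have hc' : ∀ x, outerColour c S .black x = .black := fun x => by
    induction x using WithBot.recBotCoe with
    | bot => rfl
    | coe x => exact hc x.1
  have h1 := isOrientedGraph_edge hc' (z := ⊥) (y := (a : WithBot {x : I // x ∉ S}))
    WithBot.coe_ne_bot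
  have h2 := isOrientedGraph_edge (c := fun x : {x : I // x ∈ S} => c x.1) (fun x => hc x.1) hyz
  unfold edgeGraph
  rw [comp_orderedGraph _ _ _ _ h1 h2, map_sum]
  symm
  refine Finset.sum_bij (fun p _ _ => (.inl ⟨(a : WithBot _), WithBot.coe_ne_bot⟩, .inr p))
    ?_ ?_ ?_ ?_
  · intro p _
    rw [mem_reattach]
    exact fun _ => rfl
  · intro p _ q _ h
    exact Sum.inr_injective (congrArg Prod.snd (congrFun h 0))
  · intro E' hE'
    rw [mem_reattach] at hE'
    have h3 := congrArg Prod.fst (hE' 0)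
    have h4 := congrArg Prod.snd (hE' 0)
    rcases hx : (E' 0).2 with x | x
    · simp only [Prod.map_snd, hx] at h4
      exact absurd h4 x.2
    · refine ⟨x, Finset.mem_univ _, ?_⟩
      funext i
      rw [Subsingleton.elim i 0]
      refine Prod.ext ?_ hx.symm
      rcases hy : (E' 0).1 with y | y
      · simp only [Prod.map_fst, hy] at h3
        exact congrArg Sum.inl (Subtype.ext h3.symm)
      · simp only [Prod.map_fst, hy] at h3
        exact absurd h3 WithBot.bot_ne_coe
  · intro p _
    rw [relabel_orderedGraph]
    unfold twoEdges
    congr 1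
    funext i
    rcases i with i | i <;> rfl

open Classical in
theorem splitSign_compl_singleton (d : ℤ) [Finite I] (o : LinearOrder I) (hc : ∀ x, c x = .black)
    {x y z : I} (hyx : y ≠ x) (hzx : z ≠ x) (hyz : y ≠ z) (hI : ∀ w, w = x ∨ w = y ∨ w = z) :
    splitSign d o c .black {x}ᶜ = (if o.lt x y then (d + 1).negOnePow else 1) *
      if o.lt x z then (d + 1).negOnePow else 1 := by
  cases nonempty_fintype I
  have huniv : (Finset.univ : Finset I) = {x, y, z} := by
    ext w
    simpa using hI w
  have hprod : ∀ f : I → ℤˣ, ∏ w, f w = f x * (f y * f z) := fun f => by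
    rw [huniv, Finset.prod_insert (by simp [hyx.symm, hzx.symm]), Finset.prod_pair hyz]
  have hun : unshuffle d c o {x}ᶜ = (if o.lt x y then (d + 1).negOnePow else 1) *
      if o.lt x z then (d + 1).negOnePow else 1 := by
    unfold unshuffle
    rw [finprod_pair]
    simp only [finprod_eq_prod_of_fintype, hprod, hc, eps, negOnePow_mul_self]
    simp [hyx, hzx]
  have h1 : Nat.card {w : I // w ∉ ({x}ᶜ : Set I)} = 1 := by
    rw [Nat.card_congr (Equiv.subtypeEquivRight (q := fun w => w = x) fun w => by simp)]
    simp
  have h2 : Nat.card {w : I // w ∈ ({x}ᶜ : Set I)} = 2 := by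
    rw [Nat.card_congr (Equiv.subtypeEquivRight (q := fun w => w ∈ ({y, z} : Finset I)) fun w => by
      have := hI w
      rw [Finset.mem_insert, Finset.mem_singleton, Set.mem_compl_iff, Set.mem_singleton_iff]
      refine ⟨this.resolve_left, ?_⟩
      rintro (rfl | rfl) <;> assumption), Nat.card_eq_fintype_card, Fintype.card_coe,
      Finset.card_pair hyz]
  have h3 : ((1 + eps d .black - ((2 : ℕ) : ℤ) * eps d .black) *
      (((1 : ℕ) : ℤ) * eps d .black)).negOnePow = 1 := by
    simp only [eps]
    refine Int.negOnePow_even _ ?_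
    have h4 : (1 + (d + 1) - ((2 : ℕ) : ℤ) * (d + 1)) * (((1 : ℕ) : ℤ) * (d + 1)) =
        -(d * (d + 1)) := by
      push_cast
      ring
    rw [h4]
    exact (Int.even_mul_succ_self d).neg
  unfold splitSign
  rw [hun, totalEps_const (c := fun w : {w : I // w ∈ ({x}ᶜ : Set I)} => c w.1) d .black
      fun w => hc w.1, totalEps_const (c := fun w : {w : I // w ∉ ({x}ᶜ : Set I)} => c w.1) d .black
      fun w => hc w.1, h1, h2, h3, colourSign, mul_one, mul_one]

open Classical in
theorem convTerm_gamma_compl_singleton [Finite I] (o : LinearOrder I) (hc : ∀ x, c x = .black)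
    {x y z : I} (hyx : y ≠ x) (hzx : z ≠ x) (hyz : o.lt y z) (hI : ∀ w, w = x ∨ w = y ∨ w = z) :
    (gra K d).toOperadData.convTerm d 1 (gamma K d) (gamma K d) ⟨I, o, c, .black⟩ .black {x}ᶜ =
      signScalar K ((if o.lt x y then (d + 1).negOnePow else 1) *
        if o.lt x z then (d + 1).negOnePow else 1) •
      (twoEdges K d c (y, x) (y, z) + twoEdges K d c (z, x) (y, z) +
        twoEdges K d c (x, y) (z, y) + twoEdges K d c (x, z) (z, y) +
        signScalar K (d + 1).negOnePow • (twoEdges K d c (x, y) (y, z) +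
          twoEdges K d c (x, z) (y, z) + twoEdges K d c (y, x) (z, y) +
          twoEdges K d c (z, x) (z, y))) := by
  have hne : y ≠ z := fun h => @lt_irrefl _ o.toPreorder y (by rw [← h] at hyz; exact hyz)
  have hxS : x ∉ ({x}ᶜ : Set I) := fun h => h rfl
  let y' : {w : I // w ∈ ({x}ᶜ : Set I)} := ⟨y, hyx⟩
  let z' : {w : I // w ∈ ({x}ᶜ : Set I)} := ⟨z, hzx⟩
  let x' : {w : I // w ∉ ({x}ᶜ : Set I)} := ⟨x, hxS⟩
  have hne' : y' ≠ z' := fun h => hne (congrArg Subtype.val h)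
  have hI' : ∀ w : {w : I // w ∈ ({x}ᶜ : Set I)}, w = y' ∨ w = z' := fun w =>
    ((hI w.1).resolve_left w.2).imp Subtype.ext Subtype.ext
  have hout : ∀ w : WithBot {w : I // w ∉ ({x}ᶜ : Set I)}, w = ⊥ ∨ w = (x' : WithBot _) := by
    intro w
    induction w using WithBot.recBotCoe with
    | bot => exact .inl rfl
    | coe w => exact .inr (congrArg _ (Subtype.ext (not_not.1 w.2)))
  have hcout : ∀ w, outerColour c {x}ᶜ .black w = .black := fun w => by
    induction w using WithBot.recBotCoe with
    | bot => rfl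
    | coe w => exact hc w.1
  have := Fintype.ofFinite {w : I // w ∈ ({x}ᶜ : Set I)}
  have huniv : (Finset.univ : Finset {w : I // w ∈ ({x}ᶜ : Set I)}) = {y', z'} := by
    ext w
    simpa using hI' w
  rw [convTerm_gamma, splitSign_compl_singleton d o hc hyx hzx hne hI,
    gamma_black_of_pair (outerOrder o {x}ᶜ) (@WithBot.bot_lt_coe {w : I // w ∉ ({x}ᶜ : Set I)} _ x')
      hout hcout,
    gamma_black_of_pair (y := y') (z := z') (innerOrder o {x}ᶜ) hyz hI' fun w => hc w.1]
  simp only [map_add, map_smul, LinearMap.add_apply, LinearMap.smul_apply]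
  rw [relabel_comp_edgeGraph_bot_left hc _ _ _ hne', relabel_comp_edgeGraph_bot_left hc _ _ _
    hne'.symm,
    relabel_comp_edgeGraph_bot_right hc _ _ _ hne', relabel_comp_edgeGraph_bot_right hc _ _ _
      hne'.symm,
    huniv]
  simp only [Finset.sum_pair hne']
  congr 1
  have hs := signScalar_mul_self K (d + 1).negOnePow
  simp only [smul_add, smul_smul, hs, one_smul]
  simp only [x', y', z']
  abel

theorem convTerm_gamma_black_black_eq_zero [Finite I] (o : LinearOrder I) {S : Set I}
    (h : ¬ ∃ x y z, S = {x}ᶜ ∧ y ≠ x ∧ z ≠ x ∧ o.lt y z ∧ (∀ w, w = x ∨ w = y ∨ w = z) ∧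
      ∀ w, c w = .black) :
    (gra K d).toOperadData.convTerm d 1 (gamma K d) (gamma K d) ⟨I, o, c, .black⟩ .black S = 0 := by
  by_cases h1 : Nat.card {x : I // x ∈ S} = 2 ∧ ∀ x : {x : I // x ∈ S}, c x.1 = .black
  · refine convTerm_gamma_eq_zero_of_outer o S (gamma_black_eq_zero _ ?_)
    rintro ⟨hcard, hc⟩
    rw [card_withBot] at hcard
    obtain ⟨x, hx⟩ := Nat.card_eq_one_iff_exists.1 (Nat.succ.inj hcard)
    obtain ⟨y, z, hyz, hI⟩ := exists_pair (innerOrder o S) h1.1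
    have hS : S = {x.1}ᶜ := by
      ext w
      refine ⟨fun hw hwx => x.2 (by rw [← show w = x.1 from hwx]; exact hw), fun hw => ?_⟩
      by_contra hwS
      exact hw (congrArg Subtype.val (hx ⟨w, hwS⟩))
    refine h ⟨x.1, y.1, z.1, hS, fun h => x.2 (by rw [← h]; exact y.2),
      fun h => x.2 (by rw [← h]; exact z.2), hyz, fun w => ?_, fun w => ?_⟩
    · by_cases hw : w ∈ S
      · exact .inr ((hI ⟨w, hw⟩).imp (congrArg Subtype.val) (congrArg Subtype.val))
      · exact .inl (congrArg Subtype.val (hx ⟨w, hw⟩))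
    · by_cases hw : w ∈ S
      · exact h1.2 ⟨w, hw⟩
      · exact hc ((⟨w, hw⟩ : {x : I // x ∉ S}) : WithBot {x : I // x ∉ S})
  · exact convTerm_gamma_eq_zero_of_inner o S (gamma_black_eq_zero _ h1)

theorem convTerm_gamma_black_white_eq_zero [Finite I] (o : LinearOrder I) (S : Set I) :
    (gra K d).toOperadData.convTerm d 1 (gamma K d) (gamma K d) ⟨I, o, c, .black⟩ .white S = 0 := by
  refine convTerm_gamma_eq_zero_of_outer o S (gamma_black_eq_zero _ ?_)
  rintro ⟨_, hc⟩
  cases (show Colour.white = .black from hc ⊥)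

theorem conv_gamma_black [Finite I] (o : LinearOrder I) (c : I → Colour) :
    (gra K d).toOperadData.conv d 1 (gamma K d) (gamma K d) ⟨I, o, c, .black⟩ = 0 := by
  classical
  cases nonempty_fintype I
  unfold OperadData.conv
  dsimp only
  simp only [convTerm_gamma_black_white_eq_zero, add_zero]
  by_cases h : ∃ x y z, o.lt x y ∧ o.lt y z ∧ (∀ w, w = x ∨ w = y ∨ w = z) ∧ ∀ w, c w = .black
  · obtain ⟨x, y, z, hxy, hyz, hI, hc⟩ := h
    have hxz : o.lt x z := @lt_trans _ o.toPreorder _ _ _ hxy hyz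
    have hne : ∀ {x y : I}, o.lt x y → x ≠ y := fun h h' =>
      @lt_irrefl _ o.toPreorder _ (by rw [h'] at h; exact h)
    have hasymm : ∀ {x y : I}, o.lt x y → ¬ o.lt y x := fun h h' =>
      @lt_asymm _ o.toPreorder _ _ h h'
    have hinj : Function.Injective fun x : I => ({x}ᶜ : Set I) :=
      compl_injective.comp Set.singleton_injective
    have huniv : (Finset.univ : Finset I) = {x, y, z} := by
      ext w
      simpa using hI w
    have hsum := Fintype.sum_of_injective _ hinj
      (fun x => (gra K d).toOperadData.convTerm d 1 (gamma K d) (gamma K d) ⟨I, o, c, .black⟩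
        .black {x}ᶜ)
      (fun S => (gra K d).toOperadData.convTerm d 1 (gamma K d) (gamma K d) ⟨I, o, c, .black⟩
        .black S) (fun S hS => convTerm_gamma_black_black_eq_zero o (by
          rintro ⟨x, _, _, rfl, _⟩
          exact hS ⟨x, rfl⟩)) fun _ => rfl
    rw [finsum_eq_sum_of_fintype, ← hsum, huniv, Finset.sum_insert (by simp [hne hxy, hne hxz]),
      Finset.sum_pair (hne hyz),
      convTerm_gamma_compl_singleton o hc (hne hxy).symm (hne hxz).symm hyz hI,
      convTerm_gamma_compl_singleton o hc (hne hxy) (hne hyz).symm hxz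
        fun w => or_left_comm.1 (hI w),
      convTerm_gamma_compl_singleton o hc (hne hxz) (hne hyz) hxy
        fun w => or_rotate.2 (hI w)]
    simp only [if_pos hxy, if_pos hxz, if_pos hyz, if_neg (hasymm hxy), if_neg (hasymm hxz),
      if_neg (hasymm hyz)]
    rw [twoEdges_comm (y, x) (y, z), twoEdges_comm (z, x) (y, z), twoEdges_comm (x, y) (y, z),
      twoEdges_comm (x, z) (y, z), twoEdges_comm (y, x) (z, y), twoEdges_comm (z, x) (z, y),
      twoEdges_comm (x, y) (z, y), twoEdges_comm (x, z) (z, y), twoEdges_comm (x, y) (x, z),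
      twoEdges_comm (y, x) (x, z), twoEdges_comm (x, y) (z, x), twoEdges_comm (y, x) (z, x),
      Int.negOnePow_succ]
    rcases Int.units_eq_one_or d.negOnePow with hd | hd
    · simp only [hd, signScalar_neg, map_one, mul_one, neg_mul, one_mul, neg_neg, one_smul,
        neg_smul]
      abel
    · simp only [hd, signScalar_neg, map_one, mul_one, neg_neg, one_smul,
        neg_smul]
      abel
  · refine finsum_eq_zero_of_forall_eq_zero fun S => convTerm_gamma_black_black_eq_zero o ?_
    rintro ⟨x, y, z, _, hyx, hzx, hyz, hI, hc⟩
    rcases @lt_or_gt_of_ne _ o _ _ hyx with h1 | h1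
    · rcases @lt_or_gt_of_ne _ o _ _ hzx with h2 | h2
      · exact h ⟨y, z, x, hyz, h2, fun w => or_rotate.1 (hI w), hc⟩
      · exact h ⟨y, x, z, h1, h2, fun w => or_left_comm.1 (hI w), hc⟩
    · exact h ⟨x, y, z, h1, hyz, hI, hc⟩

/-! ### The Maurer-Cartan element `γ` -/

theorem isMaurerCartan_gamma [CharZero K] : IsMaurerCartan K d (gamma K d) where
  mem := gamma_mem_fOGC
  degree := gamma_hasDegree
  equation := by
    refine funext ?_
    rintro ⟨I, o, c, k⟩
    cases k with
    | white => exact conv_gamma_white o c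
    | black => exact conv_gamma_black o c

theorem gamma_blackProfile : gamma K d blackProfile =
    (GraObj.graph d _ _ arrow + (d + 1).negOnePow • GraObj.graph d _ _ arrowRev :
      GraObj K d blackProfile.c blackProfile.k) := by
  have h : gamma K d ⟨Fin 2, inferInstance, fun _ => .black, .black⟩ = _ :=
    gamma_black_of_pair (K := K) (d := d) (inferInstance : LinearOrder (Fin 2)) (y := 0) (z := 1)
      Fin.zero_lt_one (fun x => by fin_cases x <;> simp) fun _ => rfl
  refine h.trans ?_
  have h1 : edgeGraph K d (fun _ : Fin 2 => Colour.black) .black 0 1 =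
      (show GraSpace K d _ _ from GraObj.graph d _ _ arrow) := (graph_eq_orderedGraph _).symm
  have h2 : edgeGraph K d (fun _ : Fin 2 => Colour.black) .black 1 0 =
      (show GraSpace K d _ _ from GraObj.graph d _ _ arrowRev) := (graph_eq_orderedGraph _).symm
  rw [h1, h2]
  exact congrArg (fun x : GraSpace K d (fun _ : Fin 2 => Colour.black) .black =>
      (show GraSpace K d _ _ from GraObj.graph d _ _ arrow) + x)
    (units_smul_eq K (M := GraSpace K d (fun _ : Fin 2 => Colour.black) .black) (d + 1).negOnePow
      (GraObj.graph d (fun _ : Fin 2 => Colour.black) .black arrowRev)).symm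

theorem starColour_eq_black_iff (n : ℕ) (x : Fin (n + 1)) : starColour n x = .black ↔ x = 0 := by
  cases x using Fin.cases with
  | zero => exact iff_of_true rfl rfl
  | succ j => exact iff_of_false (by simp [starColour]) (Fin.succ_ne_zero j)

theorem gamma_starProfile [CharZero K] (n : ℕ) : gamma K d (starProfile n) =
    (GraObj.graph d _ _ (star n) : GraObj K d (starProfile n).c (starProfile n).k) := by
  have h : gamma K d ⟨Fin (n + 1), inferInstance, starColour n, .white⟩ = _ :=
    gamma_white_of_unique (K := K) (d := d) inferInstance (starColour_eq_black_iff n)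
  refine h.trans ?_
  let φ : Fin n ≃ {x : Fin (n + 1) // starColour n x = .white} :=
    Equiv.ofBijective (fun j => ⟨j.succ, rfl⟩)
      ⟨fun i j hij => Fin.succ_injective _ (congrArg Subtype.val hij), by
        rintro ⟨w, hw⟩
        cases w using Fin.cases with
        | zero => cases (show Colour.black = .white from hw)
        | succ j => exact ⟨j, rfl⟩⟩
  refine (orderedGraph_congr φ inferInstance _ (fun x y hxy => ?_) _).symm.trans
    (graph_eq_orderedGraph _).symm
  exact Fin.succ_lt_succ_iff.2 hxy

end HolieGra

theorem proposition3p3 {K : Type*} [Field K] [CharZero K] (d : ℤ) :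
    -- the morphism and its values on all generating corollas
    (∃ f : HolieGra.DGOperadHom (HolieGra.holie K d) (HolieGra.gra K d),
      f.map (HolieGra.holieGen K d HolieGra.blackProfile) =
        (HolieGra.GraObj.graph d _ _ HolieGra.arrow +
          (d + 1).negOnePow • HolieGra.GraObj.graph d _ _ HolieGra.arrowRev :
          HolieGra.GraObj K d HolieGra.blackProfile.c HolieGra.blackProfile.k) ∧
      (∀ n : ℕ, f.map (HolieGra.holieGen K d (HolieGra.starProfile n)) =
        (HolieGra.GraObj.graph d _ _ (HolieGra.star n) :
          HolieGra.GraObj K d (HolieGra.starProfile n).c (HolieGra.starProfile n).k)) ∧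
      (∀ p : HolieGra.Profile, p.k = .black → Nat.card p.I ≠ 2 →
        f.map (HolieGra.holieGen K d p) = 0) ∧
      (∀ p : HolieGra.Profile, p.k = .white → Nat.card {i // p.c i = .black} ≠ 1 →
        f.map (HolieGra.holieGen K d p) = 0) ∧
      f.onGenerators = HolieGra.gamma K d) ∧
    -- the element `γ` is a Maurer-Cartan element of the connected deformation complex
    (HolieGra.gamma K d ∈ HolieGra.OGChat K d ∧
      HolieGra.IsMaurerCartan K d (HolieGra.gamma K d)) ∧
    -- Maurer-Cartan elements and morphisms correspond to each other
    ∀ F : HolieGra.GraFamily K d, HolieGra.IsMaurerCartan K d F ↔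
      ∃! f : HolieGra.DGOperadHom (HolieGra.holie K d) (HolieGra.gra K d),
        f.onGenerators = F := by
  refine ⟨?_, ⟨HolieGra.gamma_mem_OGChat, HolieGra.isMaurerCartan_gamma⟩,
    HolieGra.isMaurerCartan_iff⟩
  obtain ⟨f, hf, -⟩ := (HolieGra.isMaurerCartan_iff (HolieGra.gamma K d)).1
    HolieGra.isMaurerCartan_gamma
  refine ⟨f, (congrFun hf HolieGra.blackProfile).trans HolieGra.gamma_blackProfile,
    fun n => (congrFun hf (HolieGra.starProfile n)).trans (HolieGra.gamma_starProfile n), ?_, ?_,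
      hf⟩
  · rintro ⟨I, o, c, k⟩ hk hcard
    obtain rfl : k = .black := hk
    exact (congrFun hf ⟨I, o, c, .black⟩).trans
      (HolieGra.gamma_black_eq_zero o fun h => hcard h.1)
  · rintro ⟨I, o, c, k⟩ hk hcard
    obtain rfl : k = .white := hk
    exact (congrFun hf ⟨I, o, c, .white⟩).trans
      (HolieGra.gamma_white_eq_zero o fun ⟨b, hb⟩ => hcard (HolieGra.card_black_of_unique hb))
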